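/- Notation. For a discrete group $\Gamma$ let $\lambda$ be the left regular representation on $\ell^2(\Gamma)$, $L(\Gamma)=\lambda(\Gamma)''$ the group von Neumann algebra and $\tau(x)=\langle\delta_e,x\delta_e\rangle$ its canonical tracial state. *Amalgamated free products.* Let $\iota_s:D\to N_s$ ($s=1,2$) be injective normal unital $*$-homomorphisms of von Neumann algebras and $E_s:N_s\to\iota_s(D)$ faithful normal conditional expectations. The reduced amalgamated free product $(\mathcal N,\mathcal E)=(N_1,E_1:\iota_1)\bigstar_D(N_2,E_2:\iota_2)$ consists of a von Neumann algebra $\mathcal N$ generated by the images of injective normal unital $*$-homomorphisms $\lambda_s:N_s\to\mathcal N$ with $\lambda_1\circ\iota_1=\lambda_2\circ\iota_2=:\lambda$, and a faithful normal conditional expectation $\mathcal E:\mathcal N\to\lambda(D)$ such that $\mathcal E\circ\lambda_s=\lambda_s\circ E_s$ and $\mathcal E(\lambda_{s_1}(x_1)\cdots\lambda_{s_n}(x_n))=0$ whenever $n\ge1$, $s_1\ne s_2\ne\cdots\ne s_n$ and $x_j\in\ker E_{s_j}$. *Reduced HNN extensions.* Let $D\subseteq N$ be von Neumann algebras, $\theta:D\to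 N$ an injective normal unital $*$-homomorphism, and $E_D:N\to D$, $E_{\theta(D)}:N\to\theta(D)$ faithful normal conditional expectations. Index $2\times2$ matrices by $\{1,\theta\}$, with matrix units $e_{ij}$, and form $$(\mathcal N,\mathcal E)=\bigl(M_2(N),\operatorname{diag}(E_D,E_{\theta(D)}):\operatorname{diag}(\mathrm{id},\theta)\bigr)\bigstar_{D\oplus D}\bigl(M_2(N),\operatorname{diag}(E_D,E_D):\text{inclusion}\bigr),$$ where $D\oplus D$ is the algebra of diagonal matrices over $D$ and $\operatorname{diag}(E,E')$ maps $[x_{ij}]$ to the diagonal matrix with entries $E(x_{11}),E'(x_{\theta\theta})$. Let $\lambda_\theta,\lambda_1$ be the embeddings of the two factors, and $\mathcal E_\theta$ the faithful normal conditional expectation of $\mathcal N$ onto $\lambda_\theta(M_2(N))$ with $\mathcal E\circ\mathcal E_\theta=\mathcal E$. Put $\pi(n)=\lambda_\theta(n\otimes e_{11})$, $p=\pi(1)$ and $u(\theta)=\lambda_1(e_{1\theta})\lambda_\theta(e_{\theta1})$. The reduced HNN extension of $N$ by $\theta$ with respect to $E_D,E_{\theta(D)}$ is the pair $(M,E^M_{\pi(N)})$,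 where $M\subseteq p\mathcal Np$ is the von Neumann algebra (with unit $p$) generated by $\pi(N)$ and the stable unitary $u(\theta)$, and $E^M_{\pi(N)}=\mathcal E_\theta|_M:M\to\pi(N)$. **Corollary 3.5.** Let $G$ be a group, $H$ a subgroup, $\theta:H\to G$ an injective homomorphism, and let $\Gamma=G*_H\theta=\langle G,t : t\theta(h)t^{-1}=h,\ h\in H\rangle$ be the HNN extension. Let $L(H)=\lambda(H)''\subseteq L(G)$. Then the homomorphisms $\theta$ and $G\to\Gamma$ induce injective normal unital $*$-homomorphisms $\Theta:L(H)\to L(G)$, $\Theta(\lambda(h))=\lambda(\theta(h))$, and $j:L(G)\to L(\Gamma)$, $j(\lambda(g))=\lambda(g)$; there are $\tau$-preserving faithful normal conditional expectations $E_{L(H)}:L(G)\to L(H)$, $E_{\Theta(L(H))}:L(G)\to\Theta(L(H))$ and $E:L(\Gamma)\to j(L(G))$; and $(L(\Gamma),E)$ is the reduced HNN extension of $L(G)$ by $\Theta$ with respect to $E_{L(H)}$ and $E_{\Theta(L(H))}$, with stable unitary $\lambda(t)$. That is, the free product $(\mathcal N,\mathcal E)$ and the expectation $\mathcal E_\theta$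 above exist for $N=L(G)$, $D=L(H)$ and $\Theta$ in place of $\theta$, and for every realization of them there is a normal $*$-isomorphism $\Phi$ of $L(\Gamma)$ onto $M$ such that $\Phi\circ j=\pi$, $\Phi(\lambda(t))=u(\Theta)$ and $\Phi\circ E=E^M_{\pi(N)}\circ\Phi$. -/

import Mathlib

open scoped InnerProductSpace

universe u v

noncomputable section

namespace VonNeumannAlgebra

variable {H : Type*} [NormedAddCommGroup H] [InnerProductSpace ℂ H] [CompleteSpace H]

/-- The elements of a von Neumann algebra, as a unital `*`-algebra over `ℂ`. -/
abbrev Elem (N : VonNeumannAlgebra H) : Type _ := ↥N.toStarSubalgebra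

/-- The von Neumann algebra `(S ∪ S*)''` generated by a set `S` of bounded operators. -/
def generatedBy (S : Set (H →L[ℂ] H)) : VonNeumannAlgebra H where
  toStarSubalgebra := StarSubalgebra.centralizer ℂ
    (StarSubalgebra.centralizer ℂ S : Set (H →L[ℂ] H))
  centralizer_centralizer' := by
    change Set.centralizer (Set.centralizer
      (StarSubalgebra.centralizer ℂ (StarSubalgebra.centralizer ℂ S : Set (H →L[ℂ] H)) :
        Set (H →L[ℂ] H))) =
      (StarSubalgebra.centralizer ℂ (StarSubalgebra.centralizer ℂ S : Set (H →L[ℂ] H)) :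
        Set (H →L[ℂ] H))
    rw [StarSubalgebra.coe_centralizer_centralizer, Set.centralizer_centralizer_centralizer]

theorem subset_generatedBy (S : Set (H →L[ℂ] H)) :
    S ⊆ (generatedBy S : Set (H →L[ℂ] H)) := by
  intro x hx
  change x ∈ StarSubalgebra.centralizer ℂ (StarSubalgebra.centralizer ℂ S : Set (H →L[ℂ] H))
  exact StarAlgebra.adjoin_le_centralizer_centralizer ℂ S
    (StarAlgebra.subset_adjoin ℂ S hx)

theorem generatedBy_mono {S T : Set (H →L[ℂ] H)} (h : S ⊆ T) :
    generatedBy S ≤ generatedBy T :=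
  StarSubalgebra.centralizer_le ℂ _ _ (StarSubalgebra.centralizer_le ℂ _ _ h)

/-- The inclusion of a von Neumann subalgebra `D` of `N`. -/
abbrev incl {D N : VonNeumannAlgebra H} (h : D ≤ N) : D.Elem →⋆ₐ[ℂ] N.Elem :=
  StarSubalgebra.inclusion (S₁ := D.toStarSubalgebra) (S₂ := N.toStarSubalgebra) h

end VonNeumannAlgebra

section Normality

variable {H : Type*} [NormedAddCommGroup H] [InnerProductSpace ℂ H] [CompleteSpace H]
variable {K : Type*} [NormedAddCommGroup K] [InnerProductSpace ℂ K] [CompleteSpace K]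

/-- Normality of a positive linear map `f : N → P` between von Neumann algebras: the composition
of every vector functional of `P` with `f` is a normal positive functional on `N`, i.e. of the form
`x ↦ ∑ₙ ⟨ζₙ, x ζₙ⟩` with `∑ₙ ‖ζₙ‖² < ∞`. -/
def IsNormalMap (N : VonNeumannAlgebra H) (P : VonNeumannAlgebra K) (f : N.Elem → P.Elem) :
    Prop :=
  ∀ ξ : K, ∃ ζ : ℕ → H, Summable (fun n => ‖ζ n‖ ^ 2) ∧
    ∀ x : N.Elem, HasSum (fun n => ⟪ζ n, (x : H →L[ℂ] H) (ζ n)⟫_ℂ)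
      ⟪ξ, (f x : K →L[ℂ] K) ξ⟫_ℂ

/-- `E` is a faithful normal conditional expectation from the von Neumann algebra `N` onto its
`*`-subalgebra `B`. -/
structure IsFaithfulNormalCondExp (N : VonNeumannAlgebra H) (B : StarSubalgebra ℂ N.Elem)
    (E : N.Elem →ₗ[ℂ] N.Elem) : Prop where
  mem : ∀ x, E x ∈ B
  id_on : ∀ b ∈ B, E b = b
  bimodule : ∀ a ∈ B, ∀ b ∈ B, ∀ x, E (a * x * b) = a * E x * b
  positive : ∀ x, ((E (star x * x) : N.Elem) : H →L[ℂ] H).IsPositive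
  faithful : ∀ x, E (star x * x) = 0 → x = 0
  normal : IsNormalMap N N E

end Normality

section FreeProduct

variable {H₀ : Type*} [NormedAddCommGroup H₀] [InnerProductSpace ℂ H₀] [CompleteSpace H₀]
variable {H₁ : Type*} [NormedAddCommGroup H₁] [InnerProductSpace ℂ H₁] [CompleteSpace H₁]
variable {H₂ : Type*} [NormedAddCommGroup H₂] [InnerProductSpace ℂ H₂] [CompleteSpace H₂]
variable {K : Type*} [NormedAddCommGroup K] [InnerProductSpace ℂ K] [CompleteSpace K]

/-- `(P, E)`, with embeddings `lam₁, lam₂, lam` of `N₁, N₂, D`, is the reduced amalgamated free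
product `(N₁, E₁ : ι₁) ★_D (N₂, E₂ : ι₂)` of von Neumann algebras: the two copies agree on `D`,
they generate `P`, and they are free with amalgamation over `lam(D)` with respect to the faithful
normal conditional expectation `E`, which restricts to the given `E₁, E₂`. -/
structure IsAmalgamatedFreeProduct
    (D : VonNeumannAlgebra H₀) (N₁ : VonNeumannAlgebra H₁) (N₂ : VonNeumannAlgebra H₂)
    (ι₁ : D.Elem →⋆ₐ[ℂ] N₁.Elem) (ι₂ : D.Elem →⋆ₐ[ℂ] N₂.Elem)
    (E₁ : N₁.Elem →ₗ[ℂ] N₁.Elem) (E₂ : N₂.Elem →ₗ[ℂ] N₂.Elem)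
    (P : VonNeumannAlgebra K)
    (lam₁ : N₁.Elem →⋆ₐ[ℂ] P.Elem) (lam₂ : N₂.Elem →⋆ₐ[ℂ] P.Elem) (lam : D.Elem →⋆ₐ[ℂ] P.Elem)
    (E : P.Elem →ₗ[ℂ] P.Elem) : Prop where
  injective₁ : Function.Injective lam₁
  injective₂ : Function.Injective lam₂
  normal₁ : IsNormalMap N₁ P lam₁
  normal₂ : IsNormalMap N₂ P lam₂
  amalgam₁ : ∀ d, lam₁ (ι₁ d) = lam d
  amalgam₂ : ∀ d, lam₂ (ι₂ d) = lam d
  generates : P = VonNeumannAlgebra.generatedBy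
    (Set.range (fun x => (lam₁ x : K →L[ℂ] K)) ∪ Set.range (fun x => (lam₂ x : K →L[ℂ] K)))
  condExp : IsFaithfulNormalCondExp P lam.range E
  compatible₁ : ∀ x, E (lam₁ x) = lam₁ (E₁ x)
  compatible₂ : ∀ x, E (lam₂ x) = lam₂ (E₂ x)
  /-- Nonempty alternating words in the kernels of `E₁` and `E₂` are annihilated by `E`. -/
  free : ∀ w : List (N₁.Elem ⊕ N₂.Elem), w ≠ [] →
    w.IsChain (fun a b => a.isLeft ≠ b.isLeft) →
    (∀ x, Sum.inl x ∈ w → E₁ x = 0) → (∀ x, Sum.inr x ∈ w → E₂ x = 0) →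
    E (w.map (Sum.elim lam₁ lam₂)).prod = 0

end FreeProduct

/-! ### Two by two operator matrices -/

section Matrices

variable (H : Type*) [NormedAddCommGroup H] [InnerProductSpace ℂ H] [CompleteSpace H]

/-- The Hilbert space `H ⊗ ℓ²({1, θ}) = H ⊕ H`; the index `0` stands for `1`, and the index `1`
for `θ`. -/
abbrev Doubled : Type _ := PiLp 2 (fun _ : Fin 2 => H)

variable {H}

set_option linter.unusedSectionVars false

/-- The inclusion of the `i`-th summand. -/
def blockIn (i : Fin 2) : H →L[ℂ] Doubled H :=
  ((PiLp.continuousLinearEquiv 2 ℂ (fun _ : Fin 2 => H)).symm :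
    (Fin 2 → H) →L[ℂ] Doubled H) ∘L ContinuousLinearMap.single ℂ (fun _ : Fin 2 => H) i

/-- The projection onto the `i`-th summand. -/
def blockOut (i : Fin 2) : Doubled H →L[ℂ] H := PiLp.proj 2 (fun _ : Fin 2 => H) i

/-- The `(i, j)` entry of an operator on `H ⊕ H`. -/
def entry (x : Doubled H →L[ℂ] Doubled H) (i j : Fin 2) : H →L[ℂ] H :=
  blockOut i ∘L x ∘L blockIn j

/-- The operator on `H ⊕ H` with given entries. -/
def ofBlocks (a : Matrix (Fin 2) (Fin 2) (H →L[ℂ] H)) : Doubled H →L[ℂ] Doubled H :=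
  ∑ i, ∑ j, blockIn i ∘L a i j ∘L blockOut j

theorem entry_apply (x : Doubled H →L[ℂ] Doubled H) (i j : Fin 2) (ξ : H) :
    entry x i j ξ = x (PiLp.single 2 j ξ) i := rfl

theorem doubled_eq_sum (ξ : Doubled H) : ξ = ∑ j, PiLp.single 2 j (ξ j) := by
  ext i
  fin_cases i <;> simp

theorem apply_eq_sum_entry (x : Doubled H →L[ℂ] Doubled H) (ξ : Doubled H) (i : Fin 2) :
    x ξ i = ∑ j, entry x i j (ξ j) := by
  conv_lhs => rw [doubled_eq_sum ξ]
  simp [entry_apply]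

theorem entry_ext {x y : Doubled H →L[ℂ] Doubled H} (h : ∀ i j, entry x i j = entry y i j) :
    x = y := by
  ext ξ i
  rw [apply_eq_sum_entry, apply_eq_sum_entry]
  simp [h]

@[simp] theorem entry_ofBlocks (a : Matrix (Fin 2) (Fin 2) (H →L[ℂ] H)) (i j : Fin 2) :
    entry (ofBlocks a) i j = a i j := by
  ext ξ
  fin_cases i <;> fin_cases j <;> simp [entry_apply, ofBlocks, blockIn, blockOut]

@[simp] theorem entry_add (x y : Doubled H →L[ℂ] Doubled H) (i j : Fin 2) :
    entry (x + y) i j = entry x i j + entry y i j := by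
  ext ξ; simp [entry_apply]

@[simp] theorem entry_smul (c : ℂ) (x : Doubled H →L[ℂ] Doubled H) (i j : Fin 2) :
    entry (c • x) i j = c • entry x i j := by
  ext ξ; simp [entry_apply]

@[simp] theorem entry_zero (i j : Fin 2) :
    entry (0 : Doubled H →L[ℂ] Doubled H) i j = 0 := by
  ext ξ; simp [entry_apply]

theorem entry_mul (x y : Doubled H →L[ℂ] Doubled H) (i j : Fin 2) :
    entry (x * y) i j = ∑ k, entry x i k * entry y k j := by
  ext ξ
  rw [entry_apply, mul_apply_eq_comp, apply_eq_sum_entry]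
  simp [entry_apply]

theorem entry_one (i j : Fin 2) :
    entry (1 : Doubled H →L[ℂ] Doubled H) i j = if i = j then 1 else 0 := by
  ext ξ
  fin_cases i <;> fin_cases j <;> simp [entry_apply]

theorem entry_algebraMap (c : ℂ) (i j : Fin 2) :
    entry (algebraMap ℂ (Doubled H →L[ℂ] Doubled H) c) i j =
      if i = j then algebraMap ℂ (H →L[ℂ] H) c else 0 := by
  rw [Algebra.algebraMap_eq_smul_one, entry_smul, entry_one, Algebra.algebraMap_eq_smul_one]
  split_ifs <;> simp

@[simp] theorem entry_star (x : Doubled H →L[ℂ] Doubled H) (i j : Fin 2) :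
    entry (star x) i j = star (entry x j i) := by
  rw [ContinuousLinearMap.star_eq_adjoint, ContinuousLinearMap.star_eq_adjoint,
    ContinuousLinearMap.eq_adjoint_iff]
  have key : ∀ (z : Doubled H) (k : Fin 2) (η : H),
      ⟪z, PiLp.single 2 k η⟫_ℂ = ⟪z k, η⟫_ℂ := by
    intro z k η
    fin_cases k <;> simp [PiLp.inner_apply]
  have key' : ∀ (z : Doubled H) (k : Fin 2) (η : H),
      ⟪PiLp.single 2 k η, z⟫_ℂ = ⟪η, z k⟫_ℂ := by
    intro z k η
    fin_cases k <;> simp [PiLp.inner_apply]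
  intro ξ η
  rw [entry_apply, entry_apply, ← key, ContinuousLinearMap.adjoint_inner_left, key']

/-- `N ⊗ B(ℓ²({1, θ})) = M₂(N)`, acting on `H ⊕ H`. -/
def matVN (N : VonNeumannAlgebra H) : VonNeumannAlgebra (Doubled H) where
  carrier := {x | ∀ i j, entry x i j ∈ N}
  mul_mem' {x y} hx hy i j := by
    rw [entry_mul]
    exact sum_mem fun k _ => mul_mem (hx i k) (hy k j)
  add_mem' {x y} hx hy i j := by
    rw [entry_add]
    exact add_mem (hx i j) (hy i j)
  algebraMap_mem' c i j := by
    rw [entry_algebraMap]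
    split_ifs
    · exact N.algebraMap_mem' c
    · exact zero_mem N
  star_mem' {x} hx i j := by
    rw [entry_star]
    exact star_mem (hx j i)
  centralizer_centralizer' := by
    refine Set.Subset.antisymm (fun x hx i j => ?_) Set.subset_centralizer_centralizer
    have hN : (entry x i j) ∈ Set.centralizer (Set.centralizer (N : Set (H →L[ℂ] H))) := by
      intro T hT
      have h := hx (ofBlocks (Matrix.diagonal fun _ => T)) (by
        intro y hy
        refine entry_ext fun k l => ?_
        have := hT _ (hy k l)
        fin_cases k <;> fin_cases l <;>
          simpa [entry_mul, Matrix.diagonal] using this)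
      have h' := congrArg (fun z => entry z i j) h
      fin_cases i <;> fin_cases j <;> simpa [entry_mul, Matrix.diagonal] using h'
    rwa [N.centralizer_centralizer] at hN

/-- `D ⊗ ℓ^∞({1, θ})`, the diagonal matrices with entries in `D`, acting on `H ⊕ H`. -/
def diagVN (D : VonNeumannAlgebra H) : VonNeumannAlgebra (Doubled H) where
  carrier := {x | (∀ i, entry x i i ∈ D) ∧ ∀ i j, i ≠ j → entry x i j = 0}
  mul_mem' {x y} hx hy := by
    have h01 := hx.2 0 1 (by decide)
    have h10 := hx.2 1 0 (by decide)
    have k01 := hy.2 0 1 (by decide)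
    have k10 := hy.2 1 0 (by decide)
    constructor
    · intro i
      have := mul_mem (hx.1 i) (hy.1 i)
      fin_cases i <;> simpa [entry_mul, h01, h10] using this
    · intro i j hij
      fin_cases i <;> fin_cases j <;> simp_all [entry_mul]
  add_mem' {x y} hx hy := by
    refine ⟨fun i => ?_, fun i j hij => ?_⟩
    · rw [entry_add]
      exact add_mem (hx.1 i) (hy.1 i)
    · rw [entry_add, hx.2 i j hij, hy.2 i j hij, add_zero]
  algebraMap_mem' c := by
    refine ⟨fun i => ?_, fun i j hij => ?_⟩
    · rw [entry_algebraMap, if_pos rfl]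
      exact D.algebraMap_mem' c
    · rw [entry_algebraMap, if_neg hij]
  star_mem' {x} hx := by
    refine ⟨fun i => ?_, fun i j hij => ?_⟩
    · rw [entry_star]
      exact star_mem (hx.1 i)
    · rw [entry_star, hx.2 j i hij.symm, star_zero]
  centralizer_centralizer' := by
    refine Set.Subset.antisymm (fun x hx => ?_) Set.subset_centralizer_centralizer
    have comm : ∀ T S : H →L[ℂ] H, T ∈ Set.centralizer (D : Set (H →L[ℂ] H)) →
        S ∈ Set.centralizer (D : Set (H →L[ℂ] H)) →
        ofBlocks (Matrix.diagonal ![T, S]) * x = x * ofBlocks (Matrix.diagonal ![T, S]) := by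
      intro T S hT hS
      refine hx _ ?_
      intro y hy
      have k01 := hy.2 0 1 (by decide)
      have k10 := hy.2 1 0 (by decide)
      refine entry_ext fun k l => ?_
      have t0 := hT _ (hy.1 0)
      have t1 := hS _ (hy.1 1)
      fin_cases k <;> fin_cases l <;> simp_all [entry_mul, Matrix.diagonal]
    constructor
    · intro i
      have hD : (entry x i i) ∈ Set.centralizer (Set.centralizer (D : Set (H →L[ℂ] H))) := by
        intro T hT
        have h' := congrArg (fun z => entry z i i) (comm T T hT hT)
        fin_cases i <;> simpa [entry_mul, Matrix.diagonal] using h'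
      rwa [D.centralizer_centralizer] at hD
    · intro i j hij
      have h := comm 1 0 (by simp [Set.mem_centralizer_iff]) (by simp [Set.mem_centralizer_iff])
      have h01 := congrArg (fun z => entry z 0 1) h
      have h10 := congrArg (fun z => entry z 1 0) h
      simp only [entry_mul, Fin.sum_univ_two, entry_ofBlocks] at h01 h10
      simp [Matrix.diagonal] at h01 h10
      fin_cases i <;> fin_cases j <;> simp_all

theorem mem_matVN {N : VonNeumannAlgebra H} {x : Doubled H →L[ℂ] Doubled H} :
    x ∈ (matVN N).toStarSubalgebra ↔ ∀ i j, entry x i j ∈ N := Iff.rfl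

theorem mem_diagVN {D : VonNeumannAlgebra H} {x : Doubled H →L[ℂ] Doubled H} :
    x ∈ (diagVN D).toStarSubalgebra ↔
      (∀ i, entry x i i ∈ D) ∧ ∀ i j, i ≠ j → entry x i j = 0 := Iff.rfl

theorem diagVN_le_matVN {D N : VonNeumannAlgebra H} (h : D ≤ N) : diagVN D ≤ matVN N := by
  intro x hx i j
  by_cases hij : i = j
  · subst hij
    exact h (hx.1 i)
  · rw [hx.2 i j hij]
    exact zero_mem N

/-- The `(i, j)` entry of an element of `M₂(N)`, as an element of `N`. -/
def matEntry {N : VonNeumannAlgebra H} (x : (matVN N).Elem) (i j : Fin 2) : N.Elem :=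
  ⟨entry (x : Doubled H →L[ℂ] Doubled H) i j, x.2 i j⟩

/-- The `i`-th diagonal entry of an element of `D ⊗ ℓ^∞({1, θ})`, as an element of `D`. -/
def diagEntry {D : VonNeumannAlgebra H} (x : (diagVN D).Elem) (i : Fin 2) : D.Elem :=
  ⟨entry (x : Doubled H →L[ℂ] Doubled H) i i, x.2.1 i⟩

/-- The element of `M₂(N)` with given entries. -/
def matOf {N : VonNeumannAlgebra H} (a : Matrix (Fin 2) (Fin 2) N.Elem) : (matVN N).Elem :=
  ⟨ofBlocks (a.map Subtype.val), fun i j => by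
    rw [entry_ofBlocks]
    exact (a i j).2⟩

@[simp] theorem matEntry_matOf {N : VonNeumannAlgebra H} (a : Matrix (Fin 2) (Fin 2) N.Elem)
    (i j : Fin 2) : matEntry (matOf a) i j = a i j :=
  Subtype.ext (entry_ofBlocks (a.map Subtype.val) i j)

theorem matEntry_ext {N : VonNeumannAlgebra H} {x y : (matVN N).Elem}
    (h : ∀ i j, matEntry x i j = matEntry y i j) : x = y :=
  Subtype.ext (entry_ext fun i j => congrArg Subtype.val (h i j))

theorem matEntry_mul {N : VonNeumannAlgebra H} (x y : (matVN N).Elem) (i j : Fin 2) :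
    matEntry (x * y) i j = ∑ k, matEntry x i k * matEntry y k j := by
  apply Subtype.ext
  simp [matEntry, entry_mul]

theorem matEntry_star {N : VonNeumannAlgebra H} (x : (matVN N).Elem) (i j : Fin 2) :
    matEntry (star x) i j = star (matEntry x j i) :=
  Subtype.ext (entry_star _ i j)

theorem matEntry_add {N : VonNeumannAlgebra H} (x y : (matVN N).Elem) (i j : Fin 2) :
    matEntry (x + y) i j = matEntry x i j + matEntry y i j :=
  Subtype.ext (entry_add _ _ i j)

theorem matEntry_smul {N : VonNeumannAlgebra H} (c : ℂ) (x : (matVN N).Elem) (i j : Fin 2) :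
    matEntry (c • x) i j = c • matEntry x i j :=
  Subtype.ext (entry_smul c _ i j)

theorem matEntry_algebraMap {N : VonNeumannAlgebra H} (c : ℂ) (i j : Fin 2) :
    matEntry (algebraMap ℂ (matVN N).Elem c) i j =
      if i = j then algebraMap ℂ N.Elem c else 0 := by
  apply Subtype.ext
  refine (entry_algebraMap c i j).trans ?_
  split_ifs <;> rfl

theorem diagEntry_mul {D : VonNeumannAlgebra H} (x y : (diagVN D).Elem) (i : Fin 2) :
    diagEntry (x * y) i = diagEntry x i * diagEntry y i := by
  apply Subtype.ext
  have h01 := x.2.2 0 1 (by decide)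
  have h10 := x.2.2 1 0 (by decide)
  fin_cases i <;> simp [diagEntry, entry_mul, h01, h10]

theorem diagEntry_algebraMap {D : VonNeumannAlgebra H} (c : ℂ) (i : Fin 2) :
    diagEntry (algebraMap ℂ (diagVN D).Elem c) i = algebraMap ℂ D.Elem c := by
  apply Subtype.ext
  exact (entry_algebraMap c i i).trans (if_pos rfl)

theorem diagEntry_star {D : VonNeumannAlgebra H} (x : (diagVN D).Elem) (i : Fin 2) :
    diagEntry (star x) i = star (diagEntry x i) :=
  Subtype.ext (entry_star _ i i)

theorem diagEntry_add {D : VonNeumannAlgebra H} (x y : (diagVN D).Elem) (i : Fin 2) :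
    diagEntry (x + y) i = diagEntry x i + diagEntry y i :=
  Subtype.ext (entry_add _ _ i i)

/-- The `*`-homomorphism `D ⊗ ℓ^∞({1, θ}) → M₂(N)`, `diag(d₀, d₁) ↦ diag(ι₀ d₀, ι₁ d₁)`. -/
def diagHom {D N : VonNeumannAlgebra H} (ι₀ ι₁ : D.Elem →⋆ₐ[ℂ] N.Elem) :
    (diagVN D).Elem →⋆ₐ[ℂ] (matVN N).Elem where
  toFun x := matOf (Matrix.diagonal ![ι₀ (diagEntry x 0), ι₁ (diagEntry x 1)])
  map_one' := by
    have h := diagEntry_algebraMap (D := D) 1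
    simp only [map_one] at h
    refine matEntry_ext fun i j => ?_
    have h1 := matEntry_algebraMap (N := N) 1 i j
    simp only [map_one] at h1
    rw [h1]
    fin_cases i <;> fin_cases j <;> simp [h, Matrix.diagonal]
  map_mul' x y := by
    refine matEntry_ext fun i j => ?_
    fin_cases i <;> fin_cases j <;> simp [matEntry_mul, diagEntry_mul, Matrix.diagonal]
  map_zero' := by
    have h := diagEntry_algebraMap (D := D) 0
    simp only [map_zero] at h
    refine matEntry_ext fun i j => ?_
    have h1 := matEntry_algebraMap (N := N) 0 i j
    simp only [map_zero] at h1
    rw [h1]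
    fin_cases i <;> fin_cases j <;> simp [h, Matrix.diagonal]
  map_add' x y := by
    refine matEntry_ext fun i j => ?_
    fin_cases i <;> fin_cases j <;> simp [matEntry_add, diagEntry_add, Matrix.diagonal]
  commutes' c := by
    refine matEntry_ext fun i j => ?_
    rw [matEntry_algebraMap]
    fin_cases i <;> fin_cases j <;>
      simp [diagEntry_algebraMap, Matrix.diagonal, AlgHomClass.commutes]
  map_star' x := by
    refine matEntry_ext fun i j => ?_
    fin_cases i <;> fin_cases j <;>
      simp [matEntry_star, diagEntry_star, Matrix.diagonal, map_star]

/-- The linear map `M₂(N) → M₂(N)`, `[x_{ij}] ↦ diag(E₀ x₀₀, E₁ x₁₁)`. -/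
def diagExp {N : VonNeumannAlgebra H} (E₀ E₁ : N.Elem →ₗ[ℂ] N.Elem) :
    (matVN N).Elem →ₗ[ℂ] (matVN N).Elem where
  toFun x := matOf (Matrix.diagonal ![E₀ (matEntry x 0 0), E₁ (matEntry x 1 1)])
  map_add' x y := by
    refine matEntry_ext fun i j => ?_
    fin_cases i <;> fin_cases j <;> simp [matEntry_add, Matrix.diagonal]
  map_smul' c x := by
    refine matEntry_ext fun i j => ?_
    fin_cases i <;> fin_cases j <;> simp [matEntry_smul, Matrix.diagonal]

end Matrices

/-! ### Reduced HNN extensions of von Neumann algebras -/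

section HNN

variable {H : Type u} [NormedAddCommGroup H] [InnerProductSpace ℂ H] [CompleteSpace H]

/-- The ambient data in the construction of the reduced HNN extension of a von Neumann algebra
`N ⊇ D` by `θ : D → N`, with respect to conditional expectations `ED : N → D` and
`Eθ : N → θ(D)`. It consists of the amalgamated free product
`(P, Exp) = (M₂(N), diag(ED, Eθ) : diag(id, θ)) ★_{D ⊕ D} (M₂(N), diag(ED, ED) : inclusion)`,
where `M₂(N) = N ⊗ B(ℓ²({1, θ}))` and `D ⊕ D = D ⊗ ℓ^∞({1, θ})`, and of the conditional expectation
from `P` onto its first free component that preserves `Exp`. -/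
structure HNNConstruction (N D : VonNeumannAlgebra H) (hD : D ≤ N)
    (θ : D.Elem →⋆ₐ[ℂ] N.Elem) (ED Eθ : N.Elem →ₗ[ℂ] N.Elem) where
  K : Type v
  [normedAddCommGroup : NormedAddCommGroup K]
  [innerProductSpace : InnerProductSpace ℂ K]
  [completeSpace : CompleteSpace K]
  P : VonNeumannAlgebra K
  lamθ : (matVN N).Elem →⋆ₐ[ℂ] P.Elem
  lam₁ : (matVN N).Elem →⋆ₐ[ℂ] P.Elem
  lam : (diagVN D).Elem →⋆ₐ[ℂ] P.Elem
  Exp : P.Elem →ₗ[ℂ] P.Elem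
  isAmalgamatedFreeProduct : IsAmalgamatedFreeProduct (diagVN D) (matVN N) (matVN N)
    (diagHom (VonNeumannAlgebra.incl hD) θ)
    (VonNeumannAlgebra.incl (diagVN_le_matVN hD))
    (diagExp ED Eθ) (diagExp ED ED) P lamθ lam₁ lam Exp
  Expθ : P.Elem →ₗ[ℂ] P.Elem
  condExp_Expθ : IsFaithfulNormalCondExp P lamθ.range Expθ
  Exp_Expθ : ∀ x, Exp (Expθ x) = Exp x

namespace HNNConstruction

attribute [instance] normedAddCommGroup innerProductSpace completeSpace

variable {N D : VonNeumannAlgebra H} {hD : D ≤ N} {θ : D.Elem →⋆ₐ[ℂ] N.Elem}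
  {ED Eθ : N.Elem →ₗ[ℂ] N.Elem}

/-- The embedding `π(n) = lamθ(n ⊗ e₁₁)` of the base algebra into the corner `p P p`, where
`p = π(1)`. -/
def base (X : HNNConstruction.{u, v} N D hD θ ED Eθ) (n : N.Elem) : X.P.Elem :=
  X.lamθ (matOf (Matrix.single 0 0 n))

/-- The stable unitary `u(θ) = lam₁(e_{1θ}) lamθ(e_{θ1})` in the corner `p P p`. -/
def stable (X : HNNConstruction.{u, v} N D hD θ ED Eθ) : X.P.Elem :=
  X.lam₁ (matOf (Matrix.single 0 1 1)) * X.lamθ (matOf (Matrix.single 1 0 1))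

/-- The reduced HNN extension `M = π(N) ∨ {u(θ)}''` inside the corner `p P p`; its conditional
expectation onto `π(N)` is the restriction of `Expθ`. -/
def algebra (X : HNNConstruction.{u, v} N D hD θ ED Eθ) : Set X.P.Elem :=
  {x | (x : X.K →L[ℂ] X.K) ∈ VonNeumannAlgebra.generatedBy
      (Set.range (fun n => (X.base n : X.K →L[ℂ] X.K)) ∪ {(X.stable : X.K →L[ℂ] X.K)}) ∧
    X.base 1 * x * X.base 1 = x}

end HNNConstruction

end HNN

/-! ### Group von Neumann algebras -/

section Groups

/-- The Hilbert space `ℓ²(G)`. -/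
abbrev ellTwo (G : Type*) : Type _ := lp (fun _ : G => ℂ) 2

/-- Precomposition with a permutation, on `ℓ²(G)`. -/
def permOp {G : Type*} (e : G ≃ G) : ellTwo G →L[ℂ] ellTwo G :=
  LinearMap.mkContinuous
    { toFun := fun ξ => ⟨fun k => ξ (e k), by
        have h2 : 0 < (2 : ENNReal).toReal := by norm_num
        have h := (lp.memℓp ξ).summable h2
        exact memℓp_gen ((e.summable_iff (f := fun k => ‖ξ k‖ ^ (2 : ENNReal).toReal)).2 h)⟩
      map_add' := fun _ _ => rfl
      map_smul' := fun _ _ => rfl } 1 (fun ξ => by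
        have h2 : 0 < (2 : ENNReal).toReal := by norm_num
        rw [one_mul, lp.norm_eq_tsum_rpow h2, lp.norm_eq_tsum_rpow h2]
        apply le_of_eq
        congr 1
        exact e.tsum_eq (fun k => ‖ξ k‖ ^ (2 : ENNReal).toReal))

variable {G : Type*} [Group G]

/-- The left regular representation, `(λ(g) ξ)(k) = ξ(g⁻¹ k)`. -/
def leftReg (g : G) : ellTwo G →L[ℂ] ellTwo G := permOp (Equiv.mulLeft g⁻¹)

theorem leftReg_apply (g : G) (ξ : ellTwo G) (k : G) : leftReg g ξ k = ξ (g⁻¹ * k) := rfl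

variable (G) in
/-- The group von Neumann algebra `L(G) = λ(G)''`. -/
def groupVN : VonNeumannAlgebra (ellTwo G) :=
  VonNeumannAlgebra.generatedBy (Set.range leftReg)

/-- The von Neumann subalgebra `L(A) = λ(A)''` of `L(G)`, for a subgroup `A` of `G`. -/
def subgroupVN (A : Subgroup G) : VonNeumannAlgebra (ellTwo G) :=
  VonNeumannAlgebra.generatedBy (leftReg '' (A : Set G))

theorem subgroupVN_le (A : Subgroup G) : subgroupVN A ≤ groupVN G :=
  VonNeumannAlgebra.generatedBy_mono (Set.image_subset_range _ _)

/-- `λ(g)` as an element of `L(G)`. -/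
def groupUnitary (g : G) : (groupVN G).Elem :=
  ⟨leftReg g, VonNeumannAlgebra.subset_generatedBy _ ⟨g, rfl⟩⟩

/-- `λ(a)` as an element of `L(A)`. -/
def subgroupUnitary {A : Subgroup G} (a : A) : (subgroupVN A).Elem :=
  ⟨leftReg (a : G), VonNeumannAlgebra.subset_generatedBy _ ⟨a, a.2, rfl⟩⟩

open Classical in
/-- The canonical tracial state `τ(x) = ⟨δ_e, x δ_e⟩` of `L(G)`. -/
def groupTrace (x : (groupVN G).Elem) : ℂ :=
  ⟪lp.single 2 (1 : G) (1 : ℂ), (x : ellTwo G →L[ℂ] ellTwo G) (lp.single 2 (1 : G) (1 : ℂ))⟫_ℂ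

/-- `E` is the canonical (trace preserving, faithful, normal) conditional expectation of `L(G)`
onto its `*`-subalgebra `B`. -/
def IsCanonicalCondExp (B : StarSubalgebra ℂ (groupVN G).Elem)
    (E : (groupVN G).Elem →ₗ[ℂ] (groupVN G).Elem) : Prop :=
  IsFaithfulNormalCondExp (groupVN G) B E ∧ ∀ x, groupTrace (E x) = groupTrace x

/-- The group HNN extension `G *_H θ = ⟨G, t : t θ(h) t⁻¹ = h, h ∈ H⟩`. -/
abbrev GroupHNN (H : Subgroup G) (θ : H →* G) (hθ : Function.Injective θ) : Type _ :=
  HNNExtension G θ.range H (MonoidHom.ofInjective hθ).symm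

end Groups

end

/-! All homomorphisms of von Neumann algebras come from one extension principle. Let `U` and `σ` be
representations of a group by operators, where `U 1` and `σ 1` may be proper projections, and let
`U` generate `N`. Suppose that the adjoint of some bounded intertwiner from `U` to `σ` detects each
given nonzero vector fixed by `σ 1`. Then a maximal family of intertwining partial isometries `V`
with orthogonal ranges fills the range of `σ 1`, and `x ↦ ∑ V x V*` is a normal homomorphism
carrying `U γ` to `σ γ` (`exists_krausMap`, `exists_normalHom`). Intertwiners are produced from
equal matrix coefficients (`exists_partialIsometry`), and normal maps are determined by their values
on the group (`functional_eq_zero`, `IsNormalMap.eq_on`). Injective group homomorphisms therefore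
induce normal embeddings (`exists_groupHom`). The expectation of `L(G)` onto `L(A)` is the
block-diagonal compression along the right cosets of `A` (`groupExp`).

In any realization of the reduced HNN extension, the amalgamation forces the stable unitary to
satisfy the relations of `t`, which gives a representation `s` of the group HNN extension in the
corner under `p` (`exists_rep`). A reduced word with a stable letter becomes a matrix of the first
copy times an alternating word of centred matrices, so freeness yields `Expθ (s γ) = 0` for `γ`
outside of `G` (`rep_word`, `Expθ_rep`). Hence vector functionals composed with `Expθ` have the
coefficients of a multiple of the regular representation, and faithfulness of `Expθ` provides enough
intertwiners to extend `λ(γ) ↦ s γ` to a normal homomorphism (`exists_intertwiner`). It respects the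
expectations, so it is injective because the expectation of `L(Γ)` onto `L(G)` is faithful. The
extension principle in the opposite direction identifies its range (`range_of_injective`).

For existence, amalgamate over `H` the group HNN extensions of `G` by `θ` and by the inclusion of
`H`. Each copy of `M₂(L(G))` acts by `[x_{ik}] ↦ [p_i J(x_{ik}) p_k*]`, with `p_0 = 1` and `p_1` the
stable letter. Entries of a centred matrix have Fourier support in one factor group outside of `H`,
so freeness reduces to the normal form theorem for amalgamated products of groups (`pushout_free`,
`suppIn_letters`, `suppIn_word`). The expectations are again compressions. -/

noncomputable section

set_option linter.unusedSectionVars false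

/-! ### Multiples of a Hilbert space and maps of the form `x ↦ ∑ Sᵢ* x Sᵢ`. -/

section Amplification

variable {H : Type*} [NormedAddCommGroup H] [InnerProductSpace ℂ H] [CompleteSpace H]
variable {K : Type*} [NormedAddCommGroup K] [InnerProductSpace ℂ K] [CompleteSpace K]
variable {ι κ : Type*}

/-- The Hilbert space direct sum of `ι` copies of `H`. -/
abbrev AmpSpace (ι H : Type*) [NormedAddCommGroup H] : Type _ := lp (fun _ : ι => H) 2

/-- A square summable family, as a vector of the Hilbert space direct sum. -/
def ampVec (ζ : ι → H) (h : Summable fun i => ‖ζ i‖ ^ 2) : AmpSpace ι H :=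
  ⟨ζ, memℓp_gen (by simpa using h)⟩

@[simp] theorem ampVec_apply (ζ : ι → H) (h : Summable fun i => ‖ζ i‖ ^ 2) (i : ι) :
    ampVec ζ h i = ζ i := rfl

theorem AmpSpace.summable (f : AmpSpace ι H) : Summable fun i => ‖f i‖ ^ 2 := by
  simpa using (lp.memℓp f).summable (by norm_num)

theorem AmpSpace.norm_sq (f : AmpSpace ι H) : ‖f‖ ^ 2 = ∑' i, ‖f i‖ ^ 2 := by
  simpa using lp.norm_rpow_eq_tsum (p := 2) (by norm_num) f

/-- The diagonal amplification of an operator. -/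
def amp (ι : Type*) (x : H →L[ℂ] H) : AmpSpace ι H →L[ℂ] AmpSpace ι H :=
  lp.mapCLM 2 (fun _ : ι => x) (norm_nonneg x) (fun _ => le_rfl)

@[simp] theorem amp_apply (x : H →L[ℂ] H) (f : AmpSpace ι H) (i : ι) : amp ι x f i = x (f i) :=
  rfl

theorem amp_mul (x y : H →L[ℂ] H) : amp ι (x * y) = amp ι x * amp ι y := by
  ext f i; rfl

theorem amp_add (x y : H →L[ℂ] H) : amp ι (x + y) = amp ι x + amp ι y := by
  ext f i; rfl

theorem amp_smul (c : ℂ) (x : H →L[ℂ] H) : amp ι (c • x) = c • amp ι x := by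
  ext f i; rfl

theorem inner_amp (x : H →L[ℂ] H) (f g : AmpSpace ι H) :
    HasSum (fun i => ⟪f i, x (g i)⟫_ℂ) ⟪f, amp ι x g⟫_ℂ :=
  lp.hasSum_inner f (amp ι x g)

theorem amp_star (x : H →L[ℂ] H) : amp ι (star x) = star (amp ι x) := by
  rw [ContinuousLinearMap.star_eq_adjoint (amp ι x), ContinuousLinearMap.eq_adjoint_iff]
  intro f g
  refine (lp.hasSum_inner _ _).unique ?_
  simpa [ContinuousLinearMap.star_eq_adjoint, ContinuousLinearMap.adjoint_inner_left]
    using inner_amp x f g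

open Classical in
/-- An operator commuting with the amplifications of `S` commutes with those of `S''`. -/
theorem commute_amp {S : Set (H →L[ℂ] H)} {x : H →L[ℂ] H}
    (hx : ∀ T : H →L[ℂ] H, (∀ s ∈ S, T * s = s * T) → T * x = x * T)
    {A : AmpSpace ι H →L[ℂ] AmpSpace ι H} (hA : ∀ s ∈ S, A * amp ι s = amp ι s * A) :
    A * amp ι x = amp ι x * A := by
  have single : ∀ (y : H →L[ℂ] H) (i : ι) (v : H),
      amp ι y (lp.single 2 i v) = lp.single 2 i (y v) := by
    intro y i v
    ext j
    rw [amp_apply, lp.single_apply, lp.single_apply]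
    by_cases h : j = i
    · subst h; simp
    · simp [h]
  -- Each matrix entry of `A` is an operator on `H` that commutes with `S`, hence with `x`.
  have key : ∀ (i j : ι), ∀ v : H, (A (lp.single 2 i (x v))) j = x (A (lp.single 2 i v) j) := by
    intro i j
    let T : H →L[ℂ] H := lp.evalCLM ℂ (fun _ : ι => H) 2 j ∘L A ∘L
      lp.singleContinuousLinearMap ℂ (fun _ : ι => H) 2 i
    have hT : T * x = x * T := by
      refine hx T fun s hs => ?_
      ext v
      have := congrArg (fun B => B (lp.single 2 i v) j) (hA s hs)
      simp only [mul_apply_eq_comp, single, amp_apply] at this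
      exact this
    intro v
    exact congrArg (fun B => B v) hT
  have hs : ∀ i v, (A * amp ι x) (lp.single 2 i v) = (amp ι x * A) (lp.single 2 i v) := by
    intro i v
    ext j
    simp only [mul_apply_eq_comp, single, amp_apply, key]
  ext f : 1
  have h1 := (lp.hasSum_single (p := 2) (by norm_num) f).mapL (A * amp ι x)
  have h2 := (lp.hasSum_single (p := 2) (by norm_num) f).mapL (amp ι x * A)
  simp only [hs] at h1
  exact h1.unique h2

/-- The column operator with entries `S i`. -/
def colOp (S : ι → K →L[ℂ] H)
    (hS : ∀ ξ, Summable (fun i => ‖S i ξ‖ ^ 2) ∧ ∑' i, ‖S i ξ‖ ^ 2 ≤ ‖ξ‖ ^ 2) :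
    K →L[ℂ] AmpSpace ι H :=
  LinearMap.mkContinuous
    { toFun := fun ξ => ampVec (fun i => S i ξ) (hS ξ).1
      map_add' := fun ξ η => by ext i; simp
      map_smul' := fun c ξ => by ext i; simp } 1 (fun ξ => by
        rw [one_mul]
        refine le_of_sq_le_sq ?_ (norm_nonneg _)
        rw [AmpSpace.norm_sq]
        exact (hS ξ).2)

variable {S : ι → K →L[ℂ] H}
  {hS : ∀ ξ, Summable (fun i => ‖S i ξ‖ ^ 2) ∧ ∑' i, ‖S i ξ‖ ^ 2 ≤ ‖ξ‖ ^ 2}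

@[simp] theorem colOp_apply (ξ : K) (i : ι) : colOp S hS ξ i = S i ξ := rfl

/-- The operator `∑ᵢ (S i)* x (S i)`. -/
def krausMap (S : ι → K →L[ℂ] H)
    (hS : ∀ ξ, Summable (fun i => ‖S i ξ‖ ^ 2) ∧ ∑' i, ‖S i ξ‖ ^ 2 ≤ ‖ξ‖ ^ 2) :
    (H →L[ℂ] H) →ₗ[ℂ] (K →L[ℂ] K) where
  toFun x := ContinuousLinearMap.adjoint (colOp S hS) ∘L amp ι x ∘L colOp S hS
  map_add' x y := by rw [amp_add]; ext; simp
  map_smul' c x := by rw [amp_smul]; ext; simp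

theorem krausMap_apply (x : H →L[ℂ] H) : krausMap S hS x =
    ContinuousLinearMap.adjoint (colOp S hS) ∘L amp ι x ∘L colOp S hS := rfl

theorem inner_krausMap (x : H →L[ℂ] H) (ξ η : K) :
    HasSum (fun i => ⟪S i ξ, x (S i η)⟫_ℂ) ⟪ξ, krausMap S hS x η⟫_ℂ := by
  have := inner_amp x (colOp S hS ξ) (colOp S hS η)
  simp only [colOp_apply] at this
  rwa [krausMap_apply, ContinuousLinearMap.comp_apply, ContinuousLinearMap.comp_apply,
    ContinuousLinearMap.adjoint_inner_right]

theorem krausMap_star (x : H →L[ℂ] H) : krausMap S hS (star x) = star (krausMap S hS x) := by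
  rw [krausMap_apply, krausMap_apply, amp_star, ContinuousLinearMap.star_eq_adjoint,
    ContinuousLinearMap.star_eq_adjoint]
  simp [ContinuousLinearMap.adjoint_comp, ContinuousLinearMap.comp_assoc]

end Amplification

/-! ### Normal maps and σ-weakly continuous functionals. -/

section Normal

variable {H : Type*} [NormedAddCommGroup H] [InnerProductSpace ℂ H] [CompleteSpace H]
variable {K : Type*} [NormedAddCommGroup K] [InnerProductSpace ℂ K] [CompleteSpace K]
variable {L : Type*} [NormedAddCommGroup L] [InnerProductSpace ℂ L] [CompleteSpace L]

/-- Square summable families may be reindexed by `ℕ`. -/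
theorem exists_nat_family {ι : Type*} (ζ : ι → H) (hζ : Summable fun i => ‖ζ i‖ ^ 2) :
    ∃ ζ' : ℕ → H, Summable (fun n => ‖ζ' n‖ ^ 2) ∧
      ∀ (x : H →L[ℂ] H) (c : ℂ), HasSum (fun i => ⟪ζ i, x (ζ i)⟫_ℂ) c →
        HasSum (fun n => ⟪ζ' n, x (ζ' n)⟫_ℂ) c := by
  classical
  let s : Set ι := Function.support fun i => ‖ζ i‖ ^ 2
  have hs : s.Countable := hζ.countable_support
  have := hs.to_subtype
  obtain ⟨e, he⟩ := exists_injective_nat s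
  let ζ' : ℕ → H := Function.extend e (fun i : s => ζ i) 0
  have hζ' : ∀ i : s, ζ' (e i) = ζ i := fun i => he.extend_apply _ _ i
  have hz : ∀ n, n ∉ Set.range e → ζ' n = 0 := fun n hn => by
    simpa using Function.extend_apply' (f := e) (fun i : s => ζ i) 0 n (by simpa using hn)
  refine ⟨ζ', ?_, fun x c h => ?_⟩
  · refine (he.summable_iff (f := fun n => ‖ζ' n‖ ^ 2) (fun n hn => by simp [hz n hn])).1 ?_
    simp only [Function.comp_def, hζ']
    exact hζ.subtype s
  · refine (he.hasSum_iff (f := fun n => ⟪ζ' n, x (ζ' n)⟫_ℂ) (fun n hn => by simp [hz n hn])).1 ?_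
    simp only [Function.comp_def, hζ']
    refine (hasSum_subtype_iff_of_support_subset (f := fun i => ⟪ζ i, x (ζ i)⟫_ℂ) ?_).2 h
    intro i hi
    by_contra h0
    have : ζ i = 0 := by simpa [s] using h0
    simp [this] at hi

/-- Square summability leaves only countably many nonzero vectors, so the size of the index set is
immaterial. The families of partial isometries obtained from Zorn's lemma may be uncountable. -/
theorem isNormalMap_of_hasSum {N : VonNeumannAlgebra H} {P : VonNeumannAlgebra K}
    {f : N.Elem → P.Elem} {ι : Type*} (ζ : K → ι → H)
    (hζ : ∀ ξ, Summable fun i => ‖ζ ξ i‖ ^ 2)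
    (hf : ∀ ξ (x : N.Elem), HasSum (fun i => ⟪ζ ξ i, (x : H →L[ℂ] H) (ζ ξ i)⟫_ℂ)
      ⟪ξ, (f x : K →L[ℂ] K) ξ⟫_ℂ) : IsNormalMap N P f := by
  intro ξ
  obtain ⟨ζ', h1, h2⟩ := exists_nat_family (ζ ξ) (hζ ξ)
  exact ⟨ζ', h1, fun x => h2 _ _ (hf ξ x)⟩

theorem summable_prod_of_rows {a : ℕ → ℕ → ℝ} {b : ℕ → ℝ} (ha : ∀ n m, 0 ≤ a n m)
    (hs : ∀ n, Summable (a n)) (hb : Summable b) (hab : ∀ n, ∑' m, a n m ≤ b n) :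
    Summable fun nm : ℕ × ℕ => a nm.1 nm.2 :=
  (summable_prod_of_nonneg (f := fun nm : ℕ × ℕ => a nm.1 nm.2) (fun nm => ha nm.1 nm.2)).2
    ⟨hs, hb.of_nonneg_of_le (fun n => tsum_nonneg (ha n)) hab⟩

/-- Expanding a vector functional through `g` and each of its terms through `f` gives a double
family. It is square summable because the inner sum attached to `η` is at most `‖f 1‖ ‖η‖²`. -/
theorem IsNormalMap.comp {N : VonNeumannAlgebra H} {P : VonNeumannAlgebra K}
    {Q : VonNeumannAlgebra L} {g : P.Elem → Q.Elem} {f : N.Elem → P.Elem}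
    (hg : IsNormalMap P Q g) (hf : IsNormalMap N P f) : IsNormalMap N Q (g ∘ f) := by
  choose z hz hzs using hf
  choose w hw hws using hg
  -- Evaluation at `1` computes the total mass of the family attached to `η`.
  have hnorm : ∀ η : K, HasSum (fun n => ‖z η n‖ ^ 2) (Complex.re ⟪η, (f 1 : K →L[ℂ] K) η⟫_ℂ) := by
    intro η
    refine (Complex.hasSum_re (hzs η 1)).congr_fun fun n => ?_
    exact (inner_self_eq_norm_sq (𝕜 := ℂ) (z η n)).symm
  have hsum : ∀ ξ : L, Summable fun nm : ℕ × ℕ => ‖z (w ξ nm.1) nm.2‖ ^ 2 := by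
    intro ξ
    refine summable_prod_of_rows (a := fun n m => ‖z (w ξ n) m‖ ^ 2) (fun _ _ => sq_nonneg _)
      (fun n => hz (w ξ n)) ((hw ξ).mul_left ‖(f 1 : K →L[ℂ] K)‖) fun n => ?_
    rw [(hnorm (w ξ n)).tsum_eq]
    refine (Complex.re_le_norm _).trans ((norm_inner_le_norm _ _).trans ?_)
    calc ‖w ξ n‖ * ‖(f 1 : K →L[ℂ] K) (w ξ n)‖
        ≤ ‖w ξ n‖ * (‖(f 1 : K →L[ℂ] K)‖ * ‖w ξ n‖) := by
          gcongr; exact ContinuousLinearMap.le_opNorm _ _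
      _ = _ := by ring
  refine isNormalMap_of_hasSum (fun ξ (nm : ℕ × ℕ) => z (w ξ nm.1) nm.2) hsum fun ξ x => ?_
  have hs : Summable fun nm : ℕ × ℕ => ⟪z (w ξ nm.1) nm.2,
      (x : H →L[ℂ] H) (z (w ξ nm.1) nm.2)⟫_ℂ := by
    refine Summable.of_norm_bounded ((hsum ξ).mul_left ‖(x : H →L[ℂ] H)‖) fun nm => ?_
    refine (norm_inner_le_norm _ _).trans ?_
    calc _ ≤ ‖z (w ξ nm.1) nm.2‖ * (‖(x : H →L[ℂ] H)‖ * ‖z (w ξ nm.1) nm.2‖) := by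
          gcongr; exact ContinuousLinearMap.le_opNorm _ _
      _ = _ := by ring
  have h1 := hs.hasSum.prod_fiberwise (fun n => hzs (w ξ n) x)
  have h2 := hws ξ (f x)
  rw [Function.comp_apply, h2.unique h1]
  exact hs.hasSum

/-- A σ-weakly continuous functional `x ↦ ∑ᵢ ⟨aᵢ, x bᵢ⟩`. -/
def IsNormalFunctional (N : VonNeumannAlgebra H) (f : N.Elem → ℂ) : Prop :=
  ∃ (ι : Type) (a b : AmpSpace ι H), ∀ x : N.Elem, f x = ⟪a, amp ι (x : H →L[ℂ] H) b⟫_ℂ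

theorem IsNormalFunctional.add {N : VonNeumannAlgebra H} {f g : N.Elem → ℂ}
    (hf : IsNormalFunctional N f) (hg : IsNormalFunctional N g) :
    IsNormalFunctional N (fun x => f x + g x) := by
  obtain ⟨ι, a, b, h⟩ := hf
  obtain ⟨κ, a', b', h'⟩ := hg
  have hs : ∀ (p : AmpSpace ι H) (q : AmpSpace κ H),
      Summable fun i : ι ⊕ κ => ‖(Sum.elim p q i : H)‖ ^ 2 := fun p q =>
    (HasSum.sum (f := fun i : ι ⊕ κ => ‖(Sum.elim p q i : H)‖ ^ 2)
      p.summable.hasSum q.summable.hasSum).summable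
  refine ⟨ι ⊕ κ, ampVec _ (hs a a'), ampVec _ (hs b b'), fun x => ?_⟩
  refine HasSum.unique ?_ (inner_amp _ _ _)
  beta_reduce
  rw [h, h']
  exact HasSum.sum (inner_amp (x : H →L[ℂ] H) a b) (inner_amp (x : H →L[ℂ] H) a' b')

theorem IsNormalFunctional.smul {N : VonNeumannAlgebra H} {f : N.Elem → ℂ}
    (hf : IsNormalFunctional N f) (c : ℂ) : IsNormalFunctional N (fun x => c * f x) := by
  obtain ⟨ι, a, b, h⟩ := hf
  exact ⟨ι, a, c • b, fun x => by beta_reduce; rw [h, map_smul, inner_smul_right]⟩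

theorem IsNormalFunctional.sub {N : VonNeumannAlgebra H} {f g : N.Elem → ℂ}
    (hf : IsNormalFunctional N f) (hg : IsNormalFunctional N g) :
    IsNormalFunctional N (fun x => f x - g x) := by
  simpa [sub_eq_add_neg] using hf.add (hg.smul (-1))

theorem IsNormalMap.isNormalFunctional_self {N : VonNeumannAlgebra H} {P : VonNeumannAlgebra K}
    {f : N.Elem → P.Elem} (hf : IsNormalMap N P f) (ξ : K) :
    IsNormalFunctional N (fun x => ⟪ξ, (f x : K →L[ℂ] K) ξ⟫_ℂ) := by
  obtain ⟨ζ, h1, h2⟩ := hf ξ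
  exact ⟨ℕ, ampVec ζ h1, ampVec ζ h1, fun x => (h2 x).unique (inner_amp _ _ _)⟩

/-- Polarization. The inner product is conjugate-linear in the first variable, whence the factors
`-I`. -/
theorem IsNormalMap.isNormalFunctional {N : VonNeumannAlgebra H} {P : VonNeumannAlgebra K}
    {f : N.Elem → P.Elem} (hf : IsNormalMap N P f) (ξ η : K) :
    IsNormalFunctional N (fun x => ⟪ξ, (f x : K →L[ℂ] K) η⟫_ℂ) := by
  have h := (((hf.isNormalFunctional_self (ξ + η)).sub (hf.isNormalFunctional_self (ξ - η))).add
    (((hf.isNormalFunctional_self (ξ + Complex.I • η)).smul (-Complex.I)).sub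
      ((hf.isNormalFunctional_self (ξ - Complex.I • η)).smul (-Complex.I)))).smul (1 / 4)
  convert h using 2 with x
  simp only [map_add, map_sub, inner_add_left, inner_add_right, map_smul, inner_smul_left,
    inner_smul_right, Complex.conj_I, inner_sub_left, inner_sub_right]
  linear_combination (1 / 2) * ⟪ξ, (f x : K →L[ℂ] K) η⟫_ℂ * Complex.I_sq -
    (1 / 2) * ⟪η, (f x : K →L[ℂ] K) ξ⟫_ℂ * Complex.I_sq

theorem isNormalMap_subtype {N P : VonNeumannAlgebra H} (f : N.Elem → P.Elem)
    (h : ∀ x, (f x : H →L[ℂ] H) = x) : IsNormalMap N P f :=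
  isNormalMap_of_hasSum (ι := Unit) (fun ξ _ => ξ) (fun _ => Summable.of_finite)
    (fun ξ x => by rw [h]; exact hasSum_unique (fun _ : Unit => ⟪ξ, (x : H →L[ℂ] H) ξ⟫_ℂ))

end Normal
end

noncomputable section

set_option linter.unusedSectionVars false

/-! ### Cyclic subspaces and matrix coefficients of group representations. -/

section Representations

variable {H : Type*} [NormedAddCommGroup H] [InnerProductSpace ℂ H] [CompleteSpace H]
variable {K : Type*} [NormedAddCommGroup K] [InnerProductSpace ℂ K] [CompleteSpace K]
variable {Γ : Type*} [Group Γ]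

open ContinuousLinearMap (adjoint)

/-- A unitary representation of a group on a subspace of `H`, extended by zero. -/
structure IsRep (U : Γ → H →L[ℂ] H) : Prop where
  mul : ∀ γ δ, U (γ * δ) = U γ * U δ
  star : ∀ γ, U γ⁻¹ = star (U γ)

/-- `N` is contained in the double commutant of the range of `U`. -/
def GeneratedByRep (N : VonNeumannAlgebra H) (U : Γ → H →L[ℂ] H) : Prop :=
  ∀ x ∈ N, ∀ T : H →L[ℂ] H, (∀ γ, T * U γ = U γ * T) → T * x = x * T

/-- With `q` the projection onto `R`, invariance under `T` gives `q T q = T q`. The same identity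
for `star T`, after taking adjoints, gives `q T q = q T`. -/
theorem starProjection_commute {R : Submodule ℂ H} [R.HasOrthogonalProjection] {T : H →L[ℂ] H}
    (h : ∀ x ∈ R, T x ∈ R) (h' : ∀ x ∈ R, star T x ∈ R) :
    R.starProjection * T = T * R.starProjection := by
  have key : ∀ A : H →L[ℂ] H, (∀ x ∈ R, A x ∈ R) →
      R.starProjection * A * R.starProjection = A * R.starProjection := by
    intro A hA
    ext v
    exact R.starProjection_eq_self_iff.2 (hA _ (R.starProjection_apply_mem v))
  have hs : star R.starProjection = R.starProjection := isSelfAdjoint_starProjection R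
  have h1 := congrArg star (key _ h')
  simp only [star_mul, star_star, hs, ← mul_assoc] at h1
  rw [← h1, key _ h]

namespace IsRep

variable {U : Γ → H →L[ℂ] H} {σ : Γ → K →L[ℂ] K}

theorem amplify (hU : IsRep U) (ι : Type*) : IsRep fun γ => amp ι (U γ) where
  mul γ δ := by rw [hU.mul, amp_mul]
  star γ := by rw [hU.star, amp_star]

theorem one_mul (hU : IsRep U) (γ : Γ) : U 1 * U γ = U γ := by rw [← hU.mul, _root_.one_mul]

theorem adjoint_intertwines (hU : IsRep U) (hσ : IsRep σ) {T : H →L[ℂ] K}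
    (hT : ∀ γ, T ∘L U γ = σ γ ∘L T) (γ : Γ) : adjoint T ∘L σ γ = U γ ∘L adjoint T := by
  have h := congrArg ContinuousLinearMap.adjoint (hT γ⁻¹)
  rw [hU.star, hσ.star, ContinuousLinearMap.star_eq_adjoint, ContinuousLinearMap.star_eq_adjoint,
    ContinuousLinearMap.adjoint_comp, ContinuousLinearMap.adjoint_comp,
    ContinuousLinearMap.adjoint_adjoint, ContinuousLinearMap.adjoint_adjoint] at h
  exact h.symm

/-- The cyclic subspace generated by a vector. -/
def cyclic (U : Γ → H →L[ℂ] H) (a : H) : Submodule ℂ H :=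
  (Submodule.span ℂ (Set.range fun γ => U γ a)).topologicalClosure

instance (U : Γ → H →L[ℂ] H) (a : H) : CompleteSpace (cyclic U a) :=
  (Submodule.isClosed_topologicalClosure _).completeSpace_coe

theorem mem_cyclic (U : Γ → H →L[ℂ] H) (a : H) (γ : Γ) : U γ a ∈ cyclic U a :=
  Submodule.le_topologicalClosure _ (Submodule.subset_span ⟨γ, rfl⟩)

theorem cyclic_induction {M : Type*} [NormedAddCommGroup M] [NormedSpace ℂ M] {a : H}
    {A : H →L[ℂ] M} (h : ∀ γ, A (U γ a) = 0) {x : H} (hx : x ∈ cyclic U a) : A x = 0 := by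
  have : cyclic U a ≤ LinearMap.ker (A : H →ₗ[ℂ] M) := by
    refine Submodule.topologicalClosure_minimal _ (Submodule.span_le.2 ?_) A.isClosed_ker
    rintro _ ⟨γ, rfl⟩
    exact h γ
  exact this hx

theorem cyclic_invariant (hU : IsRep U) (a : H) (γ : Γ) {x : H} (hx : x ∈ cyclic U a) :
    U γ x ∈ cyclic U a := by
  have : cyclic U a ≤ (cyclic U a).comap (U γ : H →ₗ[ℂ] H) := by
    refine Submodule.topologicalClosure_minimal _ (Submodule.span_le.2 ?_)
      ((Submodule.isClosed_topologicalClosure _).preimage (U γ).continuous)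
    rintro _ ⟨δ, rfl⟩
    change U γ (U δ a) ∈ cyclic U a
    have := mem_cyclic U a (γ * δ)
    rwa [hU.mul] at this
  exact this hx

theorem cyclic_commute (hU : IsRep U) (a : H) (γ : Γ) :
    (cyclic U a).starProjection * U γ = U γ * (cyclic U a).starProjection :=
  starProjection_commute (fun _ hx => hU.cyclic_invariant a γ hx)
    (fun _ hx => by rw [← hU.star]; exact hU.cyclic_invariant a γ⁻¹ hx)

/-- A normal functional vanishing on the generators vanishes on the algebra. -/
theorem functional_eq_zero {N : VonNeumannAlgebra H} {w : Γ → N.Elem}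
    (hU : IsRep fun γ => (w γ : H →L[ℂ] H)) (hN : GeneratedByRep N fun γ => (w γ : H →L[ℂ] H))
    {f : N.Elem → ℂ} (hf : IsNormalFunctional N f) (h : ∀ γ, f (w γ) = 0) (x : N.Elem) :
    f (x * w 1) = 0 := by
  let U : Γ → H →L[ℂ] H := fun γ => w γ
  obtain ⟨ι, a, b, hab⟩ := hf
  have hA := hU.amplify ι
  set q := (cyclic (fun γ => amp ι (U γ)) b).starProjection with hq
  -- The projection `q` commutes with the amplified generators, and `x` lies in their double
  -- commutant.
  have hcomm : q * amp ι (x : H →L[ℂ] H) = amp ι (x : H →L[ℂ] H) * q :=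
    commute_amp (S := Set.range U) (fun T hT => hN x x.2 T fun γ => hT _ ⟨γ, rfl⟩)
      (by rintro _ ⟨γ, rfl⟩; exact hA.cyclic_commute b γ)
  -- As `U 1` need not be the identity, `b` may lie outside its cyclic subspace, whereas its image
  -- under `U 1` lies inside. This is why the conclusion is about `x * w 1`.
  have hmem : amp ι ((x * w 1 : N.Elem) : H →L[ℂ] H) b ∈ cyclic (fun γ => amp ι (U γ)) b := by
    change amp ι ((x : H →L[ℂ] H) * U 1) b ∈ _
    rw [amp_mul, mul_apply_eq_comp,
      ← (Submodule.starProjection_eq_self_iff (K := cyclic (fun γ => amp ι (U γ)) b)).2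
        (mem_cyclic (fun γ => amp ι (U γ)) b 1)]
    have := congrArg (fun B => B (amp ι (U 1) b)) hcomm
    simp only [mul_apply_eq_comp] at this
    rw [← hq, ← this]
    exact Submodule.starProjection_apply_mem _ _
  rw [hab]
  exact cyclic_induction (A := innerSL ℂ a)
    (fun γ => (hab (w γ)).symm.trans (h γ)) hmem

/-- Representations with cyclic vectors having the same matrix coefficients are intertwined by a
partial isometry. -/
theorem exists_partialIsometry (hU : IsRep U) (hσ : IsRep σ) {a : H} {b : K}
    (hab : ∀ γ, ⟪a, U γ a⟫_ℂ = ⟪b, σ γ b⟫_ℂ) :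
    ∃ V : H →L[ℂ] K, (∀ γ, V ∘L U γ = σ γ ∘L V) ∧ (∀ γ, V (U γ a) = σ γ b) ∧
      V ∘L adjoint V ∘L V = V ∧ ∀ T : K →L[ℂ] K, (∀ γ, T (σ γ b) = 0) → T ∘L V = 0 := by
  let R := cyclic U a
  let La : (Γ →₀ ℂ) →ₗ[ℂ] H := Finsupp.linearCombination ℂ fun γ => U γ a
  let Lb : (Γ →₀ ℂ) →ₗ[ℂ] K := Finsupp.linearCombination ℂ fun γ => σ γ b
  have hLa : ∀ f, La f ∈ R := fun f => by
    refine Submodule.le_topologicalClosure _ ?_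
    rw [Finsupp.mem_span_range_iff_exists_finsupp]
    exact ⟨f, rfl⟩
  let e : (Γ →₀ ℂ) →ₗ[ℂ] R := La.codRestrict R hLa
  have gramU : ∀ γ δ, ⟪U γ a, U δ a⟫_ℂ = ⟪a, U (γ⁻¹ * δ) a⟫_ℂ := fun γ δ => by
    rw [hU.mul, hU.star, mul_apply_eq_comp, ContinuousLinearMap.star_eq_adjoint,
      ContinuousLinearMap.adjoint_inner_right]
  have gramσ : ∀ γ δ, ⟪σ γ b, σ δ b⟫_ℂ = ⟪b, σ (γ⁻¹ * δ) b⟫_ℂ := fun γ δ => by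
    rw [hσ.mul, hσ.star, mul_apply_eq_comp, ContinuousLinearMap.star_eq_adjoint,
      ContinuousLinearMap.adjoint_inner_right]
  -- The two orbits have the same Gram matrix, so `U γ a ↦ σ γ b` extends to an isometry of the
  -- cyclic subspace of `a`.
  have hinner : ∀ f g, ⟪La f, La g⟫_ℂ = ⟪Lb f, Lb g⟫_ℂ := by
    intro f g
    simp only [La, Lb, Finsupp.linearCombination_apply, Finsupp.sum, sum_inner, inner_sum,
      inner_smul_left, inner_smul_right, gramU, gramσ, hab]
  have hnorm : ∀ f, ‖Lb f‖ = ‖e f‖ := by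
    intro f
    change ‖Lb f‖ = ‖La f‖
    rw [@norm_eq_sqrt_re_inner ℂ, @norm_eq_sqrt_re_inner ℂ, hinner]
  have hdense : DenseRange e := by
    intro x
    rw [closure_subtype]
    have hx : (x : H) ∈ closure (Submodule.span ℂ (Set.range fun γ => U γ a) : Set H) := x.2
    refine closure_mono ?_ hx
    intro y hy
    obtain ⟨f, hf⟩ := Finsupp.mem_span_range_iff_exists_finsupp.1 hy
    exact ⟨e f, ⟨f, rfl⟩, hf⟩
  have hbd : ∃ C, ∀ f, ‖Lb f‖ ≤ C * ‖e f‖ := ⟨1, fun f => by rw [hnorm, _root_.one_mul]⟩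
  let W : R →L[ℂ] K := Lb.extendOfNorm e
  have hW : ∀ f, W (e f) = Lb f := fun f => LinearMap.extendOfNorm_eq hdense hbd f
  have hiso : ∀ x, ‖W x‖ = ‖x‖ := fun x => hdense.induction
    (P := fun x => ‖W x‖ = ‖x‖) (by rintro _ ⟨f, rfl⟩; rw [hW, hnorm])
    (isClosed_eq (by fun_prop) (by fun_prop)) x
  let Wi : R →ₗᵢ[ℂ] K := ⟨W, hiso⟩
  -- Extension by zero on the orthogonal complement, so that the initial projection of `V` is the
  -- one onto `R`.
  let V : H →L[ℂ] K := W ∘L R.orthogonalProjectionOnto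
  have hVgen : ∀ γ, V (U γ a) = σ γ b := by
    intro γ
    have h1 : R.orthogonalProjectionOnto (U γ a) = e (Finsupp.single γ 1) := by
      have h2 : (e (Finsupp.single γ 1) : H) = U γ a := by simp [e, La]
      rw [← h2]
      exact R.orthogonalProjectionOnto_mem_subspace_eq_self _
    change W (R.orthogonalProjectionOnto (U γ a)) = _
    rw [h1, hW]
    simp [Lb]
  have hVq : ∀ v, V (R.starProjection v) = V v := by
    intro v
    change W _ = W _
    congr 1
    exact R.orthogonalProjectionOnto_mem_subspace_eq_self _
  have hVV : adjoint V ∘L V = R.starProjection := by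
    refine ContinuousLinearMap.ext fun v => ext_inner_left ℂ fun w => ?_
    rw [ContinuousLinearMap.comp_apply, ContinuousLinearMap.adjoint_inner_right]
    refine (Wi.inner_map_map _ _).trans ?_
    rw [← Submodule.starProjection_eq_self_iff.2 (R.starProjection_apply_mem v),
      ← R.inner_starProjection_left_eq_right]
    rfl
  refine ⟨V, fun γ => ?_, hVgen, ?_, fun T hT => ?_⟩
  · have h0 : ∀ x ∈ R, (V ∘L U γ - σ γ ∘L V) x = 0 := fun x hx =>
      cyclic_induction (A := V ∘L U γ - σ γ ∘L V) (fun δ => by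
        have h1 : U γ (U δ a) = U (γ * δ) a := by rw [hU.mul]; rfl
        simp only [sub_apply, ContinuousLinearMap.comp_apply, h1, hVgen]
        rw [hσ.mul]
        exact sub_self _) hx
    ext v
    have h1 := h0 _ (R.starProjection_apply_mem v)
    have h2 := congrArg (fun B => B v) (hU.cyclic_commute a γ)
    simp only [mul_apply_eq_comp] at h2
    simp only [sub_apply, ContinuousLinearMap.comp_apply, hVq, sub_eq_zero] at h1
    rw [← h2, hVq] at h1
    exact h1
  · rw [hVV]
    ext v
    exact hVq v
  · ext v
    rw [ContinuousLinearMap.comp_apply, ← hVq]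
    exact cyclic_induction (A := T ∘L V) (fun γ => by
      rw [ContinuousLinearMap.comp_apply, hVgen, hT]) (R.starProjection_apply_mem v)

end IsRep

end Representations
end

noncomputable section

set_option linter.unusedSectionVars false

/-! ### Normal extension of a representation covered by intertwiners. -/

section Extension

variable {H : Type*} [NormedAddCommGroup H] [InnerProductSpace ℂ H] [CompleteSpace H]
variable {K : Type*} [NormedAddCommGroup K] [InnerProductSpace ℂ K] [CompleteSpace K]
variable {Γ : Type*} [Group Γ] {U : Γ → H →L[ℂ] H} {σ : Γ → K →L[ℂ] K}

open ContinuousLinearMap (adjoint)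

/-- Bessel's inequality for partial isometries with orthogonal ranges. -/
theorem bessel_partialIsometry {s : Set (H →L[ℂ] K)}
    (hp : ∀ V ∈ s, V ∘L adjoint V ∘L V = V)
    (ho : s.Pairwise fun V W => adjoint V ∘L W = 0) (ξ : K) :
    Summable (fun V : s => ‖adjoint (V : H →L[ℂ] K) ξ‖ ^ 2) ∧
      ∑' V : s, ‖adjoint (V : H →L[ℂ] K) ξ‖ ^ 2 ≤ ‖ξ‖ ^ 2 := by
  have key : ∀ F : Finset s, ∑ V ∈ F, ‖adjoint (V : H →L[ℂ] K) ξ‖ ^ 2 ≤ ‖ξ‖ ^ 2 := by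
    intro F
    -- The projection of `ξ` onto the sum of finitely many ranges. Both `‖w‖²` and `Re ⟪ξ, w⟫` equal
    -- the finite sum, so the claim is `0 ≤ ‖ξ - w‖²`.
    set w := ∑ V ∈ F, (V : H →L[ℂ] K) (adjoint (V : H →L[ℂ] K) ξ) with hw
    have h1 : ∀ V ∈ F, adjoint (V : H →L[ℂ] K) w = adjoint (V : H →L[ℂ] K) ξ := by
      intro V hV
      rw [hw, map_sum, Finset.sum_eq_single V]
      · have h := congrArg adjoint (hp V V.2)
        simp only [ContinuousLinearMap.adjoint_comp, ContinuousLinearMap.adjoint_adjoint] at h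
        exact congrArg (fun B => B ξ) h
      · intro W _ hWV
        have h := ho V.2 W.2 (fun h => hWV (Subtype.ext h.symm))
        exact congrArg (fun B => B (adjoint (W : H →L[ℂ] K) ξ)) h
      · exact fun h => absurd hV h
    have h2 : ∀ η : K, ⟪η, w⟫_ℂ =
        ∑ V ∈ F, ⟪adjoint (V : H →L[ℂ] K) η, adjoint (V : H →L[ℂ] K) ξ⟫_ℂ := by
      intro η
      rw [hw, inner_sum]
      exact Finset.sum_congr rfl fun V _ => by rw [ContinuousLinearMap.adjoint_inner_left]
    have h3 : ‖w‖ ^ 2 = ∑ V ∈ F, ‖adjoint (V : H →L[ℂ] K) ξ‖ ^ 2 := by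
      rw [← inner_self_eq_norm_sq (𝕜 := ℂ), h2, map_sum]
      refine Finset.sum_congr rfl fun V hV => ?_
      rw [h1 V hV, inner_self_eq_norm_sq]
    have h4 : RCLike.re ⟪ξ, w⟫_ℂ = ∑ V ∈ F, ‖adjoint (V : H →L[ℂ] K) ξ‖ ^ 2 := by
      rw [h2, map_sum]
      exact Finset.sum_congr rfl fun V hV => inner_self_eq_norm_sq _
    have h5 := @norm_sub_sq ℂ _ _ _ _ ξ w
    rw [h4, h3] at h5
    nlinarith [sq_nonneg ‖ξ - w‖]
  exact ⟨summable_of_sum_le (fun _ => sq_nonneg _) key,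
    Real.tsum_le_of_sum_le (fun _ => sq_nonneg _) key⟩

namespace IsRep

/-- The polar part of a nonzero cyclic restriction of an intertwiner. -/
theorem exists_partialIsometry_of_intertwiner (hU : IsRep U) (hσ : IsRep σ) {R : H →L[ℂ] K}
    (hR : ∀ γ, R ∘L U γ = σ γ ∘L R) (a : H) :
    ∃ (c : H) (V : H →L[ℂ] K), (∀ γ, V ∘L U γ = σ γ ∘L V) ∧ (∀ γ, V (U γ c) = σ γ (R a)) ∧
      V ∘L adjoint V ∘L V = V ∧ ∀ T : K →L[ℂ] K, (∀ γ, T (σ γ (R a)) = 0) → T ∘L V = 0 := by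
  obtain ⟨A, hA⟩ : ∃ A : H →L[ℂ] H, A = adjoint R ∘L R := ⟨_, rfl⟩
  have hA0 : 0 ≤ A := by
    rw [ContinuousLinearMap.nonneg_iff_isPositive, hA]
    exact ContinuousLinearMap.isPositive_adjoint_comp_self R
  have hAU : ∀ γ, Commute A (U γ) := by
    intro γ
    rw [commute_iff_eq, hA]
    ext v
    have h1 := congrArg (fun B => B v) (hR γ)
    have h2 := congrArg (fun B => B (R v)) (hU.adjoint_intertwines hσ hR γ)
    simp only [ContinuousLinearMap.comp_apply] at h1 h2
    simp only [mul_apply_eq_comp, ContinuousLinearMap.comp_apply, h1, h2]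
  -- The modulus of `R`. It commutes with `U` because `R* R` does, and `r² = R* R` makes the
  -- coefficients of `r a` equal to those of `R a`.
  obtain ⟨r, hrU, hrr, hrs⟩ : ∃ r : H →L[ℂ] H, (∀ γ, r * U γ = U γ * r) ∧ r * r = A ∧ adjoint r = r :=
    ⟨CFC.sqrt A, fun γ => (hAU γ).cfcₙ_nnreal NNReal.sqrt, CFC.sqrt_mul_sqrt_self A hA0,
      (CFC.sqrt_nonneg A).isSelfAdjoint⟩
  have hcoef : ∀ γ, ⟪r a, U γ (r a)⟫_ℂ = ⟪R a, σ γ (R a)⟫_ℂ := by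
    intro γ
    have h1 := congrArg (fun B => B a) (hrU γ)
    have h2 := congrArg (fun B => B a) (hR γ)
    have h3 := congrArg (fun B => B (U γ a)) hrr
    simp only [mul_apply_eq_comp, ContinuousLinearMap.comp_apply] at h1 h2 h3
    rw [← h1, ← h2, ← ContinuousLinearMap.adjoint_inner_right, hrs, h3, hA]
    exact ContinuousLinearMap.adjoint_inner_right R a (R (U γ a))
  exact ⟨r a, hU.exists_partialIsometry hσ hcoef⟩

/-- A representation of the generators which is covered by bounded intertwiners extends to a
normal representation of the von Neumann algebra. -/
theorem exists_krausMap (hU : IsRep U) (hσ : IsRep σ) {N : VonNeumannAlgebra H}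
    (hN : GeneratedByRep N U)
    (hT : ∀ η, σ 1 η = η → η ≠ 0 →
      ∃ T : H →L[ℂ] K, (∀ γ, T ∘L U γ = σ γ ∘L T) ∧ adjoint T η ≠ 0) :
    ∃ (s : Set (H →L[ℂ] K)) (hs : ∀ ξ, Summable (fun V : s => ‖adjoint (V : H →L[ℂ] K) ξ‖ ^ 2) ∧
        ∑' V : s, ‖adjoint (V : H →L[ℂ] K) ξ‖ ^ 2 ≤ ‖ξ‖ ^ 2),
      (∀ V ∈ s, ∀ γ, V ∘L U γ = σ γ ∘L V) ∧
      (∀ x, krausMap (fun V : s => adjoint (V : H →L[ℂ] K)) hs x * σ 1 = krausMap _ hs x) ∧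
      (∀ x y, y ∈ N → krausMap (fun V : s => adjoint (V : H →L[ℂ] K)) hs (x * y) =
        krausMap _ hs x * krausMap _ hs y) ∧
      ∀ γ, krausMap (fun V : s => adjoint (V : H →L[ℂ] K)) hs (U γ) = σ γ := by
  -- A maximal family of intertwining partial isometries into the range of `σ 1`, with pairwise
  -- orthogonal ranges.
  obtain ⟨s, hmax⟩ := zorn_subset {s : Set (H →L[ℂ] K) |
      (∀ V ∈ s, (∀ γ, V ∘L U γ = σ γ ∘L V) ∧ V ∘L adjoint V ∘L V = V ∧ σ 1 ∘L V = V) ∧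
        s.Pairwise fun V W => adjoint V ∘L W = 0} (by
    intro c hc hchain
    refine ⟨⋃₀ c, ⟨?_, ?_⟩, fun t ht => Set.subset_sUnion_of_mem ht⟩
    · rintro V ⟨t, ht, hV⟩
      exact (hc ht).1 V hV
    · exact (Set.pairwise_sUnion hchain.directedOn).2 fun t ht => (hc ht).2)
  have hs1 := hmax.prop.1
  have ho := hmax.prop.2
  have hs := bessel_partialIsometry (fun V hV => (hs1 V hV).2.1) ho
  -- Here `C ξ = (V* ξ)_V`, so that `C* C` is the projection onto the closed sum of the ranges.
  obtain ⟨C, hC⟩ : ∃ C, C = colOp (fun V : s => adjoint (V : H →L[ℂ] K)) hs := ⟨_, rfl⟩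
  have hCa : ∀ ξ (V : s), C ξ V = adjoint (V : H →L[ℂ] K) ξ := fun ξ V => by rw [hC, colOp_apply]
  have hCσ : ∀ γ, C ∘L σ γ = amp s (U γ) ∘L C := by
    intro γ
    ext ξ V
    have h := congrArg (fun B => B ξ) (hU.adjoint_intertwines hσ (hs1 V V.2).1 γ)
    simp only [ContinuousLinearMap.comp_apply] at h
    rw [ContinuousLinearMap.comp_apply, ContinuousLinearMap.comp_apply, amp_apply, hCa, hCa, h]
  have hCσ' : ∀ γ, adjoint C ∘L amp s (U γ) = σ γ ∘L adjoint C := fun γ =>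
    hσ.adjoint_intertwines (hU.amplify s) hCσ γ
  -- This commutation is the source of multiplicativity: it holds for the generators and passes to
  -- their double commutant.
  have hcomm : ∀ y ∈ N, (C ∘L adjoint C) * amp s y = amp s y * (C ∘L adjoint C) := by
    intro y hy
    refine commute_amp (S := Set.range U) (fun T hT => hN y hy T fun γ => hT _ ⟨γ, rfl⟩) ?_
    rintro _ ⟨γ, rfl⟩
    rw [ContinuousLinearMap.mul_def, ContinuousLinearMap.mul_def, ContinuousLinearMap.comp_assoc,
      hCσ', ← ContinuousLinearMap.comp_assoc, hCσ, ContinuousLinearMap.comp_assoc]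
  have hVC : ∀ V : s, adjoint (V : H →L[ℂ] K) ∘L (adjoint C ∘L C) = adjoint (V : H →L[ℂ] K) := by
    intro V
    refine ContinuousLinearMap.ext fun η => ext_inner_left ℂ fun ζ => ?_
    rw [ContinuousLinearMap.comp_apply, ContinuousLinearMap.adjoint_inner_right,
      ContinuousLinearMap.comp_apply, ContinuousLinearMap.adjoint_inner_right]
    refine (lp.hasSum_inner (C ((V : H →L[ℂ] K) ζ)) (C η)).unique ?_
    have h := congrArg adjoint (hs1 V V.2).2.1
    simp only [ContinuousLinearMap.adjoint_comp, ContinuousLinearMap.adjoint_adjoint] at h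
    have hV : ⟪ζ, adjoint (V : H →L[ℂ] K) η⟫_ℂ =
        ⟪C ((V : H →L[ℂ] K) ζ) V, C η V⟫_ℂ := by
      have h' := congrArg (fun B => B η) h
      simp only [ContinuousLinearMap.comp_apply] at h'
      rw [hCa, hCa, ContinuousLinearMap.adjoint_inner_left, ← h',
        ContinuousLinearMap.adjoint_inner_right, h']
    rw [hV]
    refine hasSum_single V fun W hWV => ?_
    have h0 := congrArg (fun B => B ζ) (ho W.2 V.2 fun h => hWV (Subtype.ext h))
    simp only [ContinuousLinearMap.comp_apply, zero_apply] at h0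
    rw [hCa, h0, inner_zero_left]
  have hCCC : C ∘L (adjoint C ∘L C) = C := by
    ext ξ V
    have h := congrArg (fun B => B ξ) (hVC V)
    rw [ContinuousLinearMap.comp_apply] at h
    rw [ContinuousLinearMap.comp_apply, hCa, hCa, h]
  -- The projection onto the part of `K` that the family does not reach.
  obtain ⟨q, hq⟩ : ∃ q : K →L[ℂ] K, q = 1 - adjoint C ∘L C := ⟨_, rfl⟩
  have hqσ : ∀ γ, q ∘L σ γ = σ γ ∘L q := by
    intro γ
    have h : (adjoint C ∘L C) ∘L σ γ = σ γ ∘L (adjoint C ∘L C) := by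
      rw [ContinuousLinearMap.comp_assoc, hCσ, ← ContinuousLinearMap.comp_assoc, hCσ',
        ContinuousLinearMap.comp_assoc]
    ext ξ
    have h' := congrArg (fun B => B ξ) h
    simp only [ContinuousLinearMap.comp_apply] at h'
    simp [hq, h']
  have hqq : q ∘L q = q := by
    have h : (adjoint C ∘L C) ∘L (adjoint C ∘L C) = adjoint C ∘L C := by
      rw [ContinuousLinearMap.comp_assoc, hCCC]
    ext ξ
    have h' := congrArg (fun B => B ξ) h
    simp only [ContinuousLinearMap.comp_apply] at h'
    simp [hq, h']
  have hqs : adjoint q = q := by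
    rw [hq, map_sub, ContinuousLinearMap.adjoint_comp, ContinuousLinearMap.adjoint_adjoint,
      ← ContinuousLinearMap.star_eq_adjoint, star_one]
  -- If something of the range of `σ 1` were left over, an intertwiner detecting it could be cut
  -- down by `q`. Its polar part would be a nonzero partial isometry orthogonal to the family,
  -- contrary to maximality.
  have hq0 : ∀ ξ, q (σ 1 ξ) = 0 := by
    by_contra hne
    push Not at hne
    obtain ⟨ξ, hξ⟩ := hne
    set η := q (σ 1 ξ) with hη
    have hqη : q η = η := by
      have := congrArg (fun B => B (σ 1 ξ)) hqq
      simpa only [ContinuousLinearMap.comp_apply] using this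
    have hση : σ 1 η = η := by
      have h1 := congrArg (fun B => B (σ 1 ξ)) (hqσ 1)
      have h2 := congrArg (fun B => B ξ) (hσ.one_mul 1)
      simp only [ContinuousLinearMap.comp_apply, mul_apply_eq_comp] at h1 h2
      rw [hη, ← h1, h2]
    obtain ⟨T, hTi, hTη⟩ := hT η hση hξ
    obtain ⟨R, hR⟩ : ∃ R : H →L[ℂ] K, R = q ∘L T := ⟨_, rfl⟩
    have hRi : ∀ γ, R ∘L U γ = σ γ ∘L R := fun γ => by
      rw [hR, ContinuousLinearMap.comp_assoc, hTi, ← ContinuousLinearMap.comp_assoc, hqσ,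
        ContinuousLinearMap.comp_assoc]
    obtain ⟨a, ha⟩ : ∃ a, a = adjoint T η := ⟨_, rfl⟩
    obtain ⟨c, V, hVi, hVgen, hVp, hVT⟩ := hU.exists_partialIsometry_of_intertwiner hσ hRi a
    have hqV : q ∘L V = V := by
      have := hVT (q - 1) fun γ => by
        have h1 := congrArg (fun B => B (R a)) (hqσ γ)
        simp only [ContinuousLinearMap.comp_apply] at h1
        have h2 : q (R a) = R a := by
          have := congrArg (fun B => B (T a)) hqq
          simp only [ContinuousLinearMap.comp_apply] at this
          rw [hR, ContinuousLinearMap.comp_apply, this]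
        rw [h2] at h1
        simp [h1]
      rw [ContinuousLinearMap.sub_comp, sub_eq_zero] at this
      exact this
    have hσV : σ 1 ∘L V = V := by
      have := hVT (σ 1 - 1) fun γ => by
        have h1 := congrArg (fun B => B (R a)) (hσ.one_mul γ)
        simp only [mul_apply_eq_comp] at h1
        simp [h1]
      rw [ContinuousLinearMap.sub_comp, sub_eq_zero] at this
      exact this
    have hWq : ∀ W ∈ s, adjoint W ∘L q = 0 := by
      intro W hW
      have := hVC ⟨W, hW⟩
      simp only at this
      rw [hq, ContinuousLinearMap.comp_sub, this, ContinuousLinearMap.one_def,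
        ContinuousLinearMap.comp_id, sub_self]
    -- With `a = T* η`, pairing `σ 1 (R a)` with `η` gives `‖a‖²`, which is not zero.
    have hV0 : V ≠ 0 := by
      intro h0
      have h1 := hVgen 1
      rw [h0, zero_apply, hR, ContinuousLinearMap.comp_apply] at h1
      have h3 : ⟪η, σ 1 (q (T a))⟫_ℂ = ⟪a, a⟫_ℂ := by
        have h4 : adjoint (σ 1) = σ 1 := by
          have := hσ.star 1
          rw [inv_one] at this
          exact this.symm
        rw [← ContinuousLinearMap.adjoint_inner_left, h4, hση,
          ← ContinuousLinearMap.adjoint_inner_left, hqs, hqη,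
          ← ContinuousLinearMap.adjoint_inner_left, ← ha]
      rw [← h1, inner_zero_right] at h3
      exact hTη (ha ▸ inner_self_eq_zero.1 h3.symm)
    have hWV : ∀ W ∈ s, adjoint W ∘L V = 0 := by
      intro W hW
      rw [← hqV, ← ContinuousLinearMap.comp_assoc, hWq W hW, ContinuousLinearMap.zero_comp]
    have hVs : V ∉ s := by
      intro hV
      apply hV0
      rw [← hVp, hWV V hV, ContinuousLinearMap.comp_zero]
    have hins : insert V s ∈ {s : Set (H →L[ℂ] K) |
      (∀ V ∈ s, (∀ γ, V ∘L U γ = σ γ ∘L V) ∧ V ∘L adjoint V ∘L V = V ∧ σ 1 ∘L V = V) ∧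
        s.Pairwise fun V W => adjoint V ∘L W = 0} := by
      refine ⟨?_, ?_⟩
      · rintro W (rfl | hW)
        · exact ⟨hVi, hVp, hσV⟩
        · exact hs1 W hW
      · refine ho.insert fun W hW _ => ⟨?_, hWV W hW⟩
        have := congrArg adjoint (hWV W hW)
        simpa [ContinuousLinearMap.adjoint_comp] using this
    exact hVs (hmax.le_of_ge hins (Set.subset_insert V s) (Set.mem_insert V s))
  refine ⟨s, hs, fun V hV => (hs1 V hV).1, fun x => ?_, fun x y hy => ?_, fun γ => ?_⟩
  · have h : C ∘L σ 1 = C := by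
      ext ξ V
      have h1 := congrArg (fun B => adjoint B ξ) (hs1 V V.2).2.2
      have h2 : adjoint (σ 1) = σ 1 := by
        have := hσ.star 1
        rw [inv_one] at this
        exact this.symm
      simp only [ContinuousLinearMap.adjoint_comp, h2, ContinuousLinearMap.comp_apply] at h1
      rw [ContinuousLinearMap.comp_apply, hCa, hCa, h1]
    rw [krausMap_apply, ← hC, ContinuousLinearMap.mul_def, ContinuousLinearMap.comp_assoc,
      ContinuousLinearMap.comp_assoc, h]
  · rw [krausMap_apply, krausMap_apply, krausMap_apply, ← hC, amp_mul]
    -- A factor `C C*` is inserted by means of `C C* C = C` and then moved to the left of `amp s y`.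
    have h : adjoint C ∘L (amp s x * amp s y) ∘L C =
        adjoint C ∘L amp s x ∘L (amp s y * (C ∘L adjoint C)) ∘L C := by
      simp only [ContinuousLinearMap.mul_def, ContinuousLinearMap.comp_assoc, hCCC]
    rw [h, ← hcomm y hy]
    simp only [ContinuousLinearMap.mul_def, ContinuousLinearMap.comp_assoc]
  · rw [krausMap_apply, ← hC, ← hCσ, ← ContinuousLinearMap.comp_assoc]
    ext ξ
    have h := hq0 (σ γ ξ)
    have h1 := congrArg (fun B => B ξ) (hσ.one_mul γ)
    simp only [mul_apply_eq_comp] at h1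
    rw [h1, hq, sub_apply, sub_eq_zero] at h
    exact h.symm

end IsRep
end Extension
end

noncomputable section

set_option linter.unusedSectionVars false

/-! ### Normal homomorphisms and their determination by generators. -/

section Extension

variable {H : Type*} [NormedAddCommGroup H] [InnerProductSpace ℂ H] [CompleteSpace H]
variable {K : Type*} [NormedAddCommGroup K] [InnerProductSpace ℂ K] [CompleteSpace K]
variable {Γ : Type*} [Group Γ]

open ContinuousLinearMap (adjoint)

variable (K) in
/-- The von Neumann algebra of all bounded operators. -/
def fullVN : VonNeumannAlgebra K := VonNeumannAlgebra.generatedBy Set.univ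

/-- A bounded operator as an element of `fullVN`. -/
def toFullVN (x : K →L[ℂ] K) : (fullVN K).Elem :=
  ⟨x, VonNeumannAlgebra.subset_generatedBy _ (Set.mem_univ x)⟩

@[simp] theorem coe_toFullVN (x : K →L[ℂ] K) : (toFullVN x : K →L[ℂ] K) = x := rfl

theorem isNormalMap_krausMap {ι : Type*} {N : VonNeumannAlgebra H} {P : VonNeumannAlgebra K}
    {f : N.Elem → P.Elem} {S : ι → K →L[ℂ] H}
    {hS : ∀ ξ, Summable (fun i => ‖S i ξ‖ ^ 2) ∧ ∑' i, ‖S i ξ‖ ^ 2 ≤ ‖ξ‖ ^ 2}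
    (h : ∀ x : N.Elem, (f x : K →L[ℂ] K) = krausMap S hS x) : IsNormalMap N P f :=
  isNormalMap_of_hasSum (fun ξ i => S i ξ) (fun ξ => (hS ξ).1) fun ξ x => by
    rw [h]; exact inner_krausMap _ _ _

theorem VonNeumannAlgebra.mem_of_commute {Q : VonNeumannAlgebra K} {x : K →L[ℂ] K}
    (h : ∀ y ∈ Q.commutant, y * x = x * y) : x ∈ Q := by
  rw [← VonNeumannAlgebra.commutant_commutant Q, VonNeumannAlgebra.mem_commutant_iff]
  exact h

/-- Normal maps agreeing on the generators agree. -/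
theorem IsNormalMap.eq_on {N : VonNeumannAlgebra H} {P : VonNeumannAlgebra K}
    {w : Γ → N.Elem} (hU : IsRep fun γ => (w γ : H →L[ℂ] H))
    (hN : GeneratedByRep N fun γ => (w γ : H →L[ℂ] H)) {f g : N.Elem → P.Elem}
    (hf : IsNormalMap N P f) (hg : IsNormalMap N P g) (h : ∀ γ, f (w γ) = g (w γ)) (x : N.Elem) :
    f (x * w 1) = g (x * w 1) := by
  refine Subtype.ext (ContinuousLinearMap.ext fun η => ext_inner_left ℂ fun ξ => ?_)
  have := IsRep.functional_eq_zero hU hN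
    ((hf.isNormalFunctional ξ η).sub (hg.isNormalFunctional ξ η)) (fun γ => by rw [h, sub_self]) x
  exact sub_eq_zero.1 this

/-- A normal map sending the generators into a von Neumann algebra takes values in it. -/
theorem IsNormalMap.mem_of_generators {N : VonNeumannAlgebra H} {P Q : VonNeumannAlgebra K}
    {w : Γ → N.Elem} (hU : IsRep fun γ => (w γ : H →L[ℂ] H))
    (hN : GeneratedByRep N fun γ => (w γ : H →L[ℂ] H)) {f : N.Elem → P.Elem}
    (hf : IsNormalMap N P f) (h : ∀ γ, (f (w γ) : K →L[ℂ] K) ∈ Q) (x : N.Elem) :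
    (f (x * w 1) : K →L[ℂ] K) ∈ Q := by
  refine VonNeumannAlgebra.mem_of_commute fun y hy => ?_
  refine ContinuousLinearMap.ext fun η => ext_inner_left ℂ fun ξ => ?_
  have := IsRep.functional_eq_zero hU hN
    ((hf.isNormalFunctional (adjoint y ξ) η).sub (hf.isNormalFunctional ξ (y η))) (fun γ => by
      rw [ContinuousLinearMap.adjoint_inner_left, sub_eq_zero]
      have h1 := VonNeumannAlgebra.mem_commutant_iff.1 hy _ (h γ)
      exact congrArg (fun B => ⟪ξ, B η⟫_ℂ) h1.symm) x
  rw [ContinuousLinearMap.adjoint_inner_left] at this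
  exact sub_eq_zero.1 this

/-- A representation of the generators which is covered by bounded intertwiners extends to a
normal homomorphism of von Neumann algebras. -/
theorem exists_normalHom {N : VonNeumannAlgebra H} {Q : VonNeumannAlgebra K}
    {w : Γ → N.Elem} (hU : IsRep fun γ => (w γ : H →L[ℂ] H))
    (hN : GeneratedByRep N fun γ => (w γ : H →L[ℂ] H))
    {s : Γ → Q.Elem} (hσ : IsRep fun γ => (s γ : K →L[ℂ] K))
    (hT : ∀ η, (s 1 : K →L[ℂ] K) η = η → η ≠ 0 → ∃ T : H →L[ℂ] K,
      (∀ γ, T ∘L (w γ : H →L[ℂ] H) = (s γ : K →L[ℂ] K) ∘L T) ∧ adjoint T η ≠ 0) :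
    ∃ Φ : N.Elem →⋆ₙₐ[ℂ] Q.Elem, (∀ γ, Φ (w γ) = s γ) ∧
      ∃ (t : Set (H →L[ℂ] K))
        (ht : ∀ ξ, Summable (fun V : t => ‖adjoint (V : H →L[ℂ] K) ξ‖ ^ 2) ∧
          ∑' V : t, ‖adjoint (V : H →L[ℂ] K) ξ‖ ^ 2 ≤ ‖ξ‖ ^ 2),
        (∀ V ∈ t, ∀ γ, V ∘L (w γ : H →L[ℂ] H) = (s γ : K →L[ℂ] K) ∘L V) ∧
        ∀ x : N.Elem, (Φ x : K →L[ℂ] K) =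
          krausMap (fun V : t => adjoint (V : H →L[ℂ] K)) ht x := by
  obtain ⟨t, ht, hi, h1, hmul, hgen⟩ := hU.exists_krausMap hσ hN hT
  have hmem : ∀ x : N.Elem,
      krausMap (fun V : t => adjoint (V : H →L[ℂ] K)) ht (x : H →L[ℂ] H) ∈ Q := by
    intro x
    -- A priori the values are arbitrary operators on `K`. Normality reduces membership in `Q` to
    -- the generators, and the extra factor `w 1` is absorbed because `σ 1` acts as a right unit on
    -- the values.
    have h2 := IsNormalMap.mem_of_generators (P := fullVN K) (Q := Q) hU hN
      (f := fun x => toFullVN (krausMap (fun V : t => adjoint (V : H →L[ℂ] K)) ht x))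
      (isNormalMap_krausMap fun _ => rfl) (fun γ => by
        change krausMap _ ht (w γ : H →L[ℂ] H) ∈ Q
        rw [hgen]
        exact (s γ).2) x
    change krausMap _ ht ((x : H →L[ℂ] H) * (w 1 : H →L[ℂ] H)) ∈ Q at h2
    rw [hmul _ _ (w 1).2, hgen, h1] at h2
    exact h2
  refine ⟨{ toFun := fun x => ⟨krausMap _ ht (x : H →L[ℂ] H), hmem x⟩
            map_smul' := fun c x => Subtype.ext (map_smul (krausMap _ ht) c (x : H →L[ℂ] H))
            map_zero' := Subtype.ext (map_zero (krausMap _ ht))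
            map_add' := fun x y => Subtype.ext
              (map_add (krausMap _ ht) (x : H →L[ℂ] H) (y : H →L[ℂ] H))
            map_mul' := fun x y => Subtype.ext (hmul _ _ y.2)
            map_star' := fun x => Subtype.ext (krausMap_star _) },
    fun γ => Subtype.ext (hgen γ), t, ht, hi, fun x => rfl⟩

end Extension
end

noncomputable section

set_option linter.unusedSectionVars false

/-! ### Conditional expectations given by partitions of unity. -/

section Partition

variable {K : Type*} [NormedAddCommGroup K] [InnerProductSpace ℂ K] [CompleteSpace K]
variable {ι : Type*}

/-- A family of self-adjoint operators with `∑ᵢ eᵢ² = 1`. -/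
structure IsPartition (e : ι → K →L[ℂ] K) : Prop where
  selfAdjoint : ∀ i, star (e i) = e i
  hasSum : ∀ ξ η, HasSum (fun i => ⟪e i ξ, e i η⟫_ℂ) ⟪ξ, η⟫_ℂ

namespace IsPartition

variable {e : ι → K →L[ℂ] K}

theorem bessel (he : IsPartition e) (ξ : K) :
    Summable (fun i => ‖e i ξ‖ ^ 2) ∧ ∑' i, ‖e i ξ‖ ^ 2 ≤ ‖ξ‖ ^ 2 := by
  have h : HasSum (fun i => ‖e i ξ‖ ^ 2) (‖ξ‖ ^ 2) := by
    have h1 := Complex.hasSum_re (he.hasSum ξ ξ)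
    have h2 : ∀ η : K, (⟪η, η⟫_ℂ).re = ‖η‖ ^ 2 := fun η => inner_self_eq_norm_sq (𝕜 := ℂ) η
    simpa only [h2] using h1
  exact ⟨h.summable, h.tsum_eq.le⟩

theorem selfAdjoint_inner (he : IsPartition e) (i : ι) (ξ η : K) :
    ⟪e i ξ, η⟫_ℂ = ⟪ξ, e i η⟫_ℂ := by
  conv_lhs => rw [← he.selfAdjoint i, ContinuousLinearMap.star_eq_adjoint,
    ContinuousLinearMap.adjoint_inner_left]

/-- The map `x ↦ ∑ᵢ eᵢ x eᵢ`. -/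
def cond (he : IsPartition e) : (K →L[ℂ] K) →ₗ[ℂ] (K →L[ℂ] K) := krausMap e he.bessel

theorem inner_cond (he : IsPartition e) (x : K →L[ℂ] K) (ξ η : K) :
    HasSum (fun i => ⟪e i ξ, x (e i η)⟫_ℂ) ⟪ξ, he.cond x η⟫_ℂ := inner_krausMap x ξ η

/-- Factors commuting with every `e i` leave the sum. In the weak formulation `a` acts as its
adjoint on the left vector, and this adjoint also commutes with the self-adjoint `e i`. -/
theorem cond_bimodule (he : IsPartition e) {a b : K →L[ℂ] K} (x : K →L[ℂ] K)
    (ha : ∀ i, e i * a = a * e i) (hb : ∀ i, e i * b = b * e i) :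
    he.cond (a * x * b) = a * he.cond x * b := by
  refine ContinuousLinearMap.ext fun η => ext_inner_left ℂ fun ξ => ?_
  refine (he.inner_cond _ ξ η).unique ?_
  have h := he.inner_cond x (ContinuousLinearMap.adjoint a ξ) (b η)
  rw [ContinuousLinearMap.adjoint_inner_left] at h
  refine h.congr_fun fun i => ?_
  have h1 : e i (ContinuousLinearMap.adjoint a ξ) = ContinuousLinearMap.adjoint a (e i ξ) := by
    have := congrArg star (ha i)
    rw [star_mul, star_mul, he.selfAdjoint] at this
    exact (congrArg (fun B => B ξ) this).symm
  have h2 : e i (b η) = b (e i η) := congrArg (fun B => B η) (hb i)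
  rw [h1, h2, ContinuousLinearMap.adjoint_inner_left]
  rfl

theorem cond_one (he : IsPartition e) : he.cond 1 = 1 := by
  refine ContinuousLinearMap.ext fun η => ext_inner_left ℂ fun ξ => ?_
  exact (he.inner_cond 1 ξ η).unique (he.hasSum ξ η)

theorem cond_eq_self (he : IsPartition e) {b : K →L[ℂ] K} (hb : ∀ i, e i * b = b * e i) :
    he.cond b = b := by
  have := he.cond_bimodule (a := 1) 1 (fun i => by rw [mul_one, one_mul]) hb
  rwa [he.cond_one, one_mul, one_mul] at this

theorem isNormalMap (he : IsPartition e) {N P : VonNeumannAlgebra K} {f : N.Elem → P.Elem}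
    (h : ∀ x : N.Elem, (f x : K →L[ℂ] K) = he.cond x) : IsNormalMap N P f :=
  isNormalMap_krausMap (hS := he.bessel) h

/-- With `C` the column of the `e i` and `x` amplified, `E (x* x) = (x C)* (x C)`, which is
positive. If it vanishes, then `x e_i = 0` for all `i`, and `∑ e_i² = 1` forces `x = 0`. -/
theorem isFaithfulNormalCondExp (he : IsPartition e) {N : VonNeumannAlgebra K}
    {B : StarSubalgebra ℂ N.Elem} {E : N.Elem →ₗ[ℂ] N.Elem}
    (hE : ∀ x : N.Elem, (E x : K →L[ℂ] K) = he.cond x) (hmem : ∀ x, E x ∈ B)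
    (hB : ∀ b ∈ B, ∀ i, e i * (b : K →L[ℂ] K) = b * e i) : IsFaithfulNormalCondExp N B E where
  mem := hmem
  id_on b hb := Subtype.ext ((hE b).trans (he.cond_eq_self (hB b hb)))
  bimodule a ha b hb x := Subtype.ext (by
    rw [hE]
    refine (he.cond_bimodule (x : K →L[ℂ] K) (hB a ha) (hB b hb)).trans ?_
    rw [← hE]
    rfl)
  positive x := by
    have h : he.cond ((star x * x : N.Elem) : K →L[ℂ] K) =
        ContinuousLinearMap.adjoint (amp ι (x : K →L[ℂ] K) ∘L colOp e he.bessel) ∘L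
          (amp ι (x : K →L[ℂ] K) ∘L colOp e he.bessel) := by
      change krausMap e he.bessel (star (x : K →L[ℂ] K) * (x : K →L[ℂ] K)) = _
      rw [krausMap_apply, amp_mul, amp_star, ContinuousLinearMap.adjoint_comp,
        ContinuousLinearMap.star_eq_adjoint]
      simp only [ContinuousLinearMap.mul_def, ContinuousLinearMap.comp_assoc]
    rw [hE, h]
    exact ContinuousLinearMap.isPositive_adjoint_comp_self _
  faithful x hx := by
    have h0 : ∀ i, (x : K →L[ℂ] K) * e i = 0 := by
      intro i
      ext ξ
      have h := he.inner_cond ((star x * x : N.Elem) : K →L[ℂ] K) ξ ξ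
      rw [← hE, hx] at h
      have h1 : ∀ j, ⟪e j ξ, ((star x * x : N.Elem) : K →L[ℂ] K) (e j ξ)⟫_ℂ =
          ((‖(x : K →L[ℂ] K) (e j ξ)‖ ^ 2 : ℝ) : ℂ) := by
        intro j
        change ⟪e j ξ, ContinuousLinearMap.adjoint (x : K →L[ℂ] K) ((x : K →L[ℂ] K) (e j ξ))⟫_ℂ = _
        rw [ContinuousLinearMap.adjoint_inner_right, inner_self_eq_norm_sq_to_K]
        norm_cast
      simp only [h1] at h
      have h2 := Complex.hasSum_re h
      simp only [Complex.ofReal_re, ZeroMemClass.coe_zero, zero_apply, inner_zero_right,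
        Complex.zero_re] at h2
      have h3 := (hasSum_zero_iff_of_nonneg (fun j => sq_nonneg _)).1 h2
      have h4 := congrFun h3 i
      simpa using h4
    apply Subtype.ext
    refine ContinuousLinearMap.ext fun η => ext_inner_left ℂ fun ξ => ?_
    have h := he.hasSum (ContinuousLinearMap.adjoint (x : K →L[ℂ] K) ξ) η
    rw [ContinuousLinearMap.adjoint_inner_left] at h
    refine h.unique ?_
    have h1 : ∀ i, ⟪e i (ContinuousLinearMap.adjoint (x : K →L[ℂ] K) ξ), e i η⟫_ℂ = 0 := by
      intro i
      have h2 := congrArg star (h0 i)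
      rw [star_mul, he.selfAdjoint, star_zero] at h2
      have h3 : e i (ContinuousLinearMap.adjoint (x : K →L[ℂ] K) ξ) = 0 :=
        congrArg (fun B => B ξ) h2
      rw [h3, inner_zero_left]
    simp only [h1]
    simp
  normal := he.isNormalMap hE

end IsPartition
end Partition

/-! ### Matrix coefficients on `ℓ²(X)` and compression along the fibres of a map. -/

section Coordinates

variable {X : Type*}

open Classical in
/-- The standard basis vectors of `ℓ²(X)`. -/
def delta (k : X) : ellTwo X := lp.single 2 k (1 : ℂ)

open Classical in
theorem delta_apply (k l : X) : delta k l = if l = k then 1 else 0 := by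
  rw [delta, lp.single_apply]
  by_cases h : l = k
  · subst h; simp
  · simp [h]

theorem inner_delta_left (k : X) (ξ : ellTwo X) : ⟪delta k, ξ⟫_ℂ = ξ k := by
  classical
  rw [delta, lp.inner_single_left]
  simp

theorem ext_delta {M : Type*} [NormedAddCommGroup M] [NormedSpace ℂ M]
    {A B : ellTwo X →L[ℂ] M} (h : ∀ k, A (delta k) = B (delta k)) : A = B := by
  classical
  ext ξ
  have key : ∀ k, A (lp.single 2 k (ξ k)) = B (lp.single 2 k (ξ k)) := by
    intro k
    have : (lp.single 2 k (ξ k) : ellTwo X) = ξ k • delta k := by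
      rw [delta, ← lp.single_smul]
      congr 1
      simp
    rw [this, map_smul, map_smul, h]
  have h1 := (lp.hasSum_single (p := 2) (by norm_num) ξ).mapL A
  have h2 := (lp.hasSum_single (p := 2) (by norm_num) ξ).mapL B
  simp only [key] at h1
  exact h1.unique h2

theorem ext_coeff {A B : ellTwo X →L[ℂ] ellTwo X} (h : ∀ k l, A (delta k) l = B (delta k) l) :
    A = B :=
  ext_delta fun k => lp.ext (funext (h k))

open Classical in
/-- Multiplication with the indicator function of a set. -/
def indOp (s : Set X) : ellTwo X →L[ℂ] ellTwo X :=
  lp.mapCLM 2 (fun k => if k ∈ s then ContinuousLinearMap.id ℂ ℂ else 0) zero_le_one (fun k => by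
    split_ifs
    · exact ContinuousLinearMap.norm_id_le
    · simp)

open Classical in
theorem indOp_apply (s : Set X) (ξ : ellTwo X) (k : X) :
    indOp s ξ k = if k ∈ s then ξ k else 0 := by
  change (if k ∈ s then ContinuousLinearMap.id ℂ ℂ else 0) (ξ k) = _
  split_ifs <;> rfl

theorem indOp_delta_of_mem {s : Set X} {k : X} (h : k ∈ s) : indOp s (delta k) = delta k := by
  classical
  ext l
  rw [indOp_apply, delta_apply]
  by_cases hl : l = k
  · subst hl; simp [h]
  · simp [hl]

theorem indOp_delta_of_notMem {s : Set X} {k : X} (h : k ∉ s) : indOp s (delta k) = 0 := by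
  classical
  ext l
  rw [indOp_apply, delta_apply]
  by_cases hl : l = k
  · subst hl; simp [h]
  · simp [hl]

/-- The partition of unity on `ℓ²(X)` given by the fibres of a map. -/
theorem isPartition_indOp {C : Type*} (κ : X → C) :
    IsPartition fun c => indOp (κ ⁻¹' {c}) where
  selfAdjoint c := by
    rw [ContinuousLinearMap.star_eq_adjoint, eq_comm, ContinuousLinearMap.eq_adjoint_iff]
    intro ξ η
    refine (lp.hasSum_inner _ _).unique ?_
    convert lp.hasSum_inner ξ (indOp (κ ⁻¹' {c}) η) using 2 with k
    rw [indOp_apply, indOp_apply]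
    split_ifs <;> simp
  hasSum ξ η := by
    have h := (Equiv.sigmaFiberEquiv κ).hasSum_iff.2 (lp.hasSum_inner (𝕜 := ℂ) ξ η)
    refine h.sigma fun c => ?_
    have h1 := lp.hasSum_inner (𝕜 := ℂ) (indOp (κ ⁻¹' {c}) ξ) (indOp (κ ⁻¹' {c}) η)
    refine (hasSum_subtype_iff_indicator (s := κ ⁻¹' {c}) (f := fun k => ⟪ξ k, η k⟫_ℂ)).2 ?_
    refine h1.congr_fun fun k => ?_
    classical
    rw [indOp_apply, indOp_apply, Set.indicator_apply]
    split_ifs <;> simp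

open Classical in
-- A single fibre projection fixes both basis vectors exactly when these lie in the same fibre. The
-- compression thus keeps the diagonal blocks and erases the others.
theorem cond_coeff {C : Type*} (κ : X → C) (x : ellTwo X →L[ℂ] ellTwo X) (k l : X) :
    (isPartition_indOp κ).cond x (delta k) l = if κ l = κ k then x (delta k) l else 0 := by
  rw [← inner_delta_left, ← inner_delta_left]
  refine ((isPartition_indOp κ).inner_cond x (delta l) (delta k)).unique ?_
  have h1 : ∀ c, c ≠ κ l → ⟪indOp (κ ⁻¹' {c}) (delta l), x (indOp (κ ⁻¹' {c}) (delta k))⟫_ℂ = 0 :=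
    fun c hc => by
      rw [indOp_delta_of_notMem (s := κ ⁻¹' {c}) (k := l) (fun h => hc h.symm), inner_zero_left]
  convert hasSum_single (κ l) h1
  rw [indOp_delta_of_mem (s := κ ⁻¹' {κ l}) (k := l) rfl]
  split_ifs with h
  · rw [indOp_delta_of_mem (s := κ ⁻¹' {κ l}) (k := k) h.symm]
  · rw [indOp_delta_of_notMem (s := κ ⁻¹' {κ l}) (k := k) (fun h' => h h'.symm), map_zero,
      inner_zero_right]

end Coordinates
end

noncomputable section

set_option linter.unusedSectionVars false

/-! ### Group von Neumann algebras and the maps induced by group homomorphisms. -/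

section GroupAlgebras

variable {G : Type*} [Group G] {G₂ : Type*} [Group G₂] {Γ : Type*} [Group Γ]

open ContinuousLinearMap (adjoint)

theorem leftReg_mul (g h : G) : leftReg (g * h) = leftReg g * leftReg h := by
  ext ξ k
  change ξ ((g * h)⁻¹ * k) = ξ (h⁻¹ * (g⁻¹ * k))
  rw [mul_inv_rev, mul_assoc]

theorem leftReg_one : leftReg (1 : G) = 1 := by
  ext ξ k
  change ξ (1⁻¹ * k) = ξ k
  simp

theorem leftReg_delta (g k : G) : leftReg g (delta k) = delta (g * k) := by
  classical
  ext l
  rw [leftReg_apply, delta_apply, delta_apply]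
  simp only [inv_mul_eq_iff_eq_mul]

theorem leftReg_inv (g : G) : leftReg g⁻¹ = star (leftReg g) := by
  rw [ContinuousLinearMap.star_eq_adjoint, ContinuousLinearMap.eq_adjoint_iff]
  intro ξ η
  have h1 := lp.hasSum_inner (𝕜 := ℂ) ξ (leftReg g η)
  have h2 := lp.hasSum_inner (𝕜 := ℂ) (leftReg g⁻¹ ξ) η
  rw [← (Equiv.mulLeft g).hasSum_iff] at h1
  refine h2.unique ?_
  convert h1 using 2 with k
  simp [leftReg_apply]

theorem isRep_leftReg (f : Γ →* G) : IsRep fun γ => leftReg (f γ) where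
  mul γ δ := by rw [map_mul, leftReg_mul]
  star γ := by rw [map_inv, leftReg_inv]

/-- Since `star (U γ) = U γ⁻¹`, an operator commuting with all `U γ` commutes with the adjoints as
well, as the centralizer of a star-closed set requires. -/
theorem generatedByRep_generatedBy {H : Type*} [NormedAddCommGroup H] [InnerProductSpace ℂ H]
    [CompleteSpace H] {U : Γ → H →L[ℂ] H} (hU : IsRep U) {S : Set (H →L[ℂ] H)}
    (hS : S ⊆ Set.range U) : GeneratedByRep (VonNeumannAlgebra.generatedBy S) U := by
  intro x hx T hT
  have hx' : x ∈ StarSubalgebra.centralizer ℂ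
    (StarSubalgebra.centralizer ℂ S : Set (H →L[ℂ] H)) := hx
  rw [StarSubalgebra.mem_centralizer_iff] at hx'
  refine (hx' T ?_).1
  rw [SetLike.mem_coe, StarSubalgebra.mem_centralizer_iff]
  intro s hs
  obtain ⟨γ, rfl⟩ := hS hs
  refine ⟨(hT γ).symm, ?_⟩
  rw [← hU.star]
  exact (hT γ⁻¹).symm

theorem generatedByRep_groupVN : GeneratedByRep (groupVN G) (leftReg (G := G)) :=
  generatedByRep_generatedBy (isRep_leftReg (MonoidHom.id G)) subset_rfl

theorem generatedByRep_subgroupVN (A : Subgroup G) :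
    GeneratedByRep (subgroupVN A) fun a : A => leftReg (a : G) :=
  generatedByRep_generatedBy (isRep_leftReg A.subtype) (by
    rintro _ ⟨a, ha, rfl⟩
    exact ⟨⟨a, ha⟩, rfl⟩)

theorem isRep_groupUnitary : IsRep fun g : G => (groupUnitary g : ellTwo G →L[ℂ] ellTwo G) :=
  isRep_leftReg (MonoidHom.id G)

theorem isRep_subgroupUnitary (A : Subgroup G) :
    IsRep fun a : A => (subgroupUnitary a : ellTwo G →L[ℂ] ellTwo G) :=
  isRep_leftReg A.subtype

theorem groupUnitary_one : groupUnitary (1 : G) = 1 := Subtype.ext leftReg_one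

theorem groupUnitary_mul (g h : G) : groupUnitary (g * h) = groupUnitary g * groupUnitary h :=
  Subtype.ext (leftReg_mul g h)

theorem groupUnitary_inv (g : G) : groupUnitary g⁻¹ = star (groupUnitary g) :=
  Subtype.ext (leftReg_inv g)

theorem subgroupUnitary_one (A : Subgroup G) : subgroupUnitary (1 : A) = 1 :=
  Subtype.ext leftReg_one

/-- Normal maps on `L(G)` agreeing on the group agree. -/
theorem IsNormalMap.eq_of_group {K : Type*} [NormedAddCommGroup K] [InnerProductSpace ℂ K]
    [CompleteSpace K] {P : VonNeumannAlgebra K} {f g : (groupVN G).Elem → P.Elem}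
    (hf : IsNormalMap (groupVN G) P f) (hg : IsNormalMap (groupVN G) P g)
    (h : ∀ γ, f (groupUnitary γ) = g (groupUnitary γ)) (x : (groupVN G).Elem) : f x = g x := by
  simpa [groupUnitary_one] using
    IsNormalMap.eq_on isRep_groupUnitary generatedByRep_groupVN hf hg h x

/-- Normal maps on `L(A)` agreeing on the group agree. -/
theorem IsNormalMap.eq_of_subgroup {K : Type*} [NormedAddCommGroup K] [InnerProductSpace ℂ K]
    [CompleteSpace K] {A : Subgroup G} {P : VonNeumannAlgebra K}
    {f g : (subgroupVN A).Elem → P.Elem}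
    (hf : IsNormalMap (subgroupVN A) P f) (hg : IsNormalMap (subgroupVN A) P g)
    (h : ∀ γ, f (subgroupUnitary γ) = g (subgroupUnitary γ)) (x : (subgroupVN A).Elem) :
    f x = g x := by
  simpa [subgroupUnitary_one] using
    IsNormalMap.eq_on (isRep_subgroupUnitary A) (generatedByRep_subgroupVN A) hf hg h x

/-- A vector functional supported in one orbit covers all of `ℓ²`. -/
theorem exists_orbit_intertwiner (f₁ : Γ →* G) (hf₁ : Function.Injective f₁) (f₂ : Γ →* G₂)
    (hf₂ : Function.Injective f₂) {η : ellTwo G₂} (hη : η ≠ 0) :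
    ∃ T : ellTwo G →L[ℂ] ellTwo G₂,
      (∀ γ, T ∘L leftReg (f₁ γ) = leftReg (f₂ γ) ∘L T) ∧ adjoint T η ≠ 0 := by
  classical
  obtain ⟨k, hk⟩ : ∃ k, η k ≠ 0 := by
    by_contra h
    push Not at h
    exact hη (lp.ext (funext h))
  -- Left translation is free and `f₁`, `f₂` are injective, so both coefficient functions are the
  -- indicator function of `1`.
  obtain ⟨V, hV, hgen, -, -⟩ := (isRep_leftReg f₁).exists_partialIsometry (isRep_leftReg f₂)
    (a := delta 1) (b := delta k) (fun γ => by
      rw [inner_delta_left, inner_delta_left, leftReg_delta, leftReg_delta, delta_apply,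
        delta_apply]
      have h1 : (1 : G) = f₁ γ * 1 ↔ γ = 1 := by
        rw [mul_one, eq_comm, map_eq_one_iff f₁ hf₁]
      have h2 : k = f₂ γ * k ↔ γ = 1 := by
        rw [eq_comm, mul_eq_right, map_eq_one_iff f₂ hf₂]
      simp only [h1, h2])
  refine ⟨V, hV, fun h0 => hk ?_⟩
  have h1 := hgen 1
  rw [map_one, map_one, leftReg_one, leftReg_one] at h1
  change V (delta 1) = delta k at h1
  rw [← inner_delta_left, ← h1, ← ContinuousLinearMap.adjoint_inner_right, h0, inner_zero_right]

/-- A group isomorphism between subgroups of `G` and `G₂` induces a normal isomorphism of the von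
Neumann algebras they generate. -/
theorem exists_groupHom (f₁ : Γ →* G) (hf₁ : Function.Injective f₁) (f₂ : Γ →* G₂)
    (hf₂ : Function.Injective f₂) {N₁ : VonNeumannAlgebra (ellTwo G)}
    {N₂ Q₂ : VonNeumannAlgebra (ellTwo G₂)} (hQ : Q₂ ≤ N₂)
    (w₁ : Γ → N₁.Elem) (hw₁ : ∀ γ, (w₁ γ : ellTwo G →L[ℂ] ellTwo G) = leftReg (f₁ γ))
    (hN₁ : GeneratedByRep N₁ fun γ => leftReg (f₁ γ))
    (w₂ : Γ → Q₂.Elem) (hw₂ : ∀ γ, (w₂ γ : ellTwo G₂ →L[ℂ] ellTwo G₂) = leftReg (f₂ γ))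
    (hQ₂ : GeneratedByRep Q₂ fun γ => leftReg (f₂ γ)) :
    ∃ Φ : N₁.Elem →⋆ₐ[ℂ] N₂.Elem, Function.Injective Φ ∧
      Φ.range = (VonNeumannAlgebra.incl hQ).range ∧
      (∀ γ, (Φ (w₁ γ) : ellTwo G₂ →L[ℂ] ellTwo G₂) = leftReg (f₂ γ)) ∧
      ∃ (t : Set (ellTwo G →L[ℂ] ellTwo G₂))
        (ht : ∀ ξ, Summable (fun V : t => ‖adjoint (V : ellTwo G →L[ℂ] ellTwo G₂) ξ‖ ^ 2) ∧
          ∑' V : t, ‖adjoint (V : ellTwo G →L[ℂ] ellTwo G₂) ξ‖ ^ 2 ≤ ‖ξ‖ ^ 2),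
        ∀ x : N₁.Elem, (Φ x : ellTwo G₂ →L[ℂ] ellTwo G₂) =
          krausMap (fun V : t => adjoint (V : ellTwo G →L[ℂ] ellTwo G₂)) ht x := by
  have e₁ : (fun γ => (w₁ γ : ellTwo G →L[ℂ] ellTwo G)) = fun γ => leftReg (f₁ γ) := funext hw₁
  have e₂ : (fun γ => (w₂ γ : ellTwo G₂ →L[ℂ] ellTwo G₂)) = fun γ => leftReg (f₂ γ) := funext hw₂
  have r₁ : IsRep fun γ => (w₁ γ : ellTwo G →L[ℂ] ellTwo G) := e₁ ▸ isRep_leftReg f₁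
  have r₂ : IsRep fun γ => (w₂ γ : ellTwo G₂ →L[ℂ] ellTwo G₂) := e₂ ▸ isRep_leftReg f₂
  have g₁ : GeneratedByRep N₁ fun γ => (w₁ γ : ellTwo G →L[ℂ] ellTwo G) := e₁ ▸ hN₁
  have g₂ : GeneratedByRep Q₂ fun γ => (w₂ γ : ellTwo G₂ →L[ℂ] ellTwo G₂) := e₂ ▸ hQ₂
  have o₁ : w₁ 1 = 1 := Subtype.ext (by rw [hw₁, map_one, leftReg_one]; rfl)
  have o₂ : w₂ 1 = 1 := Subtype.ext (by rw [hw₂, map_one, leftReg_one]; rfl)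
  -- The hypotheses are symmetric, so both directions extend. The two extensions are mutually
  -- inverse because their composites are normal and fix the generators.
  obtain ⟨Φ, hΦ, t, ht, -, hΦk⟩ := exists_normalHom r₁ g₁ r₂ (fun η _ hη => by
    simp only [hw₁, hw₂]
    exact exists_orbit_intertwiner f₁ hf₁ f₂ hf₂ hη)
  obtain ⟨Ψ, hΨ, t', ht', -, hΨk⟩ := exists_normalHom r₂ g₂ r₁ (fun η _ hη => by
    simp only [hw₁, hw₂]
    exact exists_orbit_intertwiner f₂ hf₂ f₁ hf₁ hη)
  have nΦ : IsNormalMap N₁ Q₂ Φ := isNormalMap_krausMap hΦk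
  have nΨ : IsNormalMap Q₂ N₁ Ψ := isNormalMap_krausMap hΨk
  have hΨΦ : ∀ x, Ψ (Φ x) = x := fun x => by
    simpa [o₁] using IsNormalMap.eq_on r₁ g₁ (nΨ.comp nΦ)
      (isNormalMap_subtype (fun x : N₁.Elem => x) fun _ => rfl) (fun γ => by simp [hΦ, hΨ]) x
  have hΦΨ : ∀ x, Φ (Ψ x) = x := fun x => by
    simpa [o₂] using IsNormalMap.eq_on r₂ g₂ (nΦ.comp nΨ)
      (isNormalMap_subtype (fun x : Q₂.Elem => x) fun _ => rfl) (fun γ => by simp [hΦ, hΨ]) x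
  have h1 : Φ 1 = 1 := by rw [← o₁, hΦ, o₂]
  let Φ' : N₁.Elem →⋆ₐ[ℂ] Q₂.Elem :=
    { toFun := Φ
      map_one' := h1
      map_mul' := map_mul Φ
      map_zero' := map_zero Φ
      map_add' := map_add Φ
      commutes' := fun c => by
        rw [Algebra.algebraMap_eq_smul_one, Algebra.algebraMap_eq_smul_one, map_smul, h1]
      map_star' := map_star Φ }
  refine ⟨(VonNeumannAlgebra.incl hQ).comp Φ', ?_, ?_, fun γ => ?_, t, ht, hΦk⟩
  · intro x y hxy
    have h := congrArg (fun z : N₂.Elem => (z : ellTwo G₂ →L[ℂ] ellTwo G₂)) hxy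
    have : Φ x = Φ y := Subtype.ext h
    rw [← hΨΦ x, this, hΨΦ]
  · ext y
    constructor
    · rintro ⟨x, rfl⟩
      exact ⟨Φ x, rfl⟩
    · rintro ⟨z, rfl⟩
      exact ⟨Ψ z, congrArg (VonNeumannAlgebra.incl hQ) (hΦΨ z)⟩
  · rw [← hw₂, ← hΦ]
    rfl

end GroupAlgebras

/-! ### The trace preserving expectation onto the algebra of a subgroup. -/

section Expectation

variable {G : Type*} [Group G]

/-- The class of a group element modulo left translation by a subgroup. -/
def rightClass (A : Subgroup G) (k : G) : Quotient (QuotientGroup.rightRel A) := Quotient.mk _ k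

theorem rightClass_eq_iff (A : Subgroup G) (k l : G) :
    rightClass A k = rightClass A l ↔ k * l⁻¹ ∈ A := by
  rw [rightClass, rightClass, eq_comm, Quotient.eq, QuotientGroup.rightRel_apply]

/-- Left multiplication by an element of `A` preserves each right coset `A k`. -/
theorem indOp_leftReg_comm (A : Subgroup G) (c) {a : G} (ha : a ∈ A) :
    indOp (rightClass A ⁻¹' {c}) * leftReg a = leftReg a * indOp (rightClass A ⁻¹' {c}) := by
  refine ext_delta fun k => ?_
  have h : rightClass A (a * k) = rightClass A k := by
    rw [rightClass_eq_iff]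
    simpa using ha
  simp only [mul_apply_eq_comp, leftReg_delta]
  by_cases hk : rightClass A k = c
  · rw [indOp_delta_of_mem (by rw [Set.mem_preimage, h]; exact hk),
      indOp_delta_of_mem (by exact hk), leftReg_delta]
  · rw [indOp_delta_of_notMem (by rw [Set.mem_preimage, h]; exact hk),
      indOp_delta_of_notMem (by exact hk), map_zero]

theorem indOp_subgroupVN_comm (A : Subgroup G) (c) {x : ellTwo G →L[ℂ] ellTwo G}
    (hx : x ∈ subgroupVN A) :
    indOp (rightClass A ⁻¹' {c}) * x = x * indOp (rightClass A ⁻¹' {c}) :=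
  generatedByRep_subgroupVN A x hx _ fun a => indOp_leftReg_comm A c a.2

open Classical in
-- The operator `λ(g)` moves `k` to `g k`, which lies in the right coset `A k` exactly when `g ∈ A`.
theorem cond_leftReg (A : Subgroup G) (g : G) :
    (isPartition_indOp (rightClass A)).cond (leftReg g) = if g ∈ A then leftReg g else 0 := by
  refine ext_coeff fun k l => ?_
  rw [cond_coeff, rightClass_eq_iff, leftReg_delta, delta_apply]
  by_cases hl : l = g * k
  · subst hl
    by_cases hg : g ∈ A <;> simp [hg, leftReg_delta, delta_apply]
  · by_cases hg : g ∈ A <;> simp [hg, leftReg_delta, hl, delta_apply]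

/-- The compression is normal and sends every `λ(g)` into `L(A)`, so it sends all of `L(G)` there.
-/
theorem cond_mem_subgroupVN (A : Subgroup G) (x : (groupVN G).Elem) :
    (isPartition_indOp (rightClass A)).cond (x : ellTwo G →L[ℂ] ellTwo G) ∈ subgroupVN A := by
  have hn : IsNormalMap (groupVN G) (fullVN (ellTwo G))
      (fun x => toFullVN ((isPartition_indOp (rightClass A)).cond x)) :=
    (isPartition_indOp (rightClass A)).isNormalMap fun x => coe_toFullVN _
  have h := hn.mem_of_generators (Q := subgroupVN A)
    isRep_groupUnitary generatedByRep_groupVN (fun g => by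
      change (isPartition_indOp (rightClass A)).cond (leftReg g) ∈ subgroupVN A
      rw [cond_leftReg]
      split_ifs with hg
      · exact VonNeumannAlgebra.subset_generatedBy _ ⟨g, hg, rfl⟩
      · exact zero_mem _) x
  rw [groupUnitary_one, mul_one] at h
  exact h

/-- The canonical conditional expectation of `L(G)` onto `L(A)`. -/
def groupExp (A : Subgroup G) : (groupVN G).Elem →ₗ[ℂ] (groupVN G).Elem where
  toFun x := ⟨(isPartition_indOp (rightClass A)).cond (x : ellTwo G →L[ℂ] ellTwo G),
    subgroupVN_le A (cond_mem_subgroupVN A x)⟩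
  map_add' x y := Subtype.ext (map_add _ (x : ellTwo G →L[ℂ] ellTwo G) (y : _))
  map_smul' c x := Subtype.ext (map_smul _ c (x : ellTwo G →L[ℂ] ellTwo G))

theorem coe_groupExp (A : Subgroup G) (x : (groupVN G).Elem) :
    (groupExp A x : ellTwo G →L[ℂ] ellTwo G) =
      (isPartition_indOp (rightClass A)).cond (x : ellTwo G →L[ℂ] ellTwo G) := rfl

theorem groupExp_mem (A : Subgroup G) (x : (groupVN G).Elem) :
    (groupExp A x : ellTwo G →L[ℂ] ellTwo G) ∈ subgroupVN A := cond_mem_subgroupVN A x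

open Classical in
theorem groupExp_coeff (A : Subgroup G) (x : (groupVN G).Elem) (k l : G) :
    (groupExp A x : ellTwo G →L[ℂ] ellTwo G) (delta k) l =
      if l * k⁻¹ ∈ A then (x : ellTwo G →L[ℂ] ellTwo G) (delta k) l else 0 := by
  rw [coe_groupExp, cond_coeff, rightClass_eq_iff]

theorem groupExp_unitary_of_mem {A : Subgroup G} {g : G} (hg : g ∈ A) :
    groupExp A (groupUnitary g) = groupUnitary g :=
  Subtype.ext ((cond_leftReg A g).trans (if_pos hg))

theorem groupExp_unitary_of_notMem {A : Subgroup G} {g : G} (hg : g ∉ A) :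
    groupExp A (groupUnitary g) = 0 :=
  Subtype.ext ((cond_leftReg A g).trans (if_neg hg))

theorem groupTrace_eq (x : (groupVN G).Elem) :
    groupTrace x = (x : ellTwo G →L[ℂ] ellTwo G) (delta 1) 1 :=
  inner_delta_left 1 _

/-- The trace is the coefficient at `(1, 1)`, which belongs to a diagonal block and is therefore
kept. -/
theorem isCanonicalCondExp_groupExp (A : Subgroup G) :
    IsCanonicalCondExp (VonNeumannAlgebra.incl (subgroupVN_le A)).range (groupExp A) := by
  refine ⟨(isPartition_indOp (rightClass A)).isFaithfulNormalCondExp (fun _ => rfl)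
    (fun x => ⟨⟨_, groupExp_mem A x⟩, rfl⟩) ?_, fun x => ?_⟩
  · rintro _ ⟨b, rfl⟩ c
    exact indOp_subgroupVN_comm A c b.2
  · classical
    rw [groupTrace_eq, groupTrace_eq, groupExp_coeff, if_pos (by simp)]

theorem isNormalMap_groupExp (A : Subgroup G) :
    IsNormalMap (groupVN G) (groupVN G) (groupExp A) :=
  (isCanonicalCondExp_groupExp A).1.normal

end Expectation
end

noncomputable section

set_option linter.unusedSectionVars false

/-! ### Matrix units and diagonal matrices. -/

section MatrixUnits

variable {H : Type*} [NormedAddCommGroup H] [InnerProductSpace ℂ H] [CompleteSpace H]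
variable {N D : VonNeumannAlgebra H}

/-- The matrix with the single entry `n` at the place `(i, k)`. -/
def matUnit (i k : Fin 2) (n : N.Elem) : (matVN N).Elem := matOf (Matrix.single i k n)

theorem matEntry_matUnit (i k : Fin 2) (n : N.Elem) (a b : Fin 2) :
    matEntry (matUnit i k n) a b = if i = a ∧ k = b then n else 0 := by
  rw [matUnit, matEntry_matOf, Matrix.single_apply]

theorem matUnit_mul (i k l : Fin 2) (n n' : N.Elem) :
    matUnit i k n * matUnit k l n' = matUnit i l (n * n') := by
  refine matEntry_ext fun a b => ?_
  rw [matEntry_mul]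
  simp only [matEntry_matUnit]
  by_cases h1 : i = a <;> by_cases h2 : l = b <;> simp [h1, h2]

theorem matUnit_star (i k : Fin 2) (n : N.Elem) : star (matUnit i k n) = matUnit k i (star n) := by
  refine matEntry_ext fun a b => ?_
  rw [matEntry_star]
  simp only [matEntry_matUnit]
  by_cases h1 : i = b <;> by_cases h2 : k = a <;> simp [h1, h2]

/-- Only diagonal entries enter `diagExp`, so off-diagonal matrices are centred whatever their
entries. This makes them available as letters of centred words. -/
theorem diagExp_matUnit_ne {E₀ E₁ : N.Elem →ₗ[ℂ] N.Elem} {i k : Fin 2} (h : i ≠ k) (n : N.Elem) :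
    diagExp E₀ E₁ (matUnit i k n) = 0 := by
  have h0 : matEntry (matUnit i k n) 0 0 = 0 := by
    rw [matEntry_matUnit, if_neg]; rintro ⟨rfl, rfl⟩; exact h rfl
  have h1 : matEntry (matUnit i k n) 1 1 = 0 := by
    rw [matEntry_matUnit, if_neg]; rintro ⟨rfl, rfl⟩; exact h rfl
  change matOf (Matrix.diagonal ![E₀ (matEntry (matUnit i k n) 0 0),
    E₁ (matEntry (matUnit i k n) 1 1)]) = 0
  rw [h0, h1, map_zero, map_zero]
  refine matEntry_ext fun a b => ?_
  rw [matEntry_matOf, Matrix.diagonal_apply]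
  fin_cases a <;> fin_cases b <;> exact Subtype.ext (by simp [matEntry])

theorem matEntry_diagExp (E₀ E₁ : N.Elem →ₗ[ℂ] N.Elem) (x : (matVN N).Elem) (a b : Fin 2) :
    matEntry (diagExp E₀ E₁ x) a b =
      Matrix.diagonal ![E₀ (matEntry x 0 0), E₁ (matEntry x 1 1)] a b :=
  matEntry_matOf _ a b

theorem matEntry_zero (a b : Fin 2) : matEntry (0 : (matVN N).Elem) a b = 0 :=
  Subtype.ext (entry_zero a b)

theorem diagExp_matUnit_zero {E₀ E₁ : N.Elem →ₗ[ℂ] N.Elem} {n : N.Elem} (h : E₀ n = 0) :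
    diagExp E₀ E₁ (matUnit 0 0 n) = 0 := by
  refine matEntry_ext fun a b => ?_
  rw [matEntry_diagExp, matEntry_zero]
  fin_cases a <;> fin_cases b <;> simp [matEntry_matUnit, h]

theorem diagExp_matUnit_one {E₀ E₁ : N.Elem →ₗ[ℂ] N.Elem} {n : N.Elem} (h : E₁ n = 0) :
    diagExp E₀ E₁ (matUnit 1 1 n) = 0 := by
  refine matEntry_ext fun a b => ?_
  rw [matEntry_diagExp, matEntry_zero]
  fin_cases a <;> fin_cases b <;> simp [matEntry_matUnit, h]

/-- The diagonal matrix with given entries. -/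
def diagOf (d₀ d₁ : D.Elem) : (diagVN D).Elem :=
  ⟨ofBlocks (Matrix.diagonal ![(d₀ : H →L[ℂ] H), (d₁ : H →L[ℂ] H)]), by
    refine ⟨fun i => ?_, fun i j hij => ?_⟩
    · rw [entry_ofBlocks]
      fin_cases i
      · exact d₀.2
      · exact d₁.2
    · rw [entry_ofBlocks, Matrix.diagonal_apply_ne _ hij]⟩

theorem diagEntry_diagOf_zero (d₀ d₁ : D.Elem) : diagEntry (diagOf d₀ d₁) 0 = d₀ :=
  Subtype.ext (by simp [diagEntry, diagOf])

theorem diagEntry_diagOf_one (d₀ d₁ : D.Elem) : diagEntry (diagOf d₀ d₁) 1 = d₁ :=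
  Subtype.ext (by simp [diagEntry, diagOf])

theorem matEntry_diagHom (ι₀ ι₁ : D.Elem →⋆ₐ[ℂ] N.Elem) (x : (diagVN D).Elem) (a b : Fin 2) :
    matEntry (diagHom ι₀ ι₁ x) a b =
      Matrix.diagonal ![ι₀ (diagEntry x 0), ι₁ (diagEntry x 1)] a b :=
  matEntry_matOf _ a b

theorem diagHom_incl (hD : D ≤ N) (x : (diagVN D).Elem) :
    diagHom (VonNeumannAlgebra.incl hD) (VonNeumannAlgebra.incl hD) x =
      VonNeumannAlgebra.incl (diagVN_le_matVN hD) x := by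
  refine matEntry_ext fun a b => ?_
  rw [matEntry_diagHom]
  apply Subtype.ext
  by_cases h : a = b
  · subst h
    fin_cases a <;> rfl
  · rw [Matrix.diagonal_apply_ne _ h]
    exact (x.2.2 a b h).symm

theorem diagHom_diagOf_zero (ι₀ ι₁ : D.Elem →⋆ₐ[ℂ] N.Elem) (d : D.Elem) :
    diagHom ι₀ ι₁ (diagOf d 0) = matUnit 0 0 (ι₀ d) := by
  refine matEntry_ext fun a b => ?_
  rw [matEntry_diagHom, matEntry_matUnit, diagEntry_diagOf_zero, diagEntry_diagOf_one, map_zero]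
  fin_cases a <;> fin_cases b <;> simp

theorem diagHom_diagOf_one (ι₀ ι₁ : D.Elem →⋆ₐ[ℂ] N.Elem) (d : D.Elem) :
    diagHom ι₀ ι₁ (diagOf 0 d) = matUnit 1 1 (ι₁ d) := by
  refine matEntry_ext fun a b => ?_
  rw [matEntry_diagHom, matEntry_matUnit, diagEntry_diagOf_zero, diagEntry_diagOf_one, map_zero]
  fin_cases a <;> fin_cases b <;> simp

end MatrixUnits

/-! ### Centred words in a realization of the free product. -/

namespace HNNConstruction

variable {H : Type u} [NormedAddCommGroup H] [InnerProductSpace ℂ H] [CompleteSpace H]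
variable {N D : VonNeumannAlgebra H} {hD : D ≤ N} {θ : D.Elem →⋆ₐ[ℂ] N.Elem}
  {ED Eθ : N.Elem →ₗ[ℂ] N.Elem} (X : HNNConstruction.{u, v} N D hD θ ED Eθ)

theorem lamθ_matUnit_zero (d : D.Elem) : X.lamθ (matUnit 0 0 (VonNeumannAlgebra.incl hD d)) =
    X.lam₁ (matUnit 0 0 (VonNeumannAlgebra.incl hD d)) := by
  have h1 := X.isAmalgamatedFreeProduct.amalgam₁ (diagOf d 0)
  have h2 := X.isAmalgamatedFreeProduct.amalgam₂ (diagOf d 0)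
  rw [diagHom_diagOf_zero] at h1
  rw [← diagHom_incl hD, diagHom_diagOf_zero] at h2
  rw [h1, h2]

/-- The amalgam identity at `diag(0, d)`. Only the first copy applies `θ` in this slot, and this
asymmetry produces the relation of the stable letter. -/
theorem lamθ_matUnit_one (d : D.Elem) : X.lamθ (matUnit 1 1 (θ d)) =
    X.lam₁ (matUnit 1 1 (VonNeumannAlgebra.incl hD d)) := by
  have h1 := X.isAmalgamatedFreeProduct.amalgam₁ (diagOf 0 d)
  have h2 := X.isAmalgamatedFreeProduct.amalgam₂ (diagOf 0 d)
  rw [diagHom_diagOf_one] at h1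
  rw [← diagHom_incl hD, diagHom_diagOf_one] at h2
  rw [h1, h2]

/-- The value of a word in the two copies of `M₂(N)`. -/
def eval (w : List ((matVN N).Elem ⊕ (matVN N).Elem)) : X.P.Elem :=
  (w.map (Sum.elim X.lamθ X.lam₁)).prod

/-- An alternating word of centred elements beginning in the second copy of `M₂(N)`. -/
structure IsCentredWord (ED Eθ : N.Elem →ₗ[ℂ] N.Elem)
    (w : List ((matVN N).Elem ⊕ (matVN N).Elem)) : Prop where
  head : ∃ x w', w = Sum.inr x :: w'
  chain : w.IsChain (fun a b => a.isLeft ≠ b.isLeft)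
  inl : ∀ x, Sum.inl x ∈ w → diagExp ED Eθ x = 0
  inr : ∀ x, Sum.inr x ∈ w → diagExp ED ED x = 0

theorem IsCentredWord.single {y : (matVN N).Elem} (hy : diagExp ED ED y = 0) :
    IsCentredWord ED Eθ [Sum.inr y] where
  head := ⟨y, [], rfl⟩
  chain := by simp
  inl x hx := by simp at hx
  inr x hx := by
    have : x = y := by simpa using hx
    rw [this, hy]

theorem IsCentredWord.pair {y z : (matVN N).Elem} (hy : diagExp ED ED y = 0)
    (hz : diagExp ED Eθ z = 0) : IsCentredWord ED Eθ [Sum.inr y, Sum.inl z] where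
  head := ⟨y, _, rfl⟩
  chain := by simp
  inl x hx := by
    have : x = z := by simpa using hx
    rw [this, hz]
  inr x hx := by
    have : x = y := by simpa using hx
    rw [this, hy]

theorem IsCentredWord.cons {y z : (matVN N).Elem} (hy : diagExp ED ED y = 0)
    (hz : diagExp ED Eθ z = 0) {w} (hw : IsCentredWord ED Eθ w) :
    IsCentredWord ED Eθ (Sum.inr y :: Sum.inl z :: w) where
  head := ⟨y, _, rfl⟩
  chain := by
    obtain ⟨x, w', rfl⟩ := hw.head
    exact List.IsChain.cons_cons (by simp) (List.IsChain.cons_cons (by simp) hw.chain)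
  inl x hx := by
    rcases (by simpa using hx : x = z ∨ Sum.inl x ∈ w) with rfl | h
    · exact hz
    · exact hw.inl x h
  inr x hx := by
    rcases (by simpa using hx : x = y ∨ Sum.inr x ∈ w) with rfl | h
    · exact hy
    · exact hw.inr x h

/-- Split `x` into `diagExp ED Eθ x` and a centred part. The centred part prolongs the word, to
which freeness applies. The other part lies in the amalgam and leaves `Exp` by the bimodule
property. -/
theorem Exp_lamθ_mul_eval (x : (matVN N).Elem) {w : List ((matVN N).Elem ⊕ (matVN N).Elem)}
    (hw : IsCentredWord ED Eθ w) : X.Exp (X.lamθ x * X.eval w) = 0 := by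
  have hF := X.isAmalgamatedFreeProduct
  have hne : w ≠ [] := by
    obtain ⟨y, w', rfl⟩ := hw.head
    simp
  have h0 : X.Exp (X.eval w) = 0 := hF.free w hne hw.chain hw.inl hw.inr
  have hmem : X.lamθ (diagExp ED Eθ x) ∈ X.lam.range := by
    rw [← hF.compatible₁]
    exact hF.condExp.mem _
  -- Idempotence of `diagExp ED Eθ` is inherited from `Exp` through the injective map `lamθ`.
  have hidem : diagExp ED Eθ (x - diagExp ED Eθ x) = 0 := by
    apply hF.injective₁
    rw [← hF.compatible₁, map_sub, map_sub, hF.condExp.id_on _ hmem, hF.compatible₁, sub_self,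
      map_zero]
  have h1 : X.Exp (X.lamθ (diagExp ED Eθ x) * X.eval w) = 0 := by
    have := hF.condExp.bimodule _ hmem 1 (one_mem _) (X.eval w)
    rwa [mul_one, mul_one, h0, mul_zero] at this
  have h2 : X.Exp (X.lamθ (x - diagExp ED Eθ x) * X.eval w) = 0 := by
    refine hF.free (Sum.inl (x - diagExp ED Eθ x) :: w) (by simp) ?_ ?_ ?_
    · obtain ⟨y, w', rfl⟩ := hw.head
      exact List.IsChain.cons_cons (by simp) hw.chain
    · intro y hy
      rcases (by simpa using hy : y = x - diagExp ED Eθ x ∨ Sum.inl y ∈ w) with rfl | h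
      · exact hidem
      · exact hw.inl y h
    · intro y hy
      exact hw.inr y (by simpa using hy)
  have h3 : X.lamθ x * X.eval w = X.lamθ (x - diagExp ED Eθ x) * X.eval w +
      X.lamθ (diagExp ED Eθ x) * X.eval w := by
    rw [← add_mul, ← map_add, sub_add_cancel]
  rw [h3, map_add, h1, h2, add_zero]

/-- Let `z` be the product and `Expθ z = lamθ m`. Since `Exp ∘ Expθ = Exp`, the element `(Expθ z)*
(Expθ z)` has the same image under `Exp` as `lamθ (m*) z`, which is `0`. Faithfulness of `Exp`
concludes. -/
theorem Expθ_lamθ_mul_eval (x : (matVN N).Elem) {w : List ((matVN N).Elem ⊕ (matVN N).Elem)}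
    (hw : IsCentredWord ED Eθ w) : X.Expθ (X.lamθ x * X.eval w) = 0 := by
  obtain ⟨m, hm⟩ := X.condExp_Expθ.mem (X.lamθ x * X.eval w)
  apply X.isAmalgamatedFreeProduct.condExp.faithful
  have hs : star (X.Expθ (X.lamθ x * X.eval w)) ∈ X.lamθ.range := star_mem ⟨m, hm⟩
  have h := X.condExp_Expθ.bimodule _ hs 1 (one_mem _) (X.lamθ x * X.eval w)
  rw [mul_one, mul_one] at h
  rw [← h, X.Exp_Expθ, ← mul_assoc, ← hm]
  have h' : star (X.lamθ m) * X.lamθ x = X.lamθ (star m * x) := by rw [map_mul, map_star]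
  exact h' ▸ X.Exp_lamθ_mul_eval (star m * x) hw

end HNNConstruction
end

noncomputable section

set_option linter.unusedSectionVars false

/-! ### The representation of the group HNN extension in a realization. -/

section CornerRepresentations

variable {G : Type*} [Group G] {A B : Subgroup G} {φ : A ≃* B} {R : Type*} [Ring R] [StarRing R]

/-- A unitary representation of an HNN extension on a corner, from its values on the generators. -/
theorem exists_hnnRep {a : G → R} (hmul : ∀ g h, a (g * h) = a g * a h)
    (hstar : ∀ g, a g⁻¹ = star (a g)) {u : R} (h1u : a 1 * u = u) (hu1 : u * a 1 = u)
    (huu : u * star u = a 1) (huu' : star u * u = a 1)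
    (hrel : ∀ k : A, u * a k = a (φ k : G) * u) :
    ∃ s : HNNExtension G A B φ → R, (∀ γ δ, s (γ * δ) = s γ * s δ) ∧
      (∀ γ, s γ⁻¹ = star (s γ)) ∧ (∀ g, s (HNNExtension.of g) = a g) ∧
      s HNNExtension.t = u := by
  have hp : IsIdempotentElem (a 1) := by
    rw [IsIdempotentElem, ← hmul, one_mul]
  have hps : star (a 1) = a 1 := by rw [← hstar, inv_one]
  have hmem : ∀ {x : R}, a 1 * x = x → x * a 1 = x → x ∈ Subsemigroup.corner (a 1) :=
    fun h h' => (Subsemigroup.mem_corner_iff hp).2 ⟨h, h'⟩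
  have hag : ∀ g, a g ∈ Subsemigroup.corner (a 1) := fun g =>
    hmem (by rw [← hmul, one_mul]) (by rw [← hmul, mul_one])
  -- The corner under `a 1` is a monoid with unit `a 1` in which `u` is invertible. The universal
  -- property of the HNN extension is applied to the units of this corner.
  let f : G →* hp.Corner :=
    { toFun := fun g => ⟨a g, hag g⟩
      map_one' := rfl
      map_mul' := fun g h => Subtype.ext (hmul g h) }
  let x : hp.Cornerˣ :=
    { val := ⟨u, hmem h1u hu1⟩
      inv := ⟨star u, hmem (by
        have := congrArg star hu1
        rwa [star_mul, hps] at this) (by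
        have := congrArg star h1u
        rwa [star_mul, hps] at this)⟩
      val_inv := Subtype.ext huu
      inv_val := Subtype.ext huu' }
  let F : HNNExtension G A B φ →* hp.Cornerˣ := HNNExtension.lift f.toHomUnits x fun k =>
    Units.ext (Subtype.ext (hrel k))
  have hof : ∀ g, (F (HNNExtension.of g) : hp.Corner).1 = a g := fun g => by
    rw [HNNExtension.lift_of]
    rfl
  have ht : (F HNNExtension.t : hp.Corner).1 = u := by
    rw [HNNExtension.lift_t]
  have hm : ∀ γ δ, (F (γ * δ) : hp.Corner).1 = (F γ : hp.Corner).1 * (F δ : hp.Corner).1 :=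
    fun γ δ => by rw [map_mul]; rfl
  refine ⟨fun γ => (F γ : hp.Corner).1, hm, fun γ => ?_, hof, ht⟩
  beta_reduce
  -- Compatibility with `star` is not part of the universal property, so it is propagated from the
  -- generators.
  induction γ using HNNExtension.induction_on with
  | of g => rw [← map_inv, hof, hof, hstar]
  | t =>
    rw [ht, map_inv, HNNExtension.lift_t]
    rfl
  | mul γ δ h h' => rw [mul_inv_rev, hm, hm, h, h', star_mul]
  | inv γ h => rw [inv_inv, h, star_star]

end CornerRepresentations

namespace HNNConstruction

variable {G : Type u} [Group G] {H : Subgroup G} {θ : H →* G} (hθ : Function.Injective θ)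
  {Θ : (subgroupVN H).Elem →⋆ₐ[ℂ] (groupVN G).Elem}
  (hΘ : ∀ h : H, Θ (subgroupUnitary h) = groupUnitary (θ h))
  (X : HNNConstruction.{u, v} (groupVN G) (subgroupVN H) (subgroupVN_le H) Θ
    (groupExp H) (groupExp θ.range))

theorem base_mul (n m : (groupVN G).Elem) : X.base (n * m) = X.base n * X.base m := by
  change X.lamθ (matUnit 0 0 (n * m)) = X.lamθ (matUnit 0 0 n) * X.lamθ (matUnit 0 0 m)
  rw [← map_mul, matUnit_mul]

theorem base_star (n : (groupVN G).Elem) : X.base (star n) = star (X.base n) := by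
  change X.lamθ (matUnit 0 0 (star n)) = star (X.lamθ (matUnit 0 0 n))
  rw [← map_star, matUnit_star]

theorem Expθ_base (n : (groupVN G).Elem) : X.Expθ (X.base n) = X.base n :=
  X.condExp_Expθ.id_on _ ⟨_, rfl⟩

theorem lamθ_unit_zero : X.lamθ (matUnit 0 0 1) = X.lam₁ (matUnit 0 0 1) := by
  have := X.lamθ_matUnit_zero 1
  rwa [map_one] at this

theorem lamθ_unit_one : X.lamθ (matUnit 1 1 1) = X.lam₁ (matUnit 1 1 1) := by
  have := X.lamθ_matUnit_one 1
  rwa [map_one, map_one] at this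

theorem base_one_mul_stable : X.base 1 * X.stable = X.stable := by
  change X.lamθ (matUnit 0 0 1) * (X.lam₁ (matUnit 0 1 1) * X.lamθ (matUnit 1 0 1)) =
    X.lam₁ (matUnit 0 1 1) * X.lamθ (matUnit 1 0 1)
  rw [X.lamθ_unit_zero, ← mul_assoc, ← map_mul, matUnit_mul, mul_one]

theorem stable_mul_base (n : (groupVN G).Elem) :
    X.stable * X.base n = X.lam₁ (matUnit 0 1 1) * X.lamθ (matUnit 1 0 n) := by
  change X.lam₁ (matUnit 0 1 1) * X.lamθ (matUnit 1 0 1) * X.lamθ (matUnit 0 0 n) = _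
  rw [mul_assoc, ← map_mul, matUnit_mul, one_mul]

theorem star_stable : star X.stable = X.lamθ (matUnit 0 1 1) * X.lam₁ (matUnit 1 0 1) := by
  change star (X.lam₁ (matUnit 0 1 1) * X.lamθ (matUnit 1 0 1)) = _
  rw [star_mul, ← map_star, ← map_star, matUnit_star, matUnit_star, star_one]

/-- The product is `lam₁(e₀₁) lamθ(e₁₁) lam₁(e₁₀)` in the indices `0, 1`. The amalgam turns the
middle factor into `lam₁(e₁₁)`, and the result `lam₁(e₀₀)` equals `lamθ(e₀₀)`. -/
theorem stable_mul_star : X.stable * star X.stable = X.base 1 := by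
  rw [star_stable]
  change X.lam₁ (matUnit 0 1 1) * X.lamθ (matUnit 1 0 1) *
    (X.lamθ (matUnit 0 1 1) * X.lam₁ (matUnit 1 0 1)) = X.lamθ (matUnit 0 0 1)
  rw [mul_assoc, ← mul_assoc (X.lamθ _), ← map_mul, matUnit_mul, mul_one, X.lamθ_unit_one,
    ← map_mul, ← map_mul, matUnit_mul, matUnit_mul, X.lamθ_unit_zero, mul_one, mul_one]

theorem star_mul_stable : star X.stable * X.stable = X.base 1 := by
  rw [star_stable]
  change X.lamθ (matUnit 0 1 1) * X.lam₁ (matUnit 1 0 1) *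
    (X.lam₁ (matUnit 0 1 1) * X.lamθ (matUnit 1 0 1)) = X.lamθ (matUnit 0 0 1)
  rw [mul_assoc, ← mul_assoc (X.lam₁ _), ← map_mul X.lam₁, matUnit_mul, mul_one, ← X.lamθ_unit_one,
    ← map_mul, ← map_mul, matUnit_mul, matUnit_mul, mul_one, mul_one]

include hΘ in
-- In the slot `(1, 1)` the amalgam turns `λ(θ h)` of the first copy into `λ(h)` of the second. The
-- matrix unit `e₀₁` carries it to the slot `(0, 0)`, where the amalgam returns it to the first copy
-- unchanged.
theorem stable_relation (h : H) : X.stable * X.base (groupUnitary (θ h)) =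
    X.base (groupUnitary (h : G)) * X.stable := by
  have e : groupUnitary (h : G) = VonNeumannAlgebra.incl (subgroupVN_le H) (subgroupUnitary h) :=
    rfl
  have h0 := X.lamθ_matUnit_zero (subgroupUnitary h)
  have h1 := X.lamθ_matUnit_one (subgroupUnitary h)
  rw [← e] at h0 h1
  rw [hΘ] at h1
  rw [stable_mul_base]
  change _ = X.lamθ (matUnit 0 0 (groupUnitary (h : G))) *
    (X.lam₁ (matUnit 0 1 1) * X.lamθ (matUnit 1 0 1))
  rw [h0, ← mul_assoc, ← map_mul, matUnit_mul, mul_one]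
  have e1 : matUnit (N := groupVN G) 1 0 (groupUnitary (θ h)) =
      matUnit 1 1 (groupUnitary (θ h)) * matUnit 1 0 1 := by rw [matUnit_mul, mul_one]
  rw [e1, map_mul, h1, ← mul_assoc, ← map_mul, matUnit_mul, one_mul]

include hΘ in
theorem exists_rep : ∃ s : GroupHNN H θ hθ → X.P.Elem, (∀ γ δ, s (γ * δ) = s γ * s δ) ∧
    (∀ γ, s γ⁻¹ = star (s γ)) ∧ (∀ g, s (HNNExtension.of g) = X.base (groupUnitary g)) ∧
    s HNNExtension.t = X.stable := by
  have h1 : X.base (groupUnitary (1 : G)) = X.base 1 := by rw [groupUnitary_one]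
  refine exists_hnnRep (a := fun g => X.base (groupUnitary g))
    (fun g h => by rw [groupUnitary_mul, base_mul]) (fun g => by rw [groupUnitary_inv, base_star])
    (by rw [h1, base_one_mul_stable]) ?_ (by rw [h1, stable_mul_star])
    (by rw [h1, star_mul_stable]) ?_
  · rw [h1, stable_mul_base]
    rfl
  · rintro ⟨_, h, rfl⟩
    have e : (MonoidHom.ofInjective hθ).symm ⟨θ h, h, rfl⟩ = h :=
      (MonoidHom.ofInjective hθ).symm_apply_apply h
    rw [e]
    exact X.stable_relation hΘ h

/-- The matrix unit in front of the word of a group element beginning with `t ^ ε`. -/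
def leadUnit (G : Type u) [Group G] (ε : ℤˣ) : (matVN (groupVN G)).Elem :=
  if ε = 1 then matUnit 0 0 1 else matUnit 0 1 1

theorem leadUnit_one : leadUnit G 1 = matUnit 0 0 1 := if_pos rfl

theorem leadUnit_neg_one : leadUnit G (-1) = matUnit 0 1 1 := if_neg (by decide)

theorem eval_single (y : (matVN (groupVN G)).Elem) : X.eval [Sum.inr y] = X.lam₁ y :=
  mul_one _

theorem eval_cons (y z : (matVN (groupVN G)).Elem) (w) :
    X.eval (Sum.inr y :: Sum.inl z :: w) = X.lam₁ y * (X.lamθ z * X.eval w) := rfl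

theorem eval_pair (y z : (matVN (groupVN G)).Elem) :
    X.eval [Sum.inr y, Sum.inl z] = X.lam₁ y * X.lamθ z := by
  rw [eval_cons]
  exact congrArg _ (mul_one _)

variable {s : GroupHNN H θ hθ → X.P.Elem} (hmul : ∀ γ δ, s (γ * δ) = s γ * s δ)
  (hstar : ∀ γ, s γ⁻¹ = star (s γ)) (hof : ∀ g, s (HNNExtension.of g) = X.base (groupUnitary g))
  (ht : s HNNExtension.t = X.stable)

include hmul hstar hof ht

theorem rep_pos (g : G) : s (HNNExtension.t ^ ((1 : ℤˣ) : ℤ) * HNNExtension.of g) =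
    X.lamθ (matUnit 0 0 1) * (X.lam₁ (matUnit 0 1 1) * X.lamθ (matUnit 1 0 (groupUnitary g))) := by
  rw [Units.val_one, zpow_one, hmul, ht, hof, ← X.stable_mul_base, ← mul_assoc]
  exact congrArg (· * _) X.base_one_mul_stable.symm

theorem rep_neg (g : G) : s (HNNExtension.t ^ ((-1 : ℤˣ) : ℤ) * HNNExtension.of g) =
    X.lamθ (matUnit 0 1 1) * (X.lam₁ (matUnit 1 0 1) * X.lamθ (matUnit 0 0 (groupUnitary g))) := by
  rw [Units.val_neg, Units.val_one, zpow_neg, zpow_one, hmul, hstar, ht, hof, X.star_stable,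
    mul_assoc]
  rfl

theorem rep_pos_mul (g : G) (x : (matVN (groupVN G)).Elem) (w) :
    s (HNNExtension.t ^ ((1 : ℤˣ) : ℤ) * HNNExtension.of g) * (X.lamθ x * X.eval w) =
      X.lamθ (leadUnit G 1) *
        X.eval (Sum.inr (matUnit 0 1 1) :: Sum.inl (matUnit 1 0 (groupUnitary g) * x) :: w) := by
  rw [X.rep_pos hθ hmul hstar hof ht, eval_cons, leadUnit_one, map_mul]
  simp only [mul_assoc]

theorem rep_neg_mul (g : G) (x : (matVN (groupVN G)).Elem) (w) :
    s (HNNExtension.t ^ ((-1 : ℤˣ) : ℤ) * HNNExtension.of g) * (X.lamθ x * X.eval w) =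
      X.lamθ (leadUnit G (-1)) *
        X.eval (Sum.inr (matUnit 1 0 1) :: Sum.inl (matUnit 0 0 (groupUnitary g) * x) :: w) := by
  rw [X.rep_neg hθ hmul hstar hof ht, eval_cons, leadUnit_neg_one, map_mul]
  simp only [mul_assoc]

omit hmul hstar hof ht in
-- The first-copy matrix between `t` and a following `t ^ ε`. For `ε = 1` it is off-diagonal. For `ε
-- = -1` it is `λ(g) ⊗ e₁₁`, and reducedness gives `g ∉ θ(H)`.
theorem diagExp_pos {ε : ℤˣ} {g : G} (h : g ∈ θ.range → 1 = ε) :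
    diagExp (groupExp H) (groupExp θ.range) (matUnit 1 0 (groupUnitary g) * leadUnit G ε) = 0 := by
  rcases Int.units_eq_one_or ε with rfl | rfl
  · rw [leadUnit_one, matUnit_mul]
    exact diagExp_matUnit_ne (by decide) _
  · rw [leadUnit_neg_one, matUnit_mul, mul_one]
    refine diagExp_matUnit_one (groupExp_unitary_of_notMem fun hg => ?_)
    exact absurd (h hg) (by decide)

omit hmul hstar hof ht in
-- The analogue after `t⁻¹`: for `ε = -1` the matrix is off-diagonal, and for `ε = 1` it is `λ(g) ⊗
-- e₀₀` with `g ∉ H`.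
theorem diagExp_neg {ε : ℤˣ} {g : G} (h : g ∈ H → -1 = ε) :
    diagExp (groupExp H) (groupExp θ.range) (matUnit 0 0 (groupUnitary g) * leadUnit G ε) = 0 := by
  rcases Int.units_eq_one_or ε with rfl | rfl
  · rw [leadUnit_one, matUnit_mul, mul_one]
    refine diagExp_matUnit_zero (groupExp_unitary_of_notMem fun hg => ?_)
    exact absurd (h hg) (by decide)
  · rw [leadUnit_neg_one, matUnit_mul]
    exact diagExp_matUnit_ne (by decide) _

/-- Each factor `t ^ ε g` is a letter of the second copy between two matrices of the first.
Neighbouring matrices of the first copy merge, and reducedness makes the merged ones centred. The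
leftmost one is kept apart as `leadUnit`, since it need not be centred. -/
theorem rep_word (l : List (ℤˣ × G)) (ε : ℤˣ) (g : G)
    (hl : ((ε, g) :: l).IsChain
      fun a b => a.2 ∈ HNNExtension.toSubgroup θ.range H a.1 → a.1 = b.1) :
    ∃ w, IsCentredWord (groupExp H) (groupExp θ.range) w ∧
      s ((((ε, g) :: l).map fun x => HNNExtension.t ^ (x.1 : ℤ) * HNNExtension.of x.2).prod) =
        X.lamθ (leadUnit G ε) * X.eval w := by
  have hne1 : (0 : Fin 2) ≠ 1 := by decide
  have hne2 : (1 : Fin 2) ≠ 0 := by decide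
  induction l generalizing ε g with
  | nil =>
    simp only [List.map_cons, List.map_nil, List.prod_cons, List.prod_nil, mul_one]
    rcases Int.units_eq_one_or ε with rfl | rfl
    · refine ⟨_, IsCentredWord.pair (diagExp_matUnit_ne hne1 1)
        (diagExp_matUnit_ne hne2 (groupUnitary g)), ?_⟩
      rw [X.rep_pos hθ hmul hstar hof ht, eval_pair, leadUnit_one]
    -- The final matrix `λ(g) ⊗ e₀₀` is not centred when `g ∈ H`. It then crosses the amalgam and is
    -- absorbed by the letter of the second copy before it.
    · by_cases hg : g ∈ H
      · refine ⟨_, IsCentredWord.single (diagExp_matUnit_ne hne2 (groupUnitary g)), ?_⟩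
        have h0 := X.lamθ_matUnit_zero (subgroupUnitary ⟨g, hg⟩)
        have e : groupUnitary g =
          VonNeumannAlgebra.incl (subgroupVN_le H) (subgroupUnitary ⟨g, hg⟩) := rfl
        rw [X.rep_neg hθ hmul hstar hof ht, e, h0, ← map_mul, matUnit_mul, one_mul]
        rw [eval_single, leadUnit_neg_one]
      · refine ⟨_, IsCentredWord.pair (diagExp_matUnit_ne hne2 1)
          (diagExp_matUnit_zero (groupExp_unitary_of_notMem hg)), ?_⟩
        rw [X.rep_neg hθ hmul hstar hof ht, eval_pair, leadUnit_neg_one]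
  | cons x l ih =>
    obtain ⟨ε', g'⟩ := x
    obtain ⟨hεg, hl'⟩ := List.isChain_cons_cons.1 hl
    obtain ⟨w, hw, hs⟩ := ih ε' g' hl'
    rw [List.map_cons, List.prod_cons, hmul, hs]
    rcases Int.units_eq_one_or ε with rfl | rfl
    · exact ⟨_, IsCentredWord.cons (diagExp_matUnit_ne hne1 1) (diagExp_pos hεg) hw,
        X.rep_pos_mul hθ hmul hstar hof ht g _ w⟩
    · exact ⟨_, IsCentredWord.cons (diagExp_matUnit_ne hne2 1) (diagExp_neg hεg) hw,
        X.rep_neg_mul hθ hmul hstar hof ht g _ w⟩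

/-- The normal form of `γ` is some `g₀` followed by a reduced word, nonempty because `γ ∉ G`. The
factor `λ(g₀)` joins the matrix in front of the centred word. -/
theorem Expθ_rep (γ : GroupHNN H θ hθ)
    (hγ : γ ∉ (HNNExtension.of : G →* GroupHNN H θ hθ).range) : X.Expθ (s γ) = 0 := by
  obtain ⟨d⟩ := HNNExtension.NormalWord.TransversalPair.nonempty G θ.range H
  obtain ⟨nw, rfl⟩ := (HNNExtension.NormalWord.equiv (MonoidHom.ofInjective hθ).symm d).symm.surjective γ
  change nw.prod _ ∉ _ at hγ
  change X.Expθ (s (nw.prod _)) = 0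
  obtain ⟨⟨g₀, l, hl⟩, hset⟩ := nw
  cases l with
  | nil =>
    refine absurd ⟨g₀, ?_⟩ hγ
    simp [HNNExtension.NormalWord.ReducedWord.prod]
  | cons x l =>
    obtain ⟨ε, g⟩ := x
    obtain ⟨w, hw, hs⟩ := X.rep_word hθ hmul hstar hof ht l ε g hl
    rw [HNNExtension.NormalWord.ReducedWord.prod, hmul, hof, hs]
    change X.Expθ (X.lamθ (matUnit 0 0 (groupUnitary g₀)) * _) = 0
    rw [← mul_assoc, ← map_mul]
    exact X.Expθ_lamθ_mul_eval _ hw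

end HNNConstruction
end

noncomputable section

set_option linter.unusedSectionVars false

/-! ### Support projections, coordinates of intertwiners, induction to a larger group. -/

section Support

variable {H : Type*} [NormedAddCommGroup H] [InnerProductSpace ℂ H] [CompleteSpace H]
variable {K : Type*} [NormedAddCommGroup K] [InnerProductSpace ℂ K] [CompleteSpace K]

open ContinuousLinearMap (adjoint)

theorem VonNeumannAlgebra.generatedBy_le {S : Set (K →L[ℂ] K)} {N : VonNeumannAlgebra K}
    (h : ∀ x ∈ S, x ∈ N) : VonNeumannAlgebra.generatedBy S ≤ N := by
  intro x hx
  have hx' : x ∈ StarSubalgebra.centralizer ℂ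
    (StarSubalgebra.centralizer ℂ S : Set (K →L[ℂ] K)) := hx
  rw [StarSubalgebra.mem_centralizer_iff] at hx'
  refine VonNeumannAlgebra.mem_of_commute fun y hy => (hx' y ?_).1
  rw [SetLike.mem_coe, StarSubalgebra.mem_centralizer_iff]
  exact fun s hs => ⟨VonNeumannAlgebra.mem_commutant_iff.1 hy _ (h s hs),
    VonNeumannAlgebra.mem_commutant_iff.1 hy _ (star_mem (h s hs))⟩

/-- The projection onto the closure of `P' η` belongs to `P`. -/
theorem VonNeumannAlgebra.exists_support (P : VonNeumannAlgebra K) (η : K) :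
    ∃ q : P.Elem, star q * q = q ∧ (q : K →L[ℂ] K) η = η ∧
      ∀ ζ, (∀ y ∈ P.commutant, ⟪η, y ζ⟫_ℂ = 0) → (q : K →L[ℂ] K) ζ = 0 := by
  let R : Submodule ℂ K :=
    (Submodule.span ℂ {v | ∃ y ∈ P.commutant, v = y η}).topologicalClosure
  have : CompleteSpace R := (Submodule.isClosed_topologicalClosure _).completeSpace_coe
  have hinv : ∀ y ∈ P.commutant, ∀ v ∈ R, y v ∈ R := by
    intro y hy v hv
    have : R ≤ R.comap (y : K →ₗ[ℂ] K) := by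
      refine Submodule.topologicalClosure_minimal _ (Submodule.span_le.2 ?_)
        ((Submodule.isClosed_topologicalClosure _).preimage y.continuous)
      rintro _ ⟨z, hz, rfl⟩
      exact Submodule.le_topologicalClosure _
        (Submodule.subset_span ⟨y * z, mul_mem hy hz, rfl⟩)
    exact this hv
  have hmem : R.starProjection ∈ P := VonNeumannAlgebra.mem_of_commute fun y hy =>
    (starProjection_commute (hinv y hy) (hinv _ (star_mem hy))).symm
  refine ⟨⟨R.starProjection, hmem⟩, Subtype.ext ?_, ?_, fun ζ hζ => ?_⟩
  · change star R.starProjection * R.starProjection = R.starProjection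
    rw [show star R.starProjection = R.starProjection from isSelfAdjoint_starProjection R]
    exact R.isIdempotentElem_starProjection
  · exact Submodule.starProjection_eq_self_iff.2 (Submodule.le_topologicalClosure _
      (Submodule.subset_span ⟨1, one_mem _, rfl⟩))
  · refine (Submodule.starProjection_apply_eq_zero_iff R).2 ?_
    have h : R ≤ LinearMap.ker (innerSL ℂ ζ : K →ₗ[ℂ] ℂ) := by
      refine Submodule.topologicalClosure_minimal _ (Submodule.span_le.2 ?_)
        (innerSL ℂ ζ).isClosed_ker
      rintro _ ⟨y, hy, rfl⟩
      change ⟪ζ, y η⟫_ℂ = 0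
      have := hζ _ (star_mem hy)
      rw [ContinuousLinearMap.star_eq_adjoint, ContinuousLinearMap.adjoint_inner_right] at this
      rw [← inner_conj_symm, this, map_zero]
    rw [Submodule.mem_orthogonal']
    exact fun v hv => h hv

/-- Evaluation at a coordinate. -/
def AmpSpace.eval (ι : Type*) (H : Type*) [NormedAddCommGroup H] [InnerProductSpace ℂ H]
    (i : ι) : AmpSpace ι H →L[ℂ] H := lp.evalCLM ℂ (fun _ : ι => H) 2 i

/-- An intertwiner on an amplification has a coordinate that does as well. -/
theorem IsRep.exists_coordinate {Γ : Type*} [Group Γ] {U : Γ → H →L[ℂ] H} {σ : Γ → K →L[ℂ] K}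
    (hU : IsRep U) {ι : Type*} {T : AmpSpace ι H →L[ℂ] K}
    (hT : ∀ γ, T ∘L amp ι (U γ) = σ γ ∘L T) {η : K} (hη : adjoint T η ≠ 0) :
    ∃ T₁ : H →L[ℂ] K, (∀ γ, T₁ ∘L U γ = σ γ ∘L T₁) ∧ adjoint T₁ η ≠ 0 := by
  obtain ⟨i, hi⟩ : ∃ i, (adjoint T η) i ≠ 0 := by
    by_contra h
    push Not at h
    exact hη (lp.ext (funext h))
  refine ⟨T ∘L adjoint (AmpSpace.eval ι H i), fun γ => ?_, ?_⟩
  · have h := (hU.amplify ι).adjoint_intertwines hU (T := AmpSpace.eval ι H i)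
      (fun γ => rfl) γ
    rw [ContinuousLinearMap.comp_assoc, h, ← ContinuousLinearMap.comp_assoc, hT,
      ContinuousLinearMap.comp_assoc]
  · rw [ContinuousLinearMap.adjoint_comp, ContinuousLinearMap.adjoint_adjoint]
    exact hi

end Support

section Induction

variable {G : Type*} [Group G] {Γ : Type*} [Group Γ]

open ContinuousLinearMap (adjoint)

open Classical in
/-- The isometry `ℓ²(G) → ℓ²(Γ)` of an injective homomorphism. -/
theorem exists_isometry (f : G →* Γ) (hf : Function.Injective f) :
    ∃ V : ellTwo G →L[ℂ] ellTwo Γ, (∀ g, adjoint V ∘L leftReg (f g) ∘L V = leftReg g) ∧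
      ∀ γ, γ ∉ f.range → adjoint V ∘L leftReg γ ∘L V = 0 := by
  obtain ⟨V, -, hV, -⟩ := (isRep_leftReg (MonoidHom.id G)).exists_partialIsometry (isRep_leftReg f)
    (a := delta 1) (b := delta 1) (fun γ => by
      rw [inner_delta_left, inner_delta_left, leftReg_delta, leftReg_delta, delta_apply,
        delta_apply, mul_one, mul_one]
      have h : (1 : Γ) = f γ ↔ 1 = γ := by rw [eq_comm, map_eq_one_iff f hf, eq_comm]
      simp only [h, MonoidHom.id_apply])
  have hVd : ∀ k, V (delta k) = delta (f k) := fun k => by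
    have := hV k
    rwa [leftReg_delta, leftReg_delta, mul_one, mul_one] at this
  have hco : ∀ γ k l, (adjoint V ∘L leftReg γ ∘L V) (delta k) l =
      if f l = γ * f k then 1 else 0 := fun γ k l => by
    rw [← inner_delta_left, ContinuousLinearMap.comp_apply,
      ContinuousLinearMap.adjoint_inner_right, ContinuousLinearMap.comp_apply, hVd, hVd,
      leftReg_delta, inner_delta_left, delta_apply]
  refine ⟨V, fun g => ext_coeff fun k l => ?_, fun γ hγ => ext_coeff fun k l => ?_⟩
  · rw [hco, leftReg_delta, delta_apply, ← map_mul, hf.eq_iff]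
  · rw [hco, if_neg]
    · rfl
    · intro h
      exact hγ ⟨l * k⁻¹, by rw [map_mul, h, map_inv, mul_inv_cancel_right]⟩

end Induction

section MatrixNormality

variable {H : Type*} [NormedAddCommGroup H] [InnerProductSpace ℂ H] [CompleteSpace H]
variable {N : VonNeumannAlgebra H}

theorem inner_matUnit_zero (n : N.Elem) (ξ : Doubled H) :
    ⟪ξ, (matUnit 0 0 n : Doubled H →L[ℂ] Doubled H) ξ⟫_ℂ = ⟪ξ 0, (n : H →L[ℂ] H) (ξ 0)⟫_ℂ := by
  have h : ∀ i j, entry (matUnit 0 0 n : Doubled H →L[ℂ] Doubled H) i j =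
      (if 0 = i ∧ 0 = j then n else 0 : N.Elem) := fun i j =>
    congrArg Subtype.val (matEntry_matUnit 0 0 n i j)
  rw [PiLp.inner_apply, Fin.sum_univ_two, apply_eq_sum_entry, apply_eq_sum_entry]
  simp [h]

theorem isNormalMap_matUnit_zero : IsNormalMap N (matVN N) (matUnit 0 0) :=
  isNormalMap_of_hasSum (ι := Unit) (fun ξ _ => ξ 0) (fun _ => Summable.of_finite) fun ξ x => by
    rw [inner_matUnit_zero]
    exact hasSum_unique _

end MatrixNormality
end

noncomputable section

set_option linter.unusedSectionVars false

/-! ### The range of an injective normal homomorphism. -/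

section InverseIntertwiner

variable {H : Type*} [NormedAddCommGroup H] [InnerProductSpace ℂ H] [CompleteSpace H]
variable {K : Type*} [NormedAddCommGroup K] [InnerProductSpace ℂ K] [CompleteSpace K]
variable {Γ : Type*} [Group Γ]

open ContinuousLinearMap (adjoint)

/-- The adjoints of the intertwiners of an injective normal homomorphism cover the space. -/
theorem exists_inverse_intertwiner {N : VonNeumannAlgebra H} {Q : VonNeumannAlgebra K}
    {w : Γ → N.Elem} (hU : IsRep fun γ => (w γ : H →L[ℂ] H))
    {s : Γ → Q.Elem} (hσ : IsRep fun γ => (s γ : K →L[ℂ] K)) {Φ : N.Elem → Q.Elem}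
    {t : Set (H →L[ℂ] K)}
    {ht : ∀ ξ, Summable (fun V : t => ‖adjoint (V : H →L[ℂ] K) ξ‖ ^ 2) ∧
      ∑' V : t, ‖adjoint (V : H →L[ℂ] K) ξ‖ ^ 2 ≤ ‖ξ‖ ^ 2}
    (hti : ∀ V ∈ t, ∀ γ, V ∘L (w γ : H →L[ℂ] H) = (s γ : K →L[ℂ] K) ∘L V)
    (hΦ : ∀ x : N.Elem, (Φ x : K →L[ℂ] K) =
      krausMap (fun V : t => adjoint (V : H →L[ℂ] K)) ht x)
    (hker : ∀ x, Φ x = 0 → x = 0) {η : H} (hη : η ≠ 0) :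
    ∃ T : K →L[ℂ] H, (∀ γ, T ∘L (s γ : K →L[ℂ] K) = (w γ : H →L[ℂ] H) ∘L T) ∧
      adjoint T η ≠ 0 := by
  by_contra hcon
  push Not at hcon
  -- For `z` in the commutant of `N`, each `z V*` is an intertwiner in the opposite direction. If
  -- none of these detects `η`, then `q V* = 0` for every `V`, so `Φ q = ∑ V q V* = 0` although `q η
  -- = η`.
  obtain ⟨q, hqq, hqη, hq⟩ := N.exists_support η
  have h0 : ∀ (V : t) (v : K), (q : H →L[ℂ] H) (adjoint (V : H →L[ℂ] K) v) = 0 := by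
    intro V v
    refine hq _ fun z hz => ?_
    have h1 := hcon (z ∘L adjoint (V : H →L[ℂ] K)) (fun γ => by
      have h2 : adjoint (V : H →L[ℂ] K) ∘L (s γ : K →L[ℂ] K) =
        (w γ : H →L[ℂ] H) ∘L adjoint (V : H →L[ℂ] K) := hU.adjoint_intertwines hσ (hti V V.2) γ
      have h3 : z ∘L (w γ : H →L[ℂ] H) = (w γ : H →L[ℂ] H) ∘L z :=
        (VonNeumannAlgebra.mem_commutant_iff.1 hz _ (w γ).2).symm
      rw [ContinuousLinearMap.comp_assoc, h2, ← ContinuousLinearMap.comp_assoc, h3,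
        ContinuousLinearMap.comp_assoc])
    have h4 : z (adjoint (V : H →L[ℂ] K) v) = (z ∘L adjoint (V : H →L[ℂ] K)) v := rfl
    rw [h4, ← ContinuousLinearMap.adjoint_inner_left, h1, inner_zero_left]
  have hq0 : q = 0 := hker q (Subtype.ext (ContinuousLinearMap.ext fun v =>
    ext_inner_left ℂ fun ξ => by
      rw [hΦ]
      refine (inner_krausMap _ ξ v).unique ?_
      simp only [h0, inner_zero_right]
      simp))
  rw [hq0] at hqη
  exact hη hqη.symm

/-- The range of an injective normal homomorphism is generated by the image of the generators. -/
theorem range_of_injective {N : VonNeumannAlgebra H} {P M : VonNeumannAlgebra K}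
    {w : Γ → N.Elem} (hU : IsRep fun γ => (w γ : H →L[ℂ] H))
    (hN : GeneratedByRep N fun γ => (w γ : H →L[ℂ] H)) (hw1 : w 1 = 1)
    {s : Γ → P.Elem} (hσ : IsRep fun γ => (s γ : K →L[ℂ] K))
    (hsM : ∀ γ, (s γ : K →L[ℂ] K) ∈ M) (hMs : GeneratedByRep M fun γ => (s γ : K →L[ℂ] K))
    (hMP : M ≤ P) {Φ : N.Elem →⋆ₙₐ[ℂ] P.Elem} (hΦ : ∀ γ, Φ (w γ) = s γ) {t : Set (H →L[ℂ] K)}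
    {ht : ∀ ξ, Summable (fun V : t => ‖adjoint (V : H →L[ℂ] K) ξ‖ ^ 2) ∧
      ∑' V : t, ‖adjoint (V : H →L[ℂ] K) ξ‖ ^ 2 ≤ ‖ξ‖ ^ 2}
    (hti : ∀ V ∈ t, ∀ γ, V ∘L (w γ : H →L[ℂ] H) = (s γ : K →L[ℂ] K) ∘L V)
    (hΦk : ∀ x : N.Elem, (Φ x : K →L[ℂ] K) =
      krausMap (fun V : t => adjoint (V : H →L[ℂ] K)) ht x)
    (hker : ∀ x, Φ x = 0 → x = 0) :
    Set.range Φ = {y : P.Elem | (y : K →L[ℂ] K) ∈ M ∧ s 1 * y * s 1 = y} := by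
  have hΦn : IsNormalMap N P Φ := isNormalMap_krausMap hΦk
  ext y
  constructor
  · rintro ⟨x, rfl⟩
    constructor
    · have := hΦn.mem_of_generators (Q := M) hU hN (fun γ => by rw [hΦ]; exact hsM γ) x
      rwa [hw1, mul_one] at this
    · rw [← hΦ, ← map_mul, ← map_mul, hw1, one_mul, mul_one]
  · rintro ⟨hy, hyp⟩
    -- A right inverse of `Φ` on the corner: `Φ ∘ Ψ` and the inclusion of `M` agree on the
    -- generators, hence at every `y * s 1`, and here `y * s 1 = y`.
    obtain ⟨Ψ, hΨ, t', hb', -, hΨk⟩ := exists_normalHom (N := M)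
      (w := fun γ => ⟨s γ, hsM γ⟩) hσ hMs hU (fun η _ hη =>
        exists_inverse_intertwiner hU hσ hti hΦk hker hη)
    have hΨn : IsNormalMap M N Ψ := isNormalMap_krausMap hΨk
    have h1 := IsNormalMap.eq_on (N := M) (w := fun γ => ⟨s γ, hsM γ⟩) hσ hMs (hΦn.comp hΨn)
      (isNormalMap_subtype (VonNeumannAlgebra.incl hMP) fun _ => rfl)
      (fun γ => by rw [Function.comp_apply, hΨ, hΦ]; rfl) ⟨y, hy⟩
    have h2 : (⟨y, hy⟩ : M.Elem) * ⟨s 1, hsM 1⟩ = ⟨y, hy⟩ := Subtype.ext (by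
      have h3 : y * s 1 = y := by
        have hpp : s 1 * s 1 = s 1 := by rw [← hΦ, ← map_mul, hw1, mul_one]
        conv_lhs => rw [← hyp, mul_assoc, hpp, hyp]
      exact congrArg (fun z : P.Elem => (z : K →L[ℂ] K)) h3)
    rw [h2] at h1
    exact ⟨Ψ ⟨y, hy⟩, h1⟩

end InverseIntertwiner

/-! ### The isomorphism onto a given realization. -/

namespace HNNConstruction

open ContinuousLinearMap (adjoint)

variable {G : Type u} [Group G] {H : Subgroup G} {θ : H →* G} (hθ : Function.Injective θ)
  {Θ : (subgroupVN H).Elem →⋆ₐ[ℂ] (groupVN G).Elem}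
  (X : HNNConstruction.{u, v} (groupVN G) (subgroupVN H) (subgroupVN_le H) Θ
    (groupExp H) (groupExp θ.range))

theorem isNormalMap_base : IsNormalMap (groupVN G) X.P X.base :=
  X.isAmalgamatedFreeProduct.normal₁.comp isNormalMap_matUnit_zero

theorem base_injective : Function.Injective X.base := by
  intro n m h
  have h1 : matUnit 0 0 n = matUnit 0 0 m := X.isAmalgamatedFreeProduct.injective₁ h
  have h2 := congrArg (fun z => matEntry z 0 0) h1
  simpa only [matEntry_matUnit, and_self, if_true] using h2

variable {s : GroupHNN H θ hθ → X.P.Elem} (hmul : ∀ γ δ, s (γ * δ) = s γ * s δ)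
  (hstar : ∀ γ, s γ⁻¹ = star (s γ)) (hof : ∀ g, s (HNNExtension.of g) = X.base (groupUnitary g))
  (ht : s HNNExtension.t = X.stable)

include hof in
theorem rep_one : s 1 = X.base 1 := by
  rw [← groupUnitary_one, ← hof, map_one]

include hmul hstar in
theorem isRep_rep : IsRep fun γ => (s γ : X.K →L[ℂ] X.K) where
  mul γ δ := by rw [hmul]; rfl
  star γ := by rw [hstar]; rfl

include hmul hstar hof ht

/-- The vector functionals of the conditional expectation are coefficients of the regular
representation of the HNN extension. -/
theorem exists_regular_vector (ξ : X.K) : ∃ a : AmpSpace ℕ (ellTwo (GroupHNN H θ hθ)),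
    ∀ γ, ⟪a, amp ℕ (leftReg γ) a⟫_ℂ = ⟪ξ, (X.Expθ (s γ) : X.K →L[ℂ] X.K) ξ⟫_ℂ := by
  obtain ⟨ζ, hζ, hs⟩ := X.isNormalMap_base ξ
  -- On `G` the coefficients are `∑ ⟪ζₙ, λ(g) ζₙ⟫`. Placing the `ζₙ` in `ℓ²` of the HNN extension
  -- makes the coefficients vanish off `G`, in accordance with `Expθ_rep`.
  obtain ⟨V, hV, hV'⟩ := exists_isometry (HNNExtension.of : G →* GroupHNN H θ hθ)
    (HNNExtension.of_injective _)
  have hsum : Summable fun n => ‖V (ζ n)‖ ^ 2 := by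
    refine (hζ.mul_left (‖V‖ ^ 2)).of_nonneg_of_le (fun n => sq_nonneg _) fun n => ?_
    rw [← mul_pow]
    exact pow_le_pow_left₀ (norm_nonneg _) (V.le_opNorm _) 2
  refine ⟨ampVec _ hsum, fun γ => ?_⟩
  refine (inner_amp (leftReg γ) (ampVec _ hsum) (ampVec _ hsum)).unique ?_
  have hco : ∀ n, ⟪ampVec _ hsum n, leftReg γ (ampVec _ hsum n)⟫_ℂ =
      ⟪ζ n, (adjoint V ∘L leftReg γ ∘L V) (ζ n)⟫_ℂ := fun n => by
    rw [ContinuousLinearMap.comp_apply, ContinuousLinearMap.adjoint_inner_right]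
    rfl
  refine HasSum.congr_fun ?_ hco
  by_cases hγ : γ ∈ (HNNExtension.of : G →* GroupHNN H θ hθ).range
  · obtain ⟨g, rfl⟩ := hγ
    rw [hV, hof, X.Expθ_base]
    exact hs (groupUnitary g)
  · rw [hV' γ hγ, X.Expθ_rep hθ hmul hstar hof ht γ hγ]
    simp

/-- Suppose that no intertwiner detects `η`, and let `q` be its support projection in `P`. The
vectors `ζₙ` representing `⟪ξ, Expθ(·) ξ⟫` have the coefficients of a vector in a multiple of the
regular representation, so intertwiners reach each `s 1 ζₙ`. Hence `q ζₙ = 0` for all `n`, which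
gives `Expθ q = 0`. Faithfulness yields `q = 0`, against `q η = η`. -/
theorem exists_intertwiner {η : X.K} (hη1 : (s 1 : X.K →L[ℂ] X.K) η = η) (hη : η ≠ 0) :
    ∃ T : ellTwo (GroupHNN H θ hθ) →L[ℂ] X.K,
      (∀ γ, T ∘L leftReg γ = (s γ : X.K →L[ℂ] X.K) ∘L T) ∧ adjoint T η ≠ 0 := by
  by_contra hcon
  push Not at hcon
  have hrep := X.isRep_rep hθ hmul hstar
  have hreg : IsRep (leftReg (G := GroupHNN H θ hθ)) := isRep_leftReg (MonoidHom.id _)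
  obtain ⟨q, hqq, hqη, hq⟩ := X.P.exists_support η
  have hE : X.Expθ (star q * q) = 0 := by
    have hquad : ∀ ξ, ⟪(X.Expθ (star q * q) : X.K →L[ℂ] X.K) ξ, ξ⟫_ℂ = 0 := by
      intro ξ
      obtain ⟨ζ, hζ, hs⟩ := X.condExp_Expθ.normal ξ
      obtain ⟨a, ha⟩ := X.exists_regular_vector hθ hmul hstar hof ht ξ
      obtain ⟨V, hV, hVa, -, -⟩ := (hreg.amplify ℕ).exists_partialIsometry (hrep.amplify ℕ)
        (a := a) (b := ampVec ζ hζ) (fun γ => by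
          rw [ha]
          exact (hs (s γ)).unique (inner_amp _ _ _))
      have hzero : ∀ n, (q : X.K →L[ℂ] X.K) (ζ n) = 0 := by
        intro n
        refine hq _ fun y hy => ?_
        -- An intertwiner from the multiple of the regular representation; `y` may be inserted
        -- because it commutes with `P`.
        obtain ⟨T, hT⟩ : ∃ T, T = y ∘L AmpSpace.eval ℕ X.K n ∘L V := ⟨_, rfl⟩
        have hTi : ∀ γ, T ∘L amp ℕ (leftReg γ) = (s γ : X.K →L[ℂ] X.K) ∘L T := by
          intro γ
          have h1 : y ∘L (s γ : X.K →L[ℂ] X.K) = (s γ : X.K →L[ℂ] X.K) ∘L y :=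
            (VonNeumannAlgebra.mem_commutant_iff.1 hy _ (s γ).2).symm
          rw [hT, ContinuousLinearMap.comp_assoc, ContinuousLinearMap.comp_assoc, hV,
            ← ContinuousLinearMap.comp_assoc (s γ : X.K →L[ℂ] X.K), ← h1]
          rfl
        have hT0 : adjoint T η = 0 := by
          by_contra hne
          obtain ⟨T₁, h1, h2⟩ := hreg.exists_coordinate hTi hne
          exact h2 (hcon T₁ h1)
        have h3 : T (amp ℕ (leftReg 1) a) = y ((s 1 : X.K →L[ℂ] X.K) (ζ n)) := by
          rw [hT, ContinuousLinearMap.comp_apply, ContinuousLinearMap.comp_apply, hVa]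
          rfl
        have h4 : y ((s 1 : X.K →L[ℂ] X.K) (ζ n)) = (s 1 : X.K →L[ℂ] X.K) (y (ζ n)) :=
          congrArg (fun B => B (ζ n)) (VonNeumannAlgebra.mem_commutant_iff.1 hy _ (s 1).2).symm
        -- Since `s 1` fixes `η`, passing from `ζ n` to `s 1 (ζ n)` does not change its pairing with
        -- `η`.
        have h5 : adjoint (s 1 : X.K →L[ℂ] X.K) η = η := by
          have := hrep.star 1
          rw [inv_one, ContinuousLinearMap.star_eq_adjoint] at this
          rw [← this, hη1]
        rw [← h5, ContinuousLinearMap.adjoint_inner_left, ← h4, ← h3,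
          ← ContinuousLinearMap.adjoint_inner_left, hT0, inner_zero_left]
      have h6 := hs (star q * q)
      rw [hqq] at h6 ⊢
      simp only [hzero, inner_zero_right] at h6
      rw [← inner_conj_symm, h6.unique hasSum_zero, map_zero]
    exact Subtype.ext (by
      have := (inner_map_self_eq_zero
        (X.Expθ (star q * q) : X.K →L[ℂ] X.K).toLinearMap).1 hquad
      ext v
      exact congrArg (fun B => B v) this)
  have hq0 := X.condExp_Expθ.faithful q hE
  rw [hq0] at hqη
  exact hη hqη.symm

theorem rep_mem (γ : GroupHNN H θ hθ) : (s γ : X.K →L[ℂ] X.K) ∈ VonNeumannAlgebra.generatedBy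
    (Set.range (fun n => (X.base n : X.K →L[ℂ] X.K)) ∪ {(X.stable : X.K →L[ℂ] X.K)}) := by
  induction γ using HNNExtension.induction_on with
  | of g =>
    rw [hof]
    exact VonNeumannAlgebra.subset_generatedBy _ (Or.inl ⟨_, rfl⟩)
  | t =>
    rw [ht]
    exact VonNeumannAlgebra.subset_generatedBy _ (Or.inr rfl)
  | mul γ δ h h' =>
    rw [hmul]
    exact mul_mem h h'
  | inv γ h =>
    rw [hstar]
    exact star_mem h

/-- The map `π` is normal and the `λ(g)` generate `L(G)`, so the images of group elements already
generate `π(L(G))`. -/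
theorem generatedByRep_rep : GeneratedByRep (VonNeumannAlgebra.generatedBy
    (Set.range (fun n => (X.base n : X.K →L[ℂ] X.K)) ∪ {(X.stable : X.K →L[ℂ] X.K)}))
    fun γ => (s γ : X.K →L[ℂ] X.K) := by
  have h := generatedByRep_generatedBy (X.isRep_rep hθ hmul hstar)
    (S := Set.range fun γ => (s γ : X.K →L[ℂ] X.K)) subset_rfl
  intro x hx
  refine h x (VonNeumannAlgebra.generatedBy_le ?_ hx)
  rintro _ (⟨n, rfl⟩ | rfl)
  · have h1 := X.isNormalMap_base.mem_of_generators
      (Q := VonNeumannAlgebra.generatedBy (Set.range fun γ => (s γ : X.K →L[ℂ] X.K)))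
      isRep_groupUnitary generatedByRep_groupVN (fun g => by
        rw [← hof]
        exact VonNeumannAlgebra.subset_generatedBy _ ⟨_, rfl⟩) n
    rwa [groupUnitary_one, mul_one] at h1
  · exact VonNeumannAlgebra.subset_generatedBy _ ⟨HNNExtension.t, congrArg Subtype.val ht⟩

omit hmul hstar hof ht in
theorem generatedBy_le_P : VonNeumannAlgebra.generatedBy
    (Set.range (fun n => (X.base n : X.K →L[ℂ] X.K)) ∪ {(X.stable : X.K →L[ℂ] X.K)}) ≤ X.P := by
  refine VonNeumannAlgebra.generatedBy_le ?_
  rintro _ (⟨n, rfl⟩ | rfl)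
  · exact (X.base n).2
  · exact X.stable.2

/-- The group von Neumann algebra of the HNN extension is the reduced HNN extension. -/
theorem exists_isomorphism {j : (groupVN G).Elem →⋆ₐ[ℂ] (groupVN (GroupHNN H θ hθ)).Elem}
    (hj : IsNormalMap (groupVN G) (groupVN (GroupHNN H θ hθ)) j)
    (hju : ∀ g : G, j (groupUnitary g) = groupUnitary (HNNExtension.of g))
    {EG : (groupVN (GroupHNN H θ hθ)).Elem →ₗ[ℂ] (groupVN (GroupHNN H θ hθ)).Elem}
    (hEG : IsFaithfulNormalCondExp (groupVN (GroupHNN H θ hθ)) j.range EG)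
    (hEG0 : ∀ γ, γ ∉ (HNNExtension.of : G →* GroupHNN H θ hθ).range → EG (groupUnitary γ) = 0) :
    ∃ Φ : (groupVN (GroupHNN H θ hθ)).Elem →⋆ₙₐ[ℂ] X.P.Elem,
      Function.Injective Φ ∧ Set.range Φ = X.algebra ∧
      IsNormalMap (groupVN (GroupHNN H θ hθ)) X.P Φ ∧
      (∀ n, Φ (j n) = X.base n) ∧
      Φ (groupUnitary HNNExtension.t) = X.stable ∧
      ∀ x, Φ (EG x) = X.Expθ (Φ x) := by
  have hrep := X.isRep_rep hθ hmul hstar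
  obtain ⟨Φ, hΦ, t, hb, hti, hΦk⟩ := exists_normalHom isRep_groupUnitary
    (generatedByRep_groupVN (G := GroupHNN H θ hθ)) hrep
    (fun η h1 h2 => X.exists_intertwiner hθ hmul hstar hof ht h1 h2)
  have hΦn : IsNormalMap (groupVN (GroupHNN H θ hθ)) X.P Φ := isNormalMap_krausMap hΦk
  have hΦj : ∀ n, Φ (j n) = X.base n := IsNormalMap.eq_of_group (hΦn.comp hj) X.isNormalMap_base
    (fun g => by rw [hju, hΦ, hof])
  -- Both sides are normal. On the group they agree, because both expectations fix `G` and
  -- annihilate the elements outside of it.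
  have hΦE : ∀ x, Φ (EG x) = X.Expθ (Φ x) :=
    IsNormalMap.eq_of_group (hΦn.comp hEG.normal) (X.condExp_Expθ.normal.comp hΦn) fun γ => by
      rw [hΦ]
      by_cases hγ : γ ∈ (HNNExtension.of : G →* GroupHNN H θ hθ).range
      · obtain ⟨g, rfl⟩ := hγ
        rw [hEG.id_on _ ⟨_, hju g⟩, hΦ, hof, X.Expθ_base]
      · rw [hEG0 γ hγ, map_zero, X.Expθ_rep hθ hmul hstar hof ht γ hγ]
  -- If `Φ x = 0`, then `Φ (EG (x* x)) = 0`. On the range of `EG` the map `Φ` is the injective `π`,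
  -- so `EG (x* x) = 0`.
  have hker : ∀ x, Φ x = 0 → x = 0 := by
    intro x hx
    apply hEG.faithful
    obtain ⟨n, hn⟩ := hEG.mem (star x * x)
    have h1 := hΦE (star x * x)
    have h2 : X.base n = X.base 0 := by
      rw [← hΦj, ← hΦj, map_zero, map_zero]
      refine (congrArg Φ hn).trans ?_
      rw [h1, map_mul, hx, mul_zero, map_zero]
    rw [← hn, X.base_injective h2]
    exact map_zero j
  refine ⟨Φ, fun x y hxy => sub_eq_zero.1 (hker _ (by rw [map_sub, hxy, sub_self])),
    ?_, hΦn, hΦj,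
    by rw [hΦ, ht], hΦE⟩
  have h := range_of_injective isRep_groupUnitary generatedByRep_groupVN groupUnitary_one hrep
    (X.rep_mem hθ hmul hstar hof ht) (X.generatedByRep_rep hθ hmul hstar hof ht)
    X.generatedBy_le_P hΦ hti hΦk hker
  rw [X.rep_one hθ hof] at h
  exact h

end HNNConstruction
end

noncomputable section

set_option linter.unusedSectionVars false

/-! ### Homomorphisms and compressions of two by two matrices. -/

section Blocks

variable {H : Type*} [NormedAddCommGroup H] [InnerProductSpace ℂ H] [CompleteSpace H]
variable {K : Type*} [NormedAddCommGroup K] [InnerProductSpace ℂ K] [CompleteSpace K]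

open ContinuousLinearMap (adjoint)

theorem inner_doubled (x : Doubled H →L[ℂ] Doubled H) (ξ η : Doubled H) :
    ⟪ξ, x η⟫_ℂ = ∑ i, ∑ k, ⟪ξ i, entry x i k (η k)⟫_ℂ := by
  rw [PiLp.inner_apply]
  refine Finset.sum_congr rfl fun i _ => ?_
  rw [apply_eq_sum_entry, inner_sum]

theorem inner_single_left (ξ : H) (i : Fin 2) (η : Doubled H) :
    ⟪(PiLp.single 2 i ξ : Doubled H), η⟫_ℂ = ⟪ξ, η i⟫_ℂ := by
  fin_cases i <;> simp [PiLp.inner_apply]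

theorem diagonal_apply (d : Fin 2 → H →L[ℂ] H) (ξ : Doubled H) (i : Fin 2) :
    ofBlocks (Matrix.diagonal d) ξ i = d i (ξ i) := by
  rw [apply_eq_sum_entry]
  fin_cases i <;> simp

theorem diagonal_single (d : Fin 2 → H →L[ℂ] H) (ξ : H) (i : Fin 2) :
    ofBlocks (Matrix.diagonal d) (PiLp.single 2 i ξ) = PiLp.single 2 i (d i ξ) := by
  ext k
  rw [diagonal_apply]
  fin_cases i <;> fin_cases k <;> simp

theorem matEntry_one {N : VonNeumannAlgebra H} (i k : Fin 2) :
    matEntry (1 : (matVN N).Elem) i k = if i = k then 1 else 0 := by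
  have h := matEntry_algebraMap (N := N) 1 i k
  simpa only [map_one] using h

/-- The element of `M₂(N)` with entries `a i k`. -/
def matFun {N : VonNeumannAlgebra H} (a : Fin 2 → Fin 2 → N.Elem) : (matVN N).Elem :=
  matOf (Matrix.of a)

theorem matEntry_matFun {N : VonNeumannAlgebra H} (a : Fin 2 → Fin 2 → N.Elem) (i k : Fin 2) :
    matEntry (matFun a) i k = a i k := matEntry_matOf (Matrix.of a) i k

/-- The homomorphism `M₂(N) → M₂(Q)`, `[x_{ik}] ↦ [w_i j(x_{ik}) w_k*]`. -/
def matHom {N : VonNeumannAlgebra H} {Q : VonNeumannAlgebra K} (j : N.Elem →⋆ₐ[ℂ] Q.Elem)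
    (w : Fin 2 → Q.Elem) (hw : ∀ i, star (w i) * w i = 1) (hw' : ∀ i, w i * star (w i) = 1) :
    (matVN N).Elem →⋆ₐ[ℂ] (matVN Q).Elem where
  toFun x := matFun fun a b => w a * j (matEntry x a b) * star (w b)
  map_one' := by
    refine matEntry_ext fun a b => ?_
    rw [matEntry_matFun, matEntry_one, matEntry_one]
    split_ifs with h
    · rw [h, map_one, mul_one, hw']
    · rw [map_zero, mul_zero, zero_mul]
  map_mul' x y := by
    refine matEntry_ext fun a b => ?_
    rw [matEntry_matFun, matEntry_mul, matEntry_mul, map_sum, Finset.mul_sum, Finset.sum_mul]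
    refine Finset.sum_congr rfl fun k _ => ?_
    rw [matEntry_matFun, matEntry_matFun, map_mul]
    simp only [mul_assoc]
    rw [← mul_assoc (star (w k)) (w k), hw, one_mul]
  map_zero' := by
    refine matEntry_ext fun a b => ?_
    rw [matEntry_matFun, matEntry_zero, matEntry_zero, map_zero, mul_zero, zero_mul]
  map_add' x y := by
    refine matEntry_ext fun a b => ?_
    rw [matEntry_matFun, matEntry_add, matEntry_add, matEntry_matFun, matEntry_matFun, map_add,
      mul_add, add_mul]
  commutes' c := by
    refine matEntry_ext fun a b => ?_
    rw [matEntry_matFun, matEntry_algebraMap, matEntry_algebraMap]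
    split_ifs with h
    · rw [h, AlgHomClass.commutes, ← Algebra.commutes, mul_assoc, hw', mul_one]
    · rw [map_zero, mul_zero, zero_mul]
  map_star' x := by
    refine matEntry_ext fun a b => ?_
    rw [matEntry_matFun, matEntry_star, matEntry_star, matEntry_matFun, map_star, star_mul, star_mul,
      star_star, mul_assoc]

section MatHom

variable {N : VonNeumannAlgebra H} {Q : VonNeumannAlgebra K} {j : N.Elem →⋆ₐ[ℂ] Q.Elem}
    {w : Fin 2 → Q.Elem} {hw : ∀ i, star (w i) * w i = 1} {hw' : ∀ i, w i * star (w i) = 1}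

theorem matEntry_matHom (x : (matVN N).Elem) (a b : Fin 2) :
    matEntry (matHom j w hw hw' x) a b = w a * j (matEntry x a b) * star (w b) :=
  matEntry_matFun _ a b

theorem matHom_injective (hj : Function.Injective j) : Function.Injective (matHom j w hw hw') := by
  intro x y hxy
  refine matEntry_ext fun a b => hj ?_
  have h := congrArg (fun z => star (w a) * matEntry z a b * w b) hxy
  simp only [matEntry_matHom] at h
  have key : ∀ z : Q.Elem, star (w a) * (w a * z * star (w b)) * w b = z := fun z => by
    simp only [mul_assoc, hw, mul_one]
    rw [← mul_assoc, hw, one_mul]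
  rwa [key, key] at h

/-- The quadratic form at `ξ` is `∑ ⟪w_i* ξ_i, j(x_{ik}) w_k* ξ_k⟫`, so the representing vectors
have the entries `V* w_i* ξ_i`. -/
theorem isNormalMap_matHom {t : Set (H →L[ℂ] K)}
    {ht : ∀ ξ, Summable (fun V : t => ‖adjoint (V : H →L[ℂ] K) ξ‖ ^ 2) ∧
      ∑' V : t, ‖adjoint (V : H →L[ℂ] K) ξ‖ ^ 2 ≤ ‖ξ‖ ^ 2}
    (hk : ∀ x : N.Elem, (j x : K →L[ℂ] K) =
      krausMap (fun V : t => adjoint (V : H →L[ℂ] K)) ht x) :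
    IsNormalMap (matVN N) (matVN Q) (matHom j w hw hw') := by
  obtain ⟨ζ, hζ⟩ : ∃ ζ : Doubled K → t → Doubled H, ∀ ξ V i, ζ ξ V i =
      adjoint (V : H →L[ℂ] K) (adjoint (w i : K →L[ℂ] K) (ξ i)) :=
    ⟨fun ξ V => WithLp.toLp 2 fun i => adjoint (V : H →L[ℂ] K) (adjoint (w i : K →L[ℂ] K) (ξ i)),
      fun _ _ _ => rfl⟩
  refine isNormalMap_of_hasSum ζ (fun ξ => ?_) fun ξ x => ?_
  · simp only [PiLp.norm_sq_eq_of_L2, hζ]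
    exact summable_sum fun i _ => (ht _).1
  · rw [inner_doubled]
    simp only [inner_doubled]
    refine hasSum_sum fun i _ => hasSum_sum fun k _ => ?_
    have h1 : entry (matHom j w hw hw' x : Doubled K →L[ℂ] Doubled K) i k =
        (w i : K →L[ℂ] K) * (j (matEntry x i k) : K →L[ℂ] K) * star (w k : K →L[ℂ] K) :=
      congrArg Subtype.val (matEntry_matHom x i k)
    rw [h1, mul_apply_eq_comp, mul_apply_eq_comp, ← ContinuousLinearMap.adjoint_inner_left, hk]
    refine (inner_krausMap _ _ _).congr_fun fun V => ?_
    rw [hζ, hζ]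
    rfl

end MatHom

section BlockPartition

variable {ι : Type*} {e : ι → Fin 2 → K →L[ℂ] K}

theorem isPartition_diagonal (h : ∀ i, IsPartition fun c => e c i) :
    IsPartition fun c => ofBlocks (Matrix.diagonal (e c)) where
  selfAdjoint c := by
    refine entry_ext fun i k => ?_
    rw [entry_star, entry_ofBlocks, entry_ofBlocks]
    by_cases hik : i = k
    · subst hik
      rw [Matrix.diagonal_apply_eq, (h i).selfAdjoint]
    · rw [Matrix.diagonal_apply_ne _ hik, Matrix.diagonal_apply_ne _ (Ne.symm hik), star_zero]
  hasSum ξ η := by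
    simp only [PiLp.inner_apply, diagonal_apply]
    exact hasSum_sum fun i _ => (h i).hasSum (ξ i) (η i)

theorem inner_entry_cond (h : ∀ i, IsPartition fun c => e c i)
    (x : Doubled K →L[ℂ] Doubled K) (i k : Fin 2) (ξ η : K) :
    HasSum (fun c => ⟪e c i ξ, entry x i k (e c k η)⟫_ℂ)
      ⟪ξ, entry ((isPartition_diagonal h).cond x) i k η⟫_ℂ := by
  have h1 := (isPartition_diagonal h).inner_cond x (PiLp.single 2 i ξ) (PiLp.single 2 k η)
  rw [inner_single_left] at h1
  simp only [diagonal_single, inner_single_left] at h1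
  exact h1

theorem IsPartition.conj {f : ι → K →L[ℂ] K} (hf : IsPartition f) {w : K →L[ℂ] K}
    (hw : star w * w = 1) (hw' : w * star w = 1) : IsPartition fun c => w * f c * star w where
  selfAdjoint c := by
    rw [star_mul, star_mul, star_star, hf.selfAdjoint, mul_assoc]
  hasSum ξ η := by
    have key : ∀ u v, ⟪w u, w v⟫_ℂ = ⟪u, v⟫_ℂ := fun u v => by
      rw [← ContinuousLinearMap.adjoint_inner_right, ← ContinuousLinearMap.star_eq_adjoint,
        ← mul_apply_eq_comp, hw]
      rfl
    have h := hf.hasSum (star w ξ) (star w η)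
    have h2 : ⟪star w ξ, star w η⟫_ℂ = ⟪ξ, η⟫_ℂ := by
      rw [← key, ← mul_apply_eq_comp, ← mul_apply_eq_comp, hw']
      rfl
    rw [h2] at h
    exact h.congr_fun fun c => key _ _

/-- The added index names the one slot in which the diagonal operator acts, so the resulting
compression also erases off-diagonal entries. -/
theorem IsPartition.split {f : ι → K →L[ℂ] K} (hf : IsPartition f) (i : Fin 2) :
    IsPartition fun c : ι × Fin 2 => if c.2 = i then f c.1 else 0 where
  selfAdjoint c := by
    split_ifs
    · exact hf.selfAdjoint _
    · exact star_zero _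
  hasSum ξ η := by
    have hinj : Function.Injective fun c : ι => (c, i) := fun a b h => (Prod.ext_iff.1 h).1
    rw [← hinj.hasSum_iff]
    · exact (hf.hasSum ξ η).congr_fun fun c => by simp
    · rintro ⟨c, k⟩ hc
      have : k ≠ i := fun h => hc ⟨c, by rw [h]⟩
      simp [this]

theorem entry_cond_split {f : ι → K →L[ℂ] K} (hf : IsPartition f)
    (x : Doubled K →L[ℂ] Doubled K) (i k : Fin 2) :
    entry ((isPartition_diagonal fun i => hf.split i).cond x) i k =
      if i = k then hf.cond (entry x i k) else 0 := by
  refine ContinuousLinearMap.ext fun η => ext_inner_left ℂ fun ξ => ?_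
  refine (inner_entry_cond (fun i => hf.split i) x i k ξ η).unique ?_
  split_ifs with h
  · subst h
    have hinj : Function.Injective fun c : ι => (c, i) := fun a b h => (Prod.ext_iff.1 h).1
    rw [← hinj.hasSum_iff]
    · exact (hf.inner_cond (entry x i i) ξ η).congr_fun fun c => by simp
    · rintro ⟨c, k⟩ hc
      have : k ≠ i := fun h => hc ⟨c, by rw [h]⟩
      simp [this]
  · have h0 : ∀ c : ι × Fin 2, ⟪(if c.2 = i then f c.1 else 0) ξ,
        entry x i k ((if c.2 = k then f c.1 else 0) η)⟫_ℂ = 0 := by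
      intro c
      by_cases h1 : c.2 = i
      · have h2 : c.2 ≠ k := fun h2 => h (h1.symm.trans h2)
        simp [h2]
      · simp [h1]
    simp only [h0]
    simp

theorem entry_cond_conj {f : ι → K →L[ℂ] K} (hf : IsPartition f) {w : Fin 2 → K →L[ℂ] K}
    (hw : ∀ i, star (w i) * w i = 1) (hw' : ∀ i, w i * star (w i) = 1)
    (x : Doubled K →L[ℂ] Doubled K) (i k : Fin 2) :
    entry ((isPartition_diagonal fun i => hf.conj (hw i) (hw' i)).cond x) i k =
      w i * hf.cond (star (w i) * entry x i k * w k) * star (w k) := by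
  refine ContinuousLinearMap.ext fun η => ext_inner_left ℂ fun ξ => ?_
  refine (inner_entry_cond (fun i => hf.conj (hw i) (hw' i)) x i k ξ η).unique ?_
  have h := hf.inner_cond (star (w i) * entry x i k * w k) (star (w i) ξ) (star (w k) η)
  rw [ContinuousLinearMap.star_eq_adjoint (w i), ContinuousLinearMap.adjoint_inner_left] at h
  refine h.congr_fun fun c => ?_
  simp only [mul_apply_eq_comp, ContinuousLinearMap.adjoint_inner_right]
  rfl

end BlockPartition

end Blocks
end

noncomputable section

set_option linter.unusedSectionVars false

/-! ### Groups carrying two free copies of a matrix configuration. -/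

section FreeConfiguration

variable {G : Type u} [Group G] {H : Subgroup G}

/-- Two copies `f b` of `G` in a group, each with a pair of elements `p b`, such that the conjugates
of `G` under these are free with amalgamation over the image of `H`, which is embedded in `G`
by `ι b i`. -/
structure FreeConfiguration (ι : Bool → Fin 2 → H →* G) (Γ : Type u) [Group Γ] where
  f : Bool → G →* Γ
  p : Bool → Fin 2 → Γ
  base : H →* Γ
  letters : Bool → Set Γ
  f_injective : ∀ b, Function.Injective (f b)
  base_injective : Function.Injective base
  conj_eq : ∀ b i h, p b i * f b (ι b i h) * (p b i)⁻¹ = base h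
  mem_of_ne : ∀ b i k g, i ≠ k → p b i * f b g * (p b k)⁻¹ ∈ letters b
  mem_of_notMem : ∀ b i g, p b i * f b g * (p b i)⁻¹ ∉ base.range →
    p b i * f b g * (p b i)⁻¹ ∈ letters b
  free : ∀ l : List (Bool × Γ), l ≠ [] → l.IsChain (fun x y => x.1 ≠ y.1) →
    (∀ x ∈ l, x.2 ∈ letters x.1) → (l.map Prod.snd).prod ∉ base.range

/-- The number of stable letters in an element of an HNN extension. -/
def hnnDegree {A B : Subgroup G} (φ : A ≃* B) : HNNExtension G A B φ →* Multiplicative ℤ :=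
  HNNExtension.lift 1 (Multiplicative.ofAdd 1) fun a => by simp

theorem hnnDegree_of {A B : Subgroup G} (φ : A ≃* B) (g : G) :
    hnnDegree φ (HNNExtension.of g) = 1 := HNNExtension.lift_of _ _ _ g

theorem hnnDegree_t {A B : Subgroup G} (φ : A ≃* B) :
    hnnDegree φ HNNExtension.t = Multiplicative.ofAdd 1 := HNNExtension.lift_t _ _ _

/-- Words in an amalgamated product of groups with letters outside of the amalgam. -/
theorem pushout_free {ι : Type*} {F : ι → Type*} [∀ i, Group (F i)] {A : Type*} [Group A]
    {φ : ∀ i, A →* F i} (hφ : ∀ i, Function.Injective (φ i)) {l : List (Σ i, F i)} (hl : l ≠ [])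
    (hc : l.IsChain fun x y => x.1 ≠ y.1) (h : ∀ x ∈ l, x.2 ∉ (φ x.1).range) :
    (l.map fun x => (Monoid.PushoutI.of x.1 x.2 : Monoid.PushoutI φ)).prod ∉
      (Monoid.PushoutI.base φ).range := by
  intro hmem
  let w : Monoid.CoprodI.Word F :=
    { toList := l
      ne_one := fun x hx h1 => h x hx (h1 ▸ one_mem _)
      chain_ne := hc }
  have hw : Monoid.PushoutI.Reduced φ w := h
  have h1 : Monoid.PushoutI.ofCoprodI w.prod =
      (l.map fun x => (Monoid.PushoutI.of x.1 x.2 : Monoid.PushoutI φ)).prod := by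
    rw [Monoid.CoprodI.Word.prod, map_list_prod, List.map_map]
    exact congrArg List.prod <| List.map_congr_left fun x _ => Monoid.PushoutI.ofCoprodI_of x.1 x.2
  have h2 := hw.eq_empty_of_mem_range hφ (h1 ▸ hmem)
  exact hl (congrArg Monoid.CoprodI.Word.toList h2)

section Amalgam

variable {θ : Bool → H →* G} {F : Bool → Type u} [∀ b, Group (F b)] {φ : ∀ b, H →* F b}

theorem amalgam_free (hφ : ∀ b, Function.Injective (φ b)) {l : List (Bool × Monoid.PushoutI φ)}
    (hl : l ≠ []) (hc : l.IsChain fun x y => x.1 ≠ y.1)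
    (hmem : ∀ x ∈ l, ∃ y, y ∉ (φ x.1).range ∧ x.2 = Monoid.PushoutI.of x.1 y) :
    (l.map Prod.snd).prod ∉ (Monoid.PushoutI.base φ).range := by
  have key : ∀ l : List (Bool × Monoid.PushoutI φ),
      (∀ x ∈ l, ∃ y, y ∉ (φ x.1).range ∧ x.2 = Monoid.PushoutI.of x.1 y) →
      ∃ l' : List (Σ b, F b), l'.map Sigma.fst = l.map Prod.fst ∧
        (∀ x ∈ l', x.2 ∉ (φ x.1).range) ∧
        l'.map (fun x => (Monoid.PushoutI.of x.1 x.2 : Monoid.PushoutI φ)) = l.map Prod.snd := by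
    intro l
    induction l with
    | nil => exact fun _ => ⟨[], rfl, by simp, rfl⟩
    | cons x l ih =>
      intro h
      obtain ⟨l', h1, h2, h3⟩ := ih fun z hz => h z (List.mem_cons_of_mem _ hz)
      obtain ⟨y, hy, hy'⟩ := h x List.mem_cons_self
      refine ⟨⟨x.1, y⟩ :: l', by simp [h1], ?_, by simp [h3, hy']⟩
      intro z hz
      rcases List.mem_cons.1 hz with rfl | hz
      · exact hy
      · exact h2 z hz
  obtain ⟨l', h1, h2, h3⟩ := key l hmem
  rw [← h3]
  refine pushout_free hφ ?_ ?_ h2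
  · rintro rfl
    exact hl (List.map_eq_nil_iff.1 h1.symm)
  · have h4 : (l.map Prod.fst).IsChain (· ≠ ·) := (List.isChain_map _).2 hc
    rw [← h1] at h4
    exact (List.isChain_map _).1 h4

/-- The configuration in an amalgamated product of two groups with stable letters. -/
def amalgamConfiguration (hφ : ∀ b, Function.Injective (φ b)) (f : ∀ b, G →* F b)
    (hf : ∀ b, Function.Injective (f b)) (hfφ : ∀ b (h : H), f b (h : G) = φ b h) (t : ∀ b, F b)
    (ht : ∀ b h, t b * f b (θ b h) * (t b)⁻¹ = φ b h)
    (hft : ∀ b g, f b g * (t b)⁻¹ ∉ (φ b).range) (htf : ∀ b g, t b * f b g ∉ (φ b).range) :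
    FreeConfiguration (fun b => ![H.subtype, θ b]) (Monoid.PushoutI φ) where
  f b := (Monoid.PushoutI.of b).comp (f b)
  p b := ![1, Monoid.PushoutI.of b (t b)]
  base := Monoid.PushoutI.base φ
  letters b := {x | ∃ y, y ∉ (φ b).range ∧ x = Monoid.PushoutI.of b y}
  f_injective b := (Monoid.PushoutI.of_injective hφ b).comp (hf b)
  base_injective := Monoid.PushoutI.base_injective hφ
  conj_eq b i h := by
    rw [← Monoid.PushoutI.of_apply_eq_base φ b]
    fin_cases i
    · simp [hfφ]
    · simp [← ht]
  mem_of_ne b i k g hik := by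
    fin_cases i <;> fin_cases k
    · exact absurd rfl hik
    · exact ⟨_, hft b g, by simp⟩
    · exact ⟨_, htf b g, by simp⟩
    · exact absurd rfl hik
  mem_of_notMem b i g hg := by
    obtain ⟨y, hy⟩ : ∃ y, ![1, Monoid.PushoutI.of b (t b)] i *
        ((Monoid.PushoutI.of b).comp (f b)) g * (![1, Monoid.PushoutI.of b (t b)] i)⁻¹ =
          (Monoid.PushoutI.of b y : Monoid.PushoutI φ) := by
      fin_cases i
      · exact ⟨f b g, by simp⟩
      · exact ⟨t b * f b g * (t b)⁻¹, by simp⟩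
    rw [hy] at hg ⊢
    refine ⟨y, ?_, rfl⟩
    rintro ⟨h, rfl⟩
    exact hg ⟨h, (Monoid.PushoutI.of_apply_eq_base φ b h).symm⟩
  free l hl hc hmem := amalgam_free hφ hl hc hmem

end Amalgam

/-- Two HNN extensions are amalgamated over `H`. Conjugation by the stable letter turns `θ b` into
the inclusion, so both slots share one copy of `H`. The exponent sum of the stable letter keeps `t
g` and `g t⁻¹` out of `H`. -/
theorem exists_freeConfiguration {θ : Bool → H →* G} (hθ : ∀ b, Function.Injective (θ b)) :
    ∃ (Γ : Type u) (_ : Group Γ), Nonempty (FreeConfiguration (fun b => ![H.subtype, θ b]) Γ) := by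
  let φ : ∀ b, H →* GroupHNN H (θ b) (hθ b) := fun b => HNNExtension.of.comp H.subtype
  have hnot : ∀ b (y : GroupHNN H (θ b) (hθ b)), hnnDegree _ y ≠ 1 → y ∉ (φ b).range := by
    rintro b _ hy ⟨h, rfl⟩
    exact hy (hnnDegree_of _ _)
  refine ⟨Monoid.PushoutI φ, inferInstance, ⟨amalgamConfiguration
    (fun b => (HNNExtension.of_injective _).comp H.subtype_injective)
    (fun b => HNNExtension.of) (fun b => HNNExtension.of_injective _) (fun b h => rfl)
    (fun b => HNNExtension.t) (fun b h => ?_) (fun b g => hnot b _ ?_) (fun b g => hnot b _ ?_)⟩⟩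
  · have h1 := HNNExtension.equiv_eq_conj (φ := (MonoidHom.ofInjective (hθ b)).symm)
      ⟨θ b h, h, rfl⟩
    have e : (MonoidHom.ofInjective (hθ b)).symm ⟨θ b h, h, rfl⟩ = h :=
      (MonoidHom.ofInjective (hθ b)).symm_apply_apply h
    rw [e] at h1
    exact h1.symm
  · rw [map_mul, map_inv, hnnDegree_of, hnnDegree_t]
    decide
  · rw [map_mul, hnnDegree_of, hnnDegree_t]
    decide

end FreeConfiguration

/-! ### Supports of Fourier coefficients. -/

section FourierSupport

variable {Γ : Type*} [Group Γ]

/-- The Fourier coefficients of an operator vanish outside of a set. -/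
def SuppIn (T : ellTwo Γ →L[ℂ] ellTwo Γ) (S : Set Γ) : Prop :=
  ∀ k l, l * k⁻¹ ∉ S → T (delta k) l = 0

theorem SuppIn.mono {T : ellTwo Γ →L[ℂ] ellTwo Γ} {S S' : Set Γ} (hT : SuppIn T S) (h : S ⊆ S') :
    SuppIn T S' := fun k l hkl => hT k l fun h' => hkl (h h')

theorem SuppIn.add {T T' : ellTwo Γ →L[ℂ] ellTwo Γ} {S : Set Γ} (hT : SuppIn T S)
    (hT' : SuppIn T' S) : SuppIn (T + T') S := fun k l hkl => by
  have h1 := hT k l hkl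
  have h2 := hT' k l hkl
  rw [add_apply, lp.coeFn_add, Pi.add_apply, h1, h2, add_zero]

/-- As `l k⁻¹ = (l m⁻¹) (m k⁻¹)`, every term of the sum over `m` for the coefficient at `(k, l)` has
a vanishing factor. -/
theorem SuppIn.mul {T T' : ellTwo Γ →L[ℂ] ellTwo Γ} {S S' : Set Γ} (hT : SuppIn T S)
    (hT' : SuppIn T' S') : SuppIn (T * T') {γ | ∃ a ∈ S, ∃ b ∈ S', γ = a * b} := by
  intro k l hkl
  rw [← inner_delta_left, mul_apply_eq_comp, ← ContinuousLinearMap.adjoint_inner_left]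
  refine (lp.hasSum_inner (𝕜 := ℂ) _ _).unique ?_
  have h0 : ∀ m, ⟪ContinuousLinearMap.adjoint T (delta l) m, T' (delta k) m⟫_ℂ = 0 := by
    intro m
    by_cases h1 : m * k⁻¹ ∈ S'
    · have h2 : l * m⁻¹ ∉ S := fun h2 => hkl ⟨_, h2, _, h1, by group⟩
      have h3 : ContinuousLinearMap.adjoint T (delta l) m = 0 := by
        rw [← inner_delta_left, ContinuousLinearMap.adjoint_inner_right, ← inner_conj_symm,
          inner_delta_left, hT m l h2, map_zero]
      rw [h3, inner_zero_left]
    · rw [hT' k m h1, inner_zero_right]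
  simp only [h0]
  exact hasSum_zero

theorem suppIn_zero (S : Set Γ) : SuppIn (0 : ellTwo Γ →L[ℂ] ellTwo Γ) S := fun _ _ _ => rfl

theorem suppIn_one : SuppIn (1 : ellTwo Γ →L[ℂ] ellTwo Γ) {1} := by
  classical
  intro k l hkl
  change delta k l = 0
  rw [delta_apply, if_neg]
  rintro rfl
  exact hkl (mul_inv_cancel l)

theorem groupExp_eq_zero {C : Subgroup Γ} {x : (groupVN Γ).Elem} {S : Set Γ}
    (hx : SuppIn (x : ellTwo Γ →L[ℂ] ellTwo Γ) S) (hS : ∀ γ ∈ S, γ ∉ C) : groupExp C x = 0 := by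
  classical
  refine Subtype.ext (ext_coeff fun k l => ?_)
  rw [groupExp_coeff]
  split_ifs with h
  · exact hx k l fun h' => hS _ h' h
  · rfl

/-- The coefficients of a two-sided translate. -/
theorem translate_coeff (T : ellTwo Γ →L[ℂ] ellTwo Γ) (p q k l : Γ) :
    (leftReg p * T * star (leftReg q)) (delta k) l = T (delta (q⁻¹ * k)) (p⁻¹ * l) := by
  rw [← leftReg_inv, mul_apply_eq_comp, mul_apply_eq_comp, leftReg_delta, leftReg_apply]

end FourierSupport
end

noncomputable section

set_option linter.unusedSectionVars false

/-! ### Embeddings of the algebras of `G` and `H` into `L(Γ)`. -/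

section OperatorModels

open ContinuousLinearMap (adjoint)

theorem isNormalMap_conj {K : Type*} [NormedAddCommGroup K] [InnerProductSpace ℂ K]
    [CompleteSpace K] {Q : VonNeumannAlgebra K} (w : Q.Elem) :
    IsNormalMap Q Q fun x => w * x * star w :=
  isNormalMap_of_hasSum (ι := Unit) (fun ξ _ => adjoint (w : K →L[ℂ] K) ξ)
    (fun _ => Summable.of_finite) fun ξ x => by
      have h : ⟪ξ, ((w * x * star w : Q.Elem) : K →L[ℂ] K) ξ⟫_ℂ =
          ⟪adjoint (w : K →L[ℂ] K) ξ, (x : K →L[ℂ] K) (adjoint (w : K →L[ℂ] K) ξ)⟫_ℂ := by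
        rw [ContinuousLinearMap.adjoint_inner_left]
        rfl
      rw [h]
      exact hasSum_unique _

theorem diagonal_mul_comm {K : Type*} [NormedAddCommGroup K] [InnerProductSpace ℂ K]
    [CompleteSpace K] {d : Fin 2 → K →L[ℂ] K} {x : Doubled K →L[ℂ] Doubled K}
    (h : ∀ i k, d i * entry x i k = entry x i k * d k) :
    ofBlocks (Matrix.diagonal d) * x = x * ofBlocks (Matrix.diagonal d) := by
  refine entry_ext fun i k => ?_
  have := h i k
  rw [entry_mul, entry_mul]
  fin_cases i <;> fin_cases k <;> simpa using this

variable {G : Type u} [Group G] {H : Subgroup G} {ι : Bool → Fin 2 → H →* G}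
  {Γ : Type u} [Group Γ]

/-- The embeddings of the von Neumann algebras of `G` and `H` induced by a configuration. -/
structure OperatorModel (c : FreeConfiguration ι Γ) where
  J : Bool → (groupVN G).Elem →⋆ₐ[ℂ] (groupVN Γ).Elem
  JC : (subgroupVN H).Elem →⋆ₐ[ℂ] (groupVN Γ).Elem
  J_injective : ∀ b, Function.Injective (J b)
  J_range : ∀ b, (J b).range = (VonNeumannAlgebra.incl (subgroupVN_le (c.f b).range)).range
  J_unitary : ∀ b g, J b (groupUnitary g) = groupUnitary (c.f b g)
  J_kraus : ∀ b, ∃ (t : Set (ellTwo G →L[ℂ] ellTwo Γ))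
        (ht : ∀ ξ, Summable (fun V : t => ‖adjoint (V : ellTwo G →L[ℂ] ellTwo Γ) ξ‖ ^ 2) ∧
          ∑' V : t, ‖adjoint (V : ellTwo G →L[ℂ] ellTwo Γ) ξ‖ ^ 2 ≤ ‖ξ‖ ^ 2),
        ∀ x : (groupVN G).Elem, (J b x : ellTwo Γ →L[ℂ] ellTwo Γ) =
          krausMap (fun V : t => adjoint (V : ellTwo G →L[ℂ] ellTwo Γ)) ht x
  JC_range : JC.range = (VonNeumannAlgebra.incl (subgroupVN_le c.base.range)).range
  JC_unitary : ∀ h, JC (subgroupUnitary h) = groupUnitary (c.base h)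
  JC_normal : IsNormalMap (subgroupVN H) (groupVN Γ) JC

theorem generatedByRep_range {A : Type*} [Group A] (f : A →* Γ) :
    GeneratedByRep (subgroupVN f.range) fun a => leftReg (f a) :=
  generatedByRep_generatedBy (isRep_leftReg f) (by
    rintro _ ⟨_, ⟨a, rfl⟩, rfl⟩
    exact ⟨a, rfl⟩)

theorem nonempty_operatorModel (c : FreeConfiguration ι Γ) : Nonempty (OperatorModel c) := by
  have hJ := fun b => exists_groupHom (MonoidHom.id G) Function.injective_id (c.f b)
    (c.f_injective b) (subgroupVN_le (c.f b).range) groupUnitary (fun _ => rfl)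
    generatedByRep_groupVN (fun g => subgroupUnitary ⟨c.f b g, g, rfl⟩) (fun _ => rfl)
    (generatedByRep_range (c.f b))
  choose J h1 h2 h3 h4 using hJ
  obtain ⟨JC, -, k2, k3, t, ht, k4⟩ := exists_groupHom H.subtype H.subtype_injective c.base
    c.base_injective (subgroupVN_le c.base.range) subgroupUnitary (fun _ => rfl)
    (generatedByRep_subgroupVN H) (fun h => subgroupUnitary ⟨c.base h, h, rfl⟩) (fun _ => rfl)
    (generatedByRep_range c.base)
  exact ⟨⟨J, JC, h1, h2, fun b g => Subtype.ext (h3 b g), h4, k2, fun h => Subtype.ext (k3 h),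
    isNormalMap_krausMap k4⟩⟩

theorem star_mul_groupUnitary (g : Γ) : star (groupUnitary g) * groupUnitary g = 1 := by
  rw [← groupUnitary_inv, ← groupUnitary_mul, inv_mul_cancel, groupUnitary_one]

theorem groupUnitary_mul_star (g : Γ) : groupUnitary g * star (groupUnitary g) = 1 := by
  rw [← groupUnitary_inv, ← groupUnitary_mul, mul_inv_cancel, groupUnitary_one]

namespace OperatorModel

variable {c : FreeConfiguration ι Γ} (m : OperatorModel c)

theorem J_normal (b : Bool) : IsNormalMap (groupVN G) (groupVN Γ) (m.J b) := by
  obtain ⟨t, ht, h⟩ := m.J_kraus b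
  exact isNormalMap_krausMap h

/-- The conjugate of `J b` by the group element `p b i`. -/
def conjJ (b : Bool) (i k : Fin 2) (x : (groupVN G).Elem) : (groupVN Γ).Elem :=
  groupUnitary (c.p b i) * m.J b x * star (groupUnitary (c.p b k))

theorem conjJ_normal (b : Bool) (i : Fin 2) :
    IsNormalMap (groupVN G) (groupVN Γ) (m.conjJ b i i) :=
  (isNormalMap_conj _).comp (m.J_normal b)

theorem conjJ_unitary (b : Bool) (i k : Fin 2) (g : G) : m.conjJ b i k (groupUnitary g) =
    groupUnitary (c.p b i * c.f b g * (c.p b k)⁻¹) := by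
  rw [conjJ, m.J_unitary, ← groupUnitary_inv, ← groupUnitary_mul, ← groupUnitary_mul]

/-- By normality this reduces to `c.conj_eq` on group elements. It makes both slots of both copies
agree on the amalgam. -/
theorem conjJ_eq {Θ : (subgroupVN H).Elem →⋆ₐ[ℂ] (groupVN G).Elem} {b : Bool} {i : Fin 2}
    (hn : IsNormalMap (subgroupVN H) (groupVN G) Θ)
    (hΘ : ∀ h : H, Θ (subgroupUnitary h) = groupUnitary (ι b i h)) (d : (subgroupVN H).Elem) :
    m.conjJ b i i (Θ d) = m.JC d :=
  IsNormalMap.eq_of_subgroup ((m.conjJ_normal b i).comp hn) m.JC_normal (fun h => by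
    rw [Function.comp_apply, hΘ, m.conjJ_unitary, m.JC_unitary, c.conj_eq]) d

theorem conj_mem_iff (c : FreeConfiguration ι Γ) (b : Bool) (i : Fin 2) (g : G) :
    c.p b i * c.f b g * (c.p b i)⁻¹ ∈ c.base.range ↔ g ∈ (ι b i).range := by
  constructor
  · rintro ⟨h, hh⟩
    rw [← c.conj_eq b i h] at hh
    exact ⟨h, c.f_injective b (mul_left_cancel (mul_right_cancel hh))⟩
  · rintro ⟨h, rfl⟩
    exact ⟨h, (c.conj_eq b i h).symm⟩

/-- Both sides are normal, and the conjugate of a group element lies in the amalgam exactly when the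
element lies in the image of `H` under `ι b i`. -/
theorem groupExp_conjJ (b : Bool) (i : Fin 2) (x : (groupVN G).Elem) :
    groupExp c.base.range (m.conjJ b i i x) = m.conjJ b i i (groupExp (ι b i).range x) := by
  refine IsNormalMap.eq_of_group ((isNormalMap_groupExp _).comp (m.conjJ_normal b i))
    ((m.conjJ_normal b i).comp (isNormalMap_groupExp _)) (fun g => ?_) x
  rw [Function.comp_apply, Function.comp_apply, m.conjJ_unitary]
  by_cases hg : g ∈ (ι b i).range
  · rw [groupExp_unitary_of_mem ((conj_mem_iff c b i g).2 hg), groupExp_unitary_of_mem hg,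
      m.conjJ_unitary]
  · rw [groupExp_unitary_of_notMem (fun h => hg ((conj_mem_iff c b i g).1 h)),
      groupExp_unitary_of_notMem hg, conjJ, map_zero, mul_zero, zero_mul]

theorem J_mem (b : Bool) (x : (groupVN G).Elem) :
    (m.J b x : ellTwo Γ →L[ℂ] ellTwo Γ) ∈ subgroupVN (c.f b).range := by
  have h : m.J b x ∈ (m.J b).range := ⟨x, rfl⟩
  rw [m.J_range] at h
  obtain ⟨y, hy⟩ := h
  exact hy ▸ y.2

theorem exists_J (b : Bool) {y : (groupVN Γ).Elem}
    (hy : (y : ellTwo Γ →L[ℂ] ellTwo Γ) ∈ subgroupVN (c.f b).range) : ∃ x, m.J b x = y := by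
  have h : y ∈ (VonNeumannAlgebra.incl (subgroupVN_le (c.f b).range)).range := ⟨⟨y, hy⟩, rfl⟩
  rw [← m.J_range] at h
  exact h

theorem JC_mem (x : (subgroupVN H).Elem) :
    (m.JC x : ellTwo Γ →L[ℂ] ellTwo Γ) ∈ subgroupVN c.base.range := by
  have h : m.JC x ∈ m.JC.range := ⟨x, rfl⟩
  rw [m.JC_range] at h
  obtain ⟨y, hy⟩ := h
  exact hy ▸ y.2

theorem exists_JC {y : (groupVN Γ).Elem}
    (hy : (y : ellTwo Γ →L[ℂ] ellTwo Γ) ∈ subgroupVN c.base.range) : ∃ x, m.JC x = y := by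
  have h : y ∈ (VonNeumannAlgebra.incl (subgroupVN_le c.base.range)).range := ⟨⟨y, hy⟩, rfl⟩
  rw [← m.JC_range] at h
  exact h

theorem suppIn_J (b : Bool) (x : (groupVN G).Elem) :
    SuppIn (m.J b x : ellTwo Γ →L[ℂ] ellTwo Γ) (c.f b).range := by
  classical
  intro k l hkl
  have h : groupExp (c.f b).range (m.J b x) = m.J b x :=
    (isCanonicalCondExp_groupExp (c.f b).range).1.id_on _ ⟨⟨_, m.J_mem b x⟩, rfl⟩
  rw [← h, groupExp_coeff]
  exact if_neg hkl

theorem suppIn_conjJ (b : Bool) (i k : Fin 2) (x : (groupVN G).Elem) :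
    SuppIn (m.conjJ b i k x : ellTwo Γ →L[ℂ] ellTwo Γ)
      {γ | ∃ g, γ = c.p b i * c.f b g * (c.p b k)⁻¹} := by
  intro k' l hkl
  refine (translate_coeff (m.J b x : ellTwo Γ →L[ℂ] ellTwo Γ) (c.p b i) (c.p b k) k' l).trans ?_
  refine m.suppIn_J b x _ _ fun h => hkl ?_
  obtain ⟨g, hg⟩ := h
  exact ⟨g, by rw [hg]; group⟩

/-- The entries of a centred matrix are supported in the letters. -/
theorem suppIn_letters (b : Bool) (i k : Fin 2) (x : (groupVN G).Elem)
    (hx : i = k → groupExp (ι b i).range x = 0) :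
    SuppIn (m.conjJ b i k x : ellTwo Γ →L[ℂ] ellTwo Γ) (c.letters b) := by
  classical
  by_cases hik : i = k
  · subst hik
    intro k' l hkl
    by_cases h : l * k'⁻¹ ∈ {γ | ∃ g, γ = c.p b i * c.f b g * (c.p b i)⁻¹}
    · obtain ⟨g, hg⟩ := h
      have h1 : l * k'⁻¹ ∈ c.base.range := by
        by_contra h2
        rw [hg] at h2 hkl
        exact hkl (c.mem_of_notMem b i g h2)
      -- At an element of the amalgam the coefficient is that of the expectation, which vanishes
      -- because `x` is centred.
      have h3 := m.groupExp_conjJ b i x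
      rw [hx rfl] at h3
      have h4 := groupExp_coeff c.base.range (m.conjJ b i i x) k' l
      rw [if_pos h1, h3] at h4
      rw [← h4, conjJ, map_zero, mul_zero, zero_mul]
      rfl
    · exact m.suppIn_conjJ b i i x k' l h
  · refine (m.suppIn_conjJ b i k x).mono ?_
    rintro _ ⟨g, rfl⟩
    exact c.mem_of_ne b i k g hik

end OperatorModel
end OperatorModels
end

noncomputable section

set_option linter.unusedSectionVars false

/-! ### The free product realized in `M₂(L(Γ))`, with its expectations. -/

namespace OperatorModel

open ContinuousLinearMap (adjoint)

variable {G : Type u} [Group G] {H : Subgroup G} {ι : Bool → Fin 2 → H →* G}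
  {Γ : Type u} [Group Γ] {c : FreeConfiguration ι Γ} (m : OperatorModel c)

/-- The embedding `[x_{ik}] ↦ [p_i J(x_{ik}) p_k*]` of `M₂(L(G))` into `M₂(L(Γ))`. -/
def hom (b : Bool) : (matVN (groupVN G)).Elem →⋆ₐ[ℂ] (matVN (groupVN Γ)).Elem :=
  matHom (m.J b) (fun i => groupUnitary (c.p b i)) (fun _ => star_mul_groupUnitary _)
    (fun _ => groupUnitary_mul_star _)

theorem matEntry_hom (b : Bool) (x : (matVN (groupVN G)).Elem) (i k : Fin 2) :
    matEntry (m.hom b x) i k = m.conjJ b i k (matEntry x i k) := matEntry_matHom x i k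

/-- The von Neumann algebra generated by the two copies of `M₂(L(G))`. -/
def alg : VonNeumannAlgebra (Doubled (ellTwo Γ)) := VonNeumannAlgebra.generatedBy
  (Set.range (fun x => (m.hom true x : Doubled (ellTwo Γ) →L[ℂ] Doubled (ellTwo Γ))) ∪
    Set.range (fun x => (m.hom false x : Doubled (ellTwo Γ) →L[ℂ] Doubled (ellTwo Γ))))

theorem alg_le : m.alg ≤ matVN (groupVN Γ) := by
  refine VonNeumannAlgebra.generatedBy_le ?_
  rintro _ (⟨x, rfl⟩ | ⟨x, rfl⟩)
  · exact (m.hom true x).2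
  · exact (m.hom false x).2

theorem hom_mem (b : Bool) (x : (matVN (groupVN G)).Elem) :
    (m.hom b x : Doubled (ellTwo Γ) →L[ℂ] Doubled (ellTwo Γ)) ∈ m.alg := by
  cases b
  · exact VonNeumannAlgebra.subset_generatedBy _ (Or.inr ⟨x, rfl⟩)
  · exact VonNeumannAlgebra.subset_generatedBy _ (Or.inl ⟨x, rfl⟩)

/-- The embedding of a copy of `M₂(L(G))`. -/
def lam (b : Bool) : (matVN (groupVN G)).Elem →⋆ₐ[ℂ] m.alg.Elem :=
  ((matVN (groupVN Γ)).toStarSubalgebra.subtype.comp (m.hom b)).codRestrict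
    m.alg.toStarSubalgebra (m.hom_mem b)

/-- The entries of an element of the algebra. -/
def coeff (x : m.alg.Elem) (i k : Fin 2) : (groupVN Γ).Elem :=
  matEntry (VonNeumannAlgebra.incl m.alg_le x) i k

theorem coeff_ext {x y : m.alg.Elem} (h : ∀ i k, m.coeff x i k = m.coeff y i k) : x = y := by
  have h1 : VonNeumannAlgebra.incl m.alg_le x = VonNeumannAlgebra.incl m.alg_le y :=
    matEntry_ext h
  exact Subtype.ext (congrArg (fun z : (matVN (groupVN Γ)).Elem =>
    (z : Doubled (ellTwo Γ) →L[ℂ] Doubled (ellTwo Γ))) h1)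

theorem coeff_lam (b : Bool) (x : (matVN (groupVN G)).Elem) (i k : Fin 2) :
    m.coeff (m.lam b x) i k = m.conjJ b i k (matEntry x i k) := m.matEntry_hom b x i k

theorem coeff_mul (x y : m.alg.Elem) (i k : Fin 2) :
    m.coeff (x * y) i k = ∑ l, m.coeff x i l * m.coeff y l k := by
  rw [coeff, map_mul, matEntry_mul]
  rfl

theorem coeff_one (i k : Fin 2) : m.coeff 1 i k = if i = k then 1 else 0 := by
  rw [coeff, map_one, matEntry_one]

theorem coe_coeff (x : m.alg.Elem) (i k : Fin 2) :
    (m.coeff x i k : ellTwo Γ →L[ℂ] ellTwo Γ) =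
      entry (x : Doubled (ellTwo Γ) →L[ℂ] Doubled (ellTwo Γ)) i k := rfl

theorem lam_injective (b : Bool) : Function.Injective (m.lam b) := by
  intro x y h
  refine matHom_injective (m.J_injective b) (hw := fun _ => star_mul_groupUnitary _)
    (hw' := fun _ => groupUnitary_mul_star _) (w := fun i => groupUnitary (c.p b i)) ?_
  exact Subtype.ext (congrArg (fun z : m.alg.Elem =>
    (z : Doubled (ellTwo Γ) →L[ℂ] Doubled (ellTwo Γ))) h)

theorem lam_normal (b : Bool) : IsNormalMap (matVN (groupVN G)) m.alg (m.lam b) := by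
  obtain ⟨t, ht, hk⟩ := m.J_kraus b
  exact isNormalMap_matHom (hw := fun _ => star_mul_groupUnitary _)
    (hw' := fun _ => groupUnitary_mul_star _) (w := fun i => groupUnitary (c.p b i)) hk

theorem alg_eq : m.alg = VonNeumannAlgebra.generatedBy
    (Set.range (fun x => (m.lam true x : Doubled (ellTwo Γ) →L[ℂ] Doubled (ellTwo Γ))) ∪
      Set.range (fun x => (m.lam false x : Doubled (ellTwo Γ) →L[ℂ] Doubled (ellTwo Γ)))) := rfl

section Amalgam

variable {Θ₀ Θ₁ : (subgroupVN H).Elem →⋆ₐ[ℂ] (groupVN G).Elem}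

theorem coeff_lam_diagHom {b : Bool}
    (hn₀ : IsNormalMap (subgroupVN H) (groupVN G) Θ₀)
    (hΘ₀ : ∀ h : H, Θ₀ (subgroupUnitary h) = groupUnitary (ι b 0 h))
    (hn₁ : IsNormalMap (subgroupVN H) (groupVN G) Θ₁)
    (hΘ₁ : ∀ h : H, Θ₁ (subgroupUnitary h) = groupUnitary (ι b 1 h))
    (d : (diagVN (subgroupVN H)).Elem) (i k : Fin 2) :
    m.coeff (m.lam b (diagHom Θ₀ Θ₁ d)) i k = if i = k then m.JC (diagEntry d i) else 0 := by
  rw [coeff_lam, matEntry_diagHom]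
  split_ifs with h
  · subst h
    rw [Matrix.diagonal_apply_eq]
    fin_cases i
    · exact m.conjJ_eq hn₀ hΘ₀ _
    · exact m.conjJ_eq hn₁ hΘ₁ _
  · rw [Matrix.diagonal_apply_ne _ h, conjJ, map_zero, mul_zero, zero_mul]

end Amalgam

/-- The value of the conditional expectation onto the diagonal. -/
theorem exp_mem {ψ : (diagVN (subgroupVN H)).Elem →⋆ₐ[ℂ] m.alg.Elem}
    (hψ : ∀ d i k, m.coeff (ψ d) i k = if i = k then m.JC (diagEntry d i) else 0)
    (x : m.alg.Elem) : ∃ d, ∀ i k, m.coeff (ψ d) i k =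
      if i = k then groupExp c.base.range (m.coeff x i k) else 0 := by
  obtain ⟨d₀, h₀⟩ := m.exists_JC (groupExp_mem c.base.range (m.coeff x 0 0))
  obtain ⟨d₁, h₁⟩ := m.exists_JC (groupExp_mem c.base.range (m.coeff x 1 1))
  refine ⟨diagOf d₀ d₁, fun i k => ?_⟩
  rw [hψ]
  split_ifs with h
  · subst h
    fin_cases i
    · exact (congrArg m.JC (diagEntry_diagOf_zero d₀ d₁)).trans h₀
    · exact (congrArg m.JC (diagEntry_diagOf_one d₀ d₁)).trans h₁
  · rfl

theorem coeff_add (x y : m.alg.Elem) (i k : Fin 2) :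
    m.coeff (x + y) i k = m.coeff x i k + m.coeff y i k := by
  rw [coeff, map_add, matEntry_add]
  rfl

theorem coeff_smul (a : ℂ) (x : m.alg.Elem) (i k : Fin 2) :
    m.coeff (a • x) i k = a • m.coeff x i k := by
  rw [coeff, map_smul, matEntry_smul]
  rfl

/-- The conditional expectation onto the diagonal. -/
theorem exists_exp {ψ : (diagVN (subgroupVN H)).Elem →⋆ₐ[ℂ] m.alg.Elem}
    (hψ : ∀ d i k, m.coeff (ψ d) i k = if i = k then m.JC (diagEntry d i) else 0) :
    ∃ E : m.alg.Elem →ₗ[ℂ] m.alg.Elem, IsFaithfulNormalCondExp m.alg ψ.range E ∧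
      ∀ x i k, m.coeff (E x) i k =
        if i = k then groupExp c.base.range (m.coeff x i k) else 0 := by
  choose D hD using m.exp_mem hψ
  let E : m.alg.Elem →ₗ[ℂ] m.alg.Elem :=
    { toFun := fun x => ψ (D x)
      map_add' := fun x y => m.coeff_ext fun i k => by
        rw [coeff_add, hD, hD, hD, coeff_add, map_add]
        split_ifs
        · rfl
        · rw [add_zero]
      map_smul' := fun a x => m.coeff_ext fun i k => by
        rw [coeff_smul, hD, hD, coeff_smul, map_smul, RingHom.id_apply]
        split_ifs
        · rfl
        · rw [smul_zero] }
  have hE : ∀ x, E x = ψ (D x) := fun _ => rfl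
  refine ⟨E, ?_, fun x => hD x⟩
  have hp := isPartition_indOp (rightClass c.base.range)
  refine (isPartition_diagonal fun i => hp.split i).isFaithfulNormalCondExp (fun x => ?_)
    (fun x => ⟨D x, rfl⟩) ?_
  · refine entry_ext fun i k => ?_
    refine Eq.trans ?_
      (entry_cond_split hp (x : Doubled (ellTwo Γ) →L[ℂ] Doubled (ellTwo Γ)) i k).symm
    rw [← coe_coeff, hE, hD]
    split_ifs
    · rfl
    · rfl
  · rintro _ ⟨d, rfl⟩ ⟨a, j⟩
    refine diagonal_mul_comm fun i k => ?_
    change _ * (m.coeff (ψ d) i k : ellTwo Γ →L[ℂ] ellTwo Γ) =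
      (m.coeff (ψ d) i k : ellTwo Γ →L[ℂ] ellTwo Γ) * _
    rw [hψ]
    by_cases hik : i = k
    · subst hik
      rw [if_pos rfl]
      by_cases hj : j = i
      · simp only [hj, if_true]
        exact indOp_subgroupVN_comm _ a (m.JC_mem _)
      · simp only [hj, if_false, zero_mul, mul_zero]
    · rw [if_neg hik]
      exact (mul_zero _).trans (zero_mul _).symm

/-- The conditional expectation onto a copy of `M₂(L(G))`. -/
theorem exists_expθ (b : Bool) :
    ∃ E : m.alg.Elem →ₗ[ℂ] m.alg.Elem, IsFaithfulNormalCondExp m.alg (m.lam b).range E ∧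
      ∀ x i k, m.coeff (E x) i k = groupUnitary (c.p b i) *
        groupExp (c.f b).range (star (groupUnitary (c.p b i)) * m.coeff x i k *
          groupUnitary (c.p b k)) * star (groupUnitary (c.p b k)) := by
  have hD : ∀ x : m.alg.Elem, ∃ y : (matVN (groupVN G)).Elem, ∀ i k,
      m.coeff (m.lam b y) i k = groupUnitary (c.p b i) *
        groupExp (c.f b).range (star (groupUnitary (c.p b i)) * m.coeff x i k *
          groupUnitary (c.p b k)) * star (groupUnitary (c.p b k)) := by
    intro x
    choose y hy using fun i k => m.exists_J b (groupExp_mem (c.f b).range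
      (star (groupUnitary (c.p b i)) * m.coeff x i k * groupUnitary (c.p b k)))
    exact ⟨matFun y, fun i k => by rw [coeff_lam, matEntry_matFun, conjJ, hy]⟩
  choose D hD using hD
  let E : m.alg.Elem →ₗ[ℂ] m.alg.Elem :=
    { toFun := fun x => m.lam b (D x)
      map_add' := fun x y => m.coeff_ext fun i k => by
        rw [coeff_add, hD, hD, hD, coeff_add, mul_add, add_mul, map_add, mul_add, add_mul]
      map_smul' := fun a x => m.coeff_ext fun i k => by
        rw [coeff_smul, hD, hD, coeff_smul, mul_smul_comm, smul_mul_assoc, map_smul,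
          mul_smul_comm, smul_mul_assoc, RingHom.id_apply] }
  have hE : ∀ x, E x = m.lam b (D x) := fun _ => rfl
  refine ⟨E, ?_, fun x => hD x⟩
  have hp := isPartition_indOp (rightClass (c.f b).range)
  obtain ⟨w, hw⟩ : ∃ w : Fin 2 → ellTwo Γ →L[ℂ] ellTwo Γ, ∀ i, w i = leftReg (c.p b i) :=
    ⟨_, fun _ => rfl⟩
  have hu : ∀ i, star (w i) * w i = 1 := fun i => by
    rw [hw, ← leftReg_inv, ← leftReg_mul, inv_mul_cancel, leftReg_one]
  have hu' : ∀ i, w i * star (w i) = 1 := fun i => by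
    rw [hw, ← leftReg_inv, ← leftReg_mul, mul_inv_cancel, leftReg_one]
  -- In slot `i` the coset projections are conjugated by `p_i`. No slot index is added to the
  -- partition, so off-diagonal entries survive.
  refine (isPartition_diagonal fun i => hp.conj (hu i) (hu' i)).isFaithfulNormalCondExp
    (fun x => ?_) (fun x => ⟨D x, rfl⟩) ?_
  · refine entry_ext fun i k => ?_
    rw [entry_cond_conj hp hu hu', ← coe_coeff, hE, hD, hw, hw]
    rfl
  · rintro _ ⟨y, rfl⟩ a
    refine diagonal_mul_comm fun i k => ?_
    have h1 : entry (m.lam b y : Doubled (ellTwo Γ) →L[ℂ] Doubled (ellTwo Γ)) i k =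
        w i * (m.J b (matEntry y i k) : ellTwo Γ →L[ℂ] ellTwo Γ) * star (w k) := by
      rw [hw, hw]
      exact congrArg Subtype.val (m.coeff_lam b y i k)
    have h2 := indOp_subgroupVN_comm _ a (m.J_mem b (matEntry y i k))
    obtain ⟨T, hT⟩ : ∃ T, T = (m.J b (matEntry y i k) : ellTwo Γ →L[ℂ] ellTwo Γ) := ⟨_, rfl⟩
    obtain ⟨e, he⟩ : ∃ e, e = indOp (rightClass (c.f b).range ⁻¹' {a}) := ⟨_, rfl⟩
    change w i * indOp (rightClass (c.f b).range ⁻¹' {a}) * star (w i) * entry (m.lam b y :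
      Doubled (ellTwo Γ) →L[ℂ] Doubled (ellTwo Γ)) i k = entry (m.lam b y :
      Doubled (ellTwo Γ) →L[ℂ] Doubled (ellTwo Γ)) i k *
        (w k * indOp (rightClass (c.f b).range ⁻¹' {a}) * star (w k))
    rw [h1, ← hT, ← he]
    rw [← hT, ← he] at h2
    calc w i * e * star (w i) * (w i * T * star (w k))
        = w i * e * (star (w i) * w i) * T * star (w k) := by simp only [mul_assoc]
      _ = w i * (e * T) * star (w k) := by rw [hu, mul_one]; simp only [mul_assoc]
      _ = w i * T * (star (w k) * w k) * e * star (w k) := by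
          rw [h2, hu, mul_one]; simp only [mul_assoc]
      _ = w i * T * star (w k) * (w k * e * star (w k)) := by simp only [mul_assoc]

/-- Expectations onto nested subgroups, one of them translated. -/
theorem groupExp_translate (b : Bool) (i : Fin 2) (x : (groupVN Γ).Elem) :
    groupExp c.base.range (groupUnitary (c.p b i) *
      groupExp (c.f b).range (star (groupUnitary (c.p b i)) * x * groupUnitary (c.p b i)) *
        star (groupUnitary (c.p b i))) = groupExp c.base.range x := by
  classical
  refine Subtype.ext (ext_coeff fun k l => ?_)
  rw [groupExp_coeff, groupExp_coeff]
  split_ifs with h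
  · refine (translate_coeff _ (c.p b i) (c.p b i) k l).trans ?_
    rw [groupExp_coeff, if_pos]
    · have h1 : ((star (groupUnitary (c.p b i)) * x * groupUnitary (c.p b i) :
          (groupVN Γ).Elem) : ellTwo Γ →L[ℂ] ellTwo Γ) =
          leftReg (c.p b i)⁻¹ * (x : ellTwo Γ →L[ℂ] ellTwo Γ) * star (leftReg (c.p b i)⁻¹) := by
        rw [← leftReg_inv, inv_inv, leftReg_inv]
        rfl
      rw [h1, translate_coeff, inv_inv, mul_inv_cancel_left, mul_inv_cancel_left]
    -- The amalgam is contained in the conjugate of `f b (G)` by `p b i`, so the inner expectation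
    -- keeps this coefficient.
    · obtain ⟨a, ha⟩ := h
      refine ⟨ι b i a, ?_⟩
      have h2 := c.conj_eq b i a
      have h3 : l = c.base a * k := by rw [ha, inv_mul_cancel_right]
      rw [h3, ← h2]
      group
  · rfl

/-- The products of letters of the given kinds. -/
def wordSet (c : FreeConfiguration ι Γ) (w : List Bool) : Set Γ :=
  {γ | ∃ l : List (Bool × Γ), l.map Prod.fst = w ∧ (∀ x ∈ l, x.2 ∈ c.letters x.1) ∧
    (l.map Prod.snd).prod = γ}

theorem notMem_of_wordSet {w : List Bool} (hw : w ≠ []) (hc : w.IsChain (· ≠ ·)) {γ : Γ}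
    (hγ : γ ∈ wordSet c w) : γ ∉ c.base.range := by
  obtain ⟨l, rfl, h2, rfl⟩ := hγ
  exact c.free l (fun h => hw (by rw [h]; rfl)) ((List.isChain_map _).1 hc) h2

/-- An entry of the product is a sum of products of entries. The word set depends only on the
sequence of copies, so all summands are supported in the same set. -/
theorem suppIn_word (w : List (Bool × (matVN (groupVN G)).Elem))
    (hw : ∀ x ∈ w, ∀ i, groupExp (ι x.1 i).range (matEntry x.2 i i) = 0) (i k : Fin 2) :
    SuppIn (m.coeff (w.map fun x => m.lam x.1 x.2).prod i k : ellTwo Γ →L[ℂ] ellTwo Γ)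
      (wordSet c (w.map Prod.fst)) := by
  induction w generalizing i k with
  | nil =>
    rw [List.map_nil, List.prod_nil, coeff_one]
    split_ifs
    · refine suppIn_one.mono ?_
      rintro _ rfl
      exact ⟨[], rfl, by simp, rfl⟩
    · exact suppIn_zero _
  | cons x w ih =>
    rw [List.map_cons, List.prod_cons, coeff_mul, Fin.sum_univ_two]
    have key : ∀ l, SuppIn ((m.coeff (m.lam x.1 x.2) i l *
        m.coeff (w.map fun x => m.lam x.1 x.2).prod l k : (groupVN Γ).Elem) :
          ellTwo Γ →L[ℂ] ellTwo Γ) (wordSet c (x.1 :: w.map Prod.fst)) := by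
      intro l
      have h1 : SuppIn (m.coeff (m.lam x.1 x.2) i l : ellTwo Γ →L[ℂ] ellTwo Γ)
          (c.letters x.1) := by
        rw [coeff_lam]
        refine m.suppIn_letters x.1 i l _ ?_
        rintro rfl
        exact hw x List.mem_cons_self i
      refine (h1.mul (ih (fun y hy => hw y (List.mem_cons_of_mem _ hy)) l k)).mono ?_
      rintro _ ⟨a, ha, _, ⟨l', h2, h3, rfl⟩, rfl⟩
      refine ⟨(x.1, a) :: l', by simp [h2], ?_, by simp⟩
      intro y hy
      rcases List.mem_cons.1 hy with rfl | hy
      · exact ha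
      · exact h3 y hy
    exact (key 0).add (key 1)

end OperatorModel
end

noncomputable section

set_option linter.unusedSectionVars false

/-! ### Existence of the reduced HNN extension. -/

section Existence

variable {G : Type u} [Group G] {H : Subgroup G}

theorem matEntry_of_diagExp {K : Type*} [NormedAddCommGroup K] [InnerProductSpace ℂ K]
    [CompleteSpace K] {N : VonNeumannAlgebra K} {E₀ E₁ : N.Elem →ₗ[ℂ] N.Elem}
    {x : (matVN N).Elem} (h : diagExp E₀ E₁ x = 0) :
    E₀ (matEntry x 0 0) = 0 ∧ E₁ (matEntry x 1 1) = 0 := by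
  have h0 := matEntry_diagExp E₀ E₁ x 0 0
  have h1 := matEntry_diagExp E₀ E₁ x 1 1
  rw [h, matEntry_zero, Matrix.diagonal_apply_eq] at h0 h1
  exact ⟨h0.symm, h1.symm⟩

namespace OperatorModel

variable {ι : Bool → Fin 2 → H →* G} {Γ : Type u} [Group Γ] {c : FreeConfiguration ι Γ}
  (m : OperatorModel c)

theorem exp_lam {E : m.alg.Elem →ₗ[ℂ] m.alg.Elem}
    (hE : ∀ x i k, m.coeff (E x) i k =
      if i = k then groupExp c.base.range (m.coeff x i k) else 0)
    (b : Bool) (x : (matVN (groupVN G)).Elem) : E (m.lam b x) =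
      m.lam b (diagExp (groupExp (ι b 0).range) (groupExp (ι b 1).range) x) := by
  refine m.coeff_ext fun i k => ?_
  rw [hE, coeff_lam, coeff_lam, matEntry_diagExp]
  split_ifs with h
  · subst h
    rw [m.groupExp_conjJ, Matrix.diagonal_apply_eq]
    fin_cases i <;> rfl
  · rw [Matrix.diagonal_apply_ne _ h, conjJ, map_zero, mul_zero, zero_mul]

/-- The diagonal entries of the product are supported on alternating products of letters, which
avoid the amalgam by `c.free`; the off-diagonal entries are erased by `E`. -/
theorem exp_word {E : m.alg.Elem →ₗ[ℂ] m.alg.Elem}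
    (hE : ∀ x i k, m.coeff (E x) i k =
      if i = k then groupExp c.base.range (m.coeff x i k) else 0)
    {w : List (Bool × (matVN (groupVN G)).Elem)} (hne : w ≠ [])
    (hc : w.IsChain fun x y => x.1 ≠ y.1)
    (hw : ∀ x ∈ w, diagExp (groupExp (ι x.1 0).range) (groupExp (ι x.1 1).range) x.2 = 0) :
    E (w.map fun x => m.lam x.1 x.2).prod = 0 := by
  refine m.coeff_ext fun i k => ?_
  have h0 : m.coeff 0 i k = 0 := by
    rw [coeff, map_zero, matEntry_zero]
  rw [hE, h0]
  split_ifs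
  · refine groupExp_eq_zero (m.suppIn_word w (fun x hx i => ?_) i k) fun γ hγ =>
      notMem_of_wordSet (c := c) (w := w.map Prod.fst) ?_ ((List.isChain_map _).2 hc) hγ
    · have h := matEntry_of_diagExp (hw x hx)
      fin_cases i
      · exact h.1
      · exact h.2
    · exact fun h => hne (List.map_eq_nil_iff.1 h)
  · rfl

end OperatorModel

/-- A vanishing statement for alternating words over `Bool × A` yields one for alternating words
over `A ⊕ A`. -/
theorem prod_word_sum {A B C : Type*} [Monoid B] [Zero C] (f : Bool → A → B) (E : B → C)
    (p q : A → Prop)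
    (h : ∀ w : List (Bool × A), w ≠ [] → w.IsChain (fun x y => x.1 ≠ y.1) →
      (∀ x, (true, x) ∈ w → p x) → (∀ x, (false, x) ∈ w → q x) →
      E (w.map fun x => f x.1 x.2).prod = 0)
    (w : List (A ⊕ A)) (h1 : w ≠ []) (h2 : w.IsChain fun a b => a.isLeft ≠ b.isLeft)
    (h3 : ∀ x, Sum.inl x ∈ w → p x) (h4 : ∀ x, Sum.inr x ∈ w → q x) :
    E (w.map (Sum.elim (f true) (f false))).prod = 0 := by
  have h := h (w.map (Sum.elim (fun x => (true, x)) (fun x => (false, x))))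
    (fun h => h1 (List.map_eq_nil_iff.1 h))
    ((List.isChain_map _).2 (h2.imp fun x y hxy => by cases x <;> cases y <;> simp_all))
    (fun x hx => h3 x ?_) (fun x hx => h4 x ?_)
  · rw [List.map_map] at h
    rw [← h]
    congr 2
    refine List.map_congr_left fun x _ => ?_
    cases x <;> rfl
  all_goals
    obtain ⟨y, hy, hyx⟩ := List.mem_map.1 hx
    cases y <;> simp_all

/-- The reduced HNN extension of a group von Neumann algebra exists. -/
theorem nonempty_hnnConstruction {θ : H →* G} (hθ : Function.Injective θ)
    {Θ : (subgroupVN H).Elem →⋆ₐ[ℂ] (groupVN G).Elem}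
    (hn : IsNormalMap (subgroupVN H) (groupVN G) Θ)
    (hΘ : ∀ h : H, Θ (subgroupUnitary h) = groupUnitary (θ h)) :
    Nonempty (HNNConstruction.{u, u} (groupVN G) (subgroupVN H) (subgroupVN_le H) Θ
      (groupExp H) (groupExp θ.range)) := by
  -- The copy `true` carries `θ` and the copy `false` the inclusion of `H`. The second copy still
  -- needs a stable letter, which places its off-diagonal entries outside of the amalgam.
  obtain ⟨Γ, _, ⟨c⟩⟩ := exists_freeConfiguration (H := H)
    (θ := fun b => bif b then θ else H.subtype) (fun b => by
      cases b
      · exact H.subtype_injective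
      · exact hθ)
  obtain ⟨m⟩ := nonempty_operatorModel c
  have hni : IsNormalMap (subgroupVN H) (groupVN G) (VonNeumannAlgebra.incl (subgroupVN_le H)) :=
    isNormalMap_subtype _ fun _ => rfl
  have hlamθ := m.coeff_lam_diagHom (b := true) hni (fun _ => rfl) hn hΘ
  have hlam₁ := m.coeff_lam_diagHom (b := false) hni (fun _ => rfl) hni (fun _ => rfl)
  obtain ⟨ψ, hψ⟩ : ∃ ψ : (diagVN (subgroupVN H)).Elem →⋆ₐ[ℂ] m.alg.Elem,
      ∀ d, ψ d = m.lam true (diagHom (VonNeumannAlgebra.incl (subgroupVN_le H)) Θ d) :=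
    ⟨(m.lam true).comp (diagHom (VonNeumannAlgebra.incl (subgroupVN_le H)) Θ), fun _ => rfl⟩
  have hψ' : ∀ d i k, m.coeff (ψ d) i k = if i = k then m.JC (diagEntry d i) else 0 :=
    fun d i k => by rw [hψ, hlamθ]
  obtain ⟨E, hE, hEc⟩ := m.exists_exp hψ'
  obtain ⟨F, hF, hFc⟩ := m.exists_expθ true
  have e : groupExp H = groupExp H.subtype.range := by rw [H.range_subtype]
  have hcompat := m.exp_lam hEc
  have hfree : ∀ w : List (Bool × (matVN (groupVN G)).Elem), w ≠ [] →
      w.IsChain (fun x y => x.1 ≠ y.1) →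
      (∀ x, (true, x) ∈ w → diagExp (groupExp H) (groupExp θ.range) x = 0) →
      (∀ x, (false, x) ∈ w → diagExp (groupExp H) (groupExp H) x = 0) →
      E (w.map fun x => m.lam x.1 x.2).prod = 0 := by
    intro w h1 h2 h3 h4
    refine m.exp_word hEc h1 h2 ?_
    rintro ⟨b, x⟩ hx
    cases b
    · have := h4 x hx
      rw [e] at this
      exact this
    · have := h3 x hx
      rw [e] at this
      exact this
  refine ⟨{
    K := Doubled (ellTwo Γ)
    P := m.alg
    lamθ := m.lam true
    lam₁ := m.lam false
    lam := ψ
    Exp := E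
    Expθ := F
    condExp_Expθ := hF
    isAmalgamatedFreeProduct :=
      { injective₁ := m.lam_injective true
        injective₂ := m.lam_injective false
        normal₁ := m.lam_normal true
        normal₂ := m.lam_normal false
        amalgam₁ := fun d => (hψ d).symm
        amalgam₂ := fun d => m.coeff_ext fun i k => by
          rw [hψ', ← diagHom_incl (subgroupVN_le H), hlam₁]
        generates := m.alg_eq
        condExp := hE
        compatible₁ := fun x => by
          have h := hcompat true x
          rw [e]
          exact h
        compatible₂ := fun x => by
          have h := hcompat false x
          rw [e]
          exact h
        free := prod_word_sum (fun b => m.lam b) E _ _ hfree }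
    Exp_Expθ := fun x => m.coeff_ext fun i k => ?_ }⟩
  · rw [hEc, hEc]
    split_ifs with h
    · subst h
      rw [hFc, OperatorModel.groupExp_translate]
    · rfl

end Existence
end

theorem corollary3p5 {G : Type u} [Group G] (H : Subgroup G) (θ : H →* G)
    (hθ : Function.Injective θ) :
    ∃ (Θ : (subgroupVN H).Elem →⋆ₐ[ℂ] (groupVN G).Elem)
      (EH EθH : (groupVN G).Elem →ₗ[ℂ] (groupVN G).Elem)
      (j : (groupVN G).Elem →⋆ₐ[ℂ] (groupVN (GroupHNN H θ hθ)).Elem)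
      (EG : (groupVN (GroupHNN H θ hθ)).Elem →ₗ[ℂ] (groupVN (GroupHNN H θ hθ)).Elem),
      -- the normal embedding `L(H) → L(G)` induced by `θ`
      (Function.Injective Θ ∧ IsNormalMap (subgroupVN H) (groupVN G) Θ ∧
        ∀ h : H, Θ (subgroupUnitary h) = groupUnitary (θ h)) ∧
      -- the normal embedding `L(G) → L(G *_H θ)` induced by the inclusion of the base group
      (Function.Injective j ∧ IsNormalMap (groupVN G) (groupVN (GroupHNN H θ hθ)) j ∧
        ∀ g : G, j (groupUnitary g) = groupUnitary (HNNExtension.of g)) ∧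
      -- the trace preserving conditional expectations
      IsCanonicalCondExp (VonNeumannAlgebra.incl (subgroupVN_le H)).range EH ∧
      IsCanonicalCondExp Θ.range EθH ∧
      IsCanonicalCondExp j.range EG ∧
      -- the reduced HNN extension of `L(G)` by `Θ` exists
      Nonempty (HNNConstruction.{u, u} (groupVN G) (subgroupVN H) (subgroupVN_le H) Θ EH EθH) ∧
      -- and it is `L(G *_H θ)`, with stable unitary `λ(t)`
      ∀ X : HNNConstruction.{u, v} (groupVN G) (subgroupVN H) (subgroupVN_le H) Θ EH EθH,
        ∃ Φ : (groupVN (GroupHNN H θ hθ)).Elem →⋆ₙₐ[ℂ] X.P.Elem,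
          Function.Injective Φ ∧ Set.range Φ = X.algebra ∧
          IsNormalMap (groupVN (GroupHNN H θ hθ)) X.P Φ ∧
          (∀ n, Φ (j n) = X.base n) ∧
          Φ (groupUnitary HNNExtension.t) = X.stable ∧
          ∀ x, Φ (EG x) = X.Expθ (Φ x) := by
  obtain ⟨Θ, h1, h2, h3, t, ht, h4⟩ := exists_groupHom H.subtype H.subtype_injective θ hθ
    (subgroupVN_le θ.range) subgroupUnitary (fun _ => rfl) (generatedByRep_subgroupVN H)
    (fun h => subgroupUnitary ⟨θ h, h, rfl⟩) (fun _ => rfl) (generatedByRep_range θ)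
  have hΘn : IsNormalMap (subgroupVN H) (groupVN G) Θ := isNormalMap_krausMap h4
  have hΘ : ∀ h : H, Θ (subgroupUnitary h) = groupUnitary (θ h) := fun h => Subtype.ext (h3 h)
  obtain ⟨f, hf⟩ : ∃ f : G →* GroupHNN H θ hθ, f = HNNExtension.of := ⟨_, rfl⟩
  obtain ⟨j, k1, k2, k3, s, hs, k4⟩ := exists_groupHom (MonoidHom.id G) Function.injective_id f
    (hf ▸ HNNExtension.of_injective _) (subgroupVN_le f.range) groupUnitary (fun _ => rfl)
    generatedByRep_groupVN (fun g => subgroupUnitary ⟨f g, g, rfl⟩) (fun _ => rfl)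
    (generatedByRep_range f)
  have hjn : IsNormalMap (groupVN G) (groupVN (GroupHNN H θ hθ)) j := isNormalMap_krausMap k4
  have hj : ∀ g : G, j (groupUnitary g) = groupUnitary (HNNExtension.of g) := fun g =>
    Subtype.ext (hf ▸ k3 g)
  -- The range of `j` is the von Neumann algebra of the subgroup `f(G)`, so compression along the
  -- right cosets of that subgroup is the required expectation.
  have hEG : IsCanonicalCondExp j.range (groupExp f.range) :=
    k2 ▸ isCanonicalCondExp_groupExp f.range
  refine ⟨Θ, groupExp H, groupExp θ.range, j, groupExp f.range, ⟨h1, hΘn, hΘ⟩, ⟨k1, hjn, hj⟩,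
    isCanonicalCondExp_groupExp H, h2 ▸ isCanonicalCondExp_groupExp θ.range, hEG,
    nonempty_hnnConstruction hθ hΘn hΘ, fun X => ?_⟩
  obtain ⟨σ, hmul, hstar, hof, ht⟩ := X.exists_rep hθ hΘ
  exact X.exists_isomorphism hθ hmul hstar hof ht hjn hj hEG.1
    (fun γ hγ => groupExp_unitary_of_notMem (hf ▸ hγ))
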